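/- Let $q$ be a power of a prime $p$, $A=\mathbb F_q[t]$, $F=\mathbb F_q(t)$, and let $K$ be a finite (possibly inseparable) extension of $F$, with separable closure $K^{\rm sep}$ and absolute Galois group $G_K=\mathrm{Gal}(K^{\rm sep}/K)$. Let $\pi\in A$ be monic irreducible, $\mathbb F_\pi=A/\pi A$, $q_\pi=\#\mathbb F_\pi$. Let $r\ge 1$ and let $\phi:A\to K\{\tau\}$ be a Drinfeld module of rank $r$ over $K$, i.e. an $\mathbb F_q$-algebra homomorphism with $\phi_t=t+c_1\tau+\cdots+c_r\tau^r$, $c_r\neq 0$, where $\tau c=c^q\tau$. For $0\ne a\in A$ let $\phi[a]=\{\lambda\in K^{\rm sep}:\phi_a(\lambda)=0\}$; put $K(\phi[\pi^\infty])=K(\bigcup_{n\ge1}\phi[\pi^n])$. Let $\mathcal C$ be the Carlitz module, $\mathcal C_t=t+\tau$, and let $\chi_\pi:G_K\to \mathbb F_\pi^\times$ be the character giving the action of $G_K$ on the one-dimensional $\mathbb F_\pi$-vector space $\mathcal C[\pi]$. Put $L=K(\phi[\pi])\cap K(\mathcal C[\pi])$. A finite place of an algebraic extension of $F$ is a place lying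 above a maximal ideal of $A$. We say that $\phi$ has good reduction at a finite place $v$ of $K$ if it is isomorphic over the completion $K_v$ to a Drinfeld module $\psi$ with $\psi_t=t+c_1'\tau+\cdots+c_r'\tau^r$, all $c_i'\in\mathcal O_{K_v}$ and $c_r'\in\mathcal O_{K_v}^\times$. Then the following are equivalent: (DR-1) $K(\phi[\pi^\infty])/L$ is a pro-$p$ extension (Galois with pro-$p$ Galois group) which is unramified at every finite place of $L$ not lying above $\pi$. (DR-2) $\phi$ has good reduction at every finite place of $K$ not lying above $\pi$, and $K(\phi[\pi])/L$ is a $p$-extension (finite Galois with Galois group a $p$-group). (DR-3) $\phi$ has good reduction at every finite place of $K$ not lying above $\pi$, and there are integers $0\le i_1,\dots,i_r\le q_\pi-1$ and an $\mathbb F_\pi$-basis of $\phi[\pi]$ in which the mod $\pi$ representation $G_K\to \mathrm{GL}_{\mathbb F_\pi}(\phi[\pi])$ is upper triangular with diagonal entries $\chi_\pi^{i_1},\dots,\chi_\pi^{i_r}$. -/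

import Mathlib

open Polynomial

noncomputable section

/-! ### Twisted polynomials over an `A`-field, where `A = Fq[X]` -/

/-- The `q`-power Frobenius `x ↦ x ^ q` of a field `L` with structure map `ι : Fq[X] → L`,
where `q = #Fq`. -/
def qFrobenius {Fq L : Type*} [Field Fq] [Finite Fq] [Field L] (ι : Fq[X] →+* L) : L →+* L where
  toFun x := x ^ Nat.card Fq
  map_one' := one_pow _
  map_mul' x y := mul_pow x y _
  map_zero' := zero_pow Nat.card_pos.ne'
  map_add' x y := by
    let : Fintype Fq := Fintype.ofFinite Fq
    let : Algebra Fq L := (ι.comp C).toAlgebra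
    have h := map_add (FiniteField.frobeniusAlgHom Fq L) x y
    simpa [FiniteField.coe_frobeniusAlgHom, Nat.card_eq_fintype_card] using h

theorem qFrobenius_apply {Fq L : Type*} [Field Fq] [Finite Fq] [Field L] (ι : Fq[X] →+* L)
    (x : L) : qFrobenius ι x = x ^ Nat.card Fq := rfl

/-- Constants from `Fq` are fixed by the `q`-power Frobenius. -/
theorem qFrobenius_const {Fq L : Type*} [Field Fq] [Finite Fq] [Field L] (ι : Fq[X] →+* L)
    (a : Fq) : qFrobenius ι (ι (C a)) = ι (C a) := by
  let : Fintype Fq := Fintype.ofFinite Fq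
  rw [qFrobenius_apply, ← map_pow, ← map_pow, Nat.card_eq_fintype_card, FiniteField.pow_card]

/-- The action of `ℕ` on `L` through powers of the `q`-power Frobenius. -/
@[reducible]
def frobeniusAction {Fq L : Type*} [Field Fq] [Finite Fq] [Field L] (ι : Fq[X] →+* L) :
    MulSemiringAction (Multiplicative ℕ) L :=
  MulSemiringAction.compHom L (powersHom (L →+* L) (qFrobenius ι))

/-- The ring `L{τ}` of twisted polynomials: the skew polynomial ring with `τ c = c ^ q τ`. -/
def TwistedPoly {Fq L : Type*} [Field Fq] [Finite Fq] [Field L] (_ι : Fq[X] →+* L) : Type _ :=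
  SkewPolynomial L

namespace TwistedPoly

instance {Fq L : Type*} [Field Fq] [Finite Fq] [Field L] (ι : Fq[X] →+* L) :
    Ring (TwistedPoly ι) :=
  letI := frobeniusAction ι
  inferInstanceAs (Ring (SkewMonoidAlgebra L (Multiplicative ℕ)))

section

variable {Fq L : Type*} [Field Fq] [Finite Fq] [Field L] (ι : Fq[X] →+* L)

/-- The coefficient of `τ ^ n`. -/
def coeff {ι : Fq[X] →+* L} (f : TwistedPoly ι) (n : ℕ) : L := SkewPolynomial.coeff f n

/-- The inclusion of constants `L → L{τ}`. -/
def const : L →+* TwistedPoly ι :=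
  letI := frobeniusAction ι
  SkewMonoidAlgebra.singleOneRingHom (k := L) (G := Multiplicative ℕ)

/-- The powers of `τ`. -/
def tauPow : Multiplicative ℕ →* TwistedPoly ι :=
  letI := frobeniusAction ι
  SkewMonoidAlgebra.of L (Multiplicative ℕ)

/-- The variable `τ`. -/
def tau : TwistedPoly ι := tauPow ι (Multiplicative.ofAdd 1)

theorem frobeniusAction_smul (n : Multiplicative ℕ) (x : L) :
    (letI := frobeniusAction ι; n • x) = (qFrobenius ι ^ n.toAdd) x := rfl

theorem tauPow_mul_const (n : Multiplicative ℕ) (x : L) :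
    tauPow ι n * const ι x = const ι ((qFrobenius ι ^ n.toAdd) x) * tauPow ι n := by
  let := frobeniusAction ι
  refine (SkewMonoidAlgebra.single_mul_single (k := L)).trans
    (Eq.trans ?_ (SkewMonoidAlgebra.single_mul_single (k := L)).symm)
  rw [frobeniusAction_smul, one_mul, mul_one, one_mul, smul_one, mul_one]

theorem const_mul_tauPow (x : L) (n : Multiplicative ℕ) :
    const ι x * tauPow ι n = (SkewMonoidAlgebra.single n x : SkewMonoidAlgebra L _) := by
  let := frobeniusAction ι
  refine (SkewMonoidAlgebra.single_mul_single (k := L)).trans ?_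
  rw [one_mul, smul_one, mul_one]

/-- The commutation rule `τ c = c ^ q τ`. -/
theorem tau_mul_const (x : L) : tau ι * const ι x = const ι (x ^ Nat.card Fq) * tau ι := by
  simpa [tau, qFrobenius_apply] using tauPow_mul_const ι (Multiplicative.ofAdd 1) x

theorem coeff_add (f g : TwistedPoly ι) (n : ℕ) : (f + g).coeff n = f.coeff n + g.coeff n :=
  DFunLike.congr_fun (SkewMonoidAlgebra.coeff_add (k := L) f g) (Multiplicative.ofAdd n)

theorem coeff_const_mul_tauPow (x : L) (m n : ℕ) :
    (const ι x * tauPow ι (Multiplicative.ofAdd m)).coeff n = if m = n then x else 0 := by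
  rw [const_mul_tauPow]
  exact SkewPolynomial.coeff_monomial

theorem coeff_const (x : L) (n : ℕ) : (const ι x).coeff n = if 0 = n then x else 0 := by
  have h := coeff_const_mul_tauPow ι x 0 n
  rwa [ofAdd_zero, map_one, mul_one] at h

theorem coeff_tau (n : ℕ) : (tau ι).coeff n = if 1 = n then 1 else 0 := by
  have h := coeff_const_mul_tauPow ι 1 1 n
  rwa [map_one, one_mul] at h

theorem induction {motive : TwistedPoly ι → Prop} (P : TwistedPoly ι)
    (zero : motive 0) (add : ∀ f g, motive f → motive g → motive (f + g))
    (monomial : ∀ (x : L) (n : ℕ), motive (const ι x * tauPow ι (Multiplicative.ofAdd n))) :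
    motive P := by
  refine SkewMonoidAlgebra.induction_on (k := L) (p := motive) P zero ?_ (fun f g => add f g)
  intro n x
  have h := monomial x n.toAdd
  rwa [const_mul_tauPow] at h

theorem map_qFrobenius_pow {M : Type*} [Field M] (f : L →+* M) (n : ℕ) (x : L) :
    f ((qFrobenius ι ^ n) x) = (qFrobenius (f.comp ι) ^ n) (f x) := by
  induction n generalizing x with
  | zero => rfl
  | succ n ih =>
    rw [pow_succ, pow_succ]
    change f ((qFrobenius ι ^ n) (qFrobenius ι x)) = (qFrobenius (f.comp ι) ^ n)
      (qFrobenius (f.comp ι) (f x))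
    rw [ih, qFrobenius_apply, qFrobenius_apply, map_pow]

theorem qFrobenius_pow_apply (n : ℕ) (x : L) :
    (qFrobenius ι ^ n) x = x ^ (Nat.card Fq ^ n) := by
  induction n generalizing x with
  | zero => simp
  | succ n ih =>
    rw [pow_succ]
    change (qFrobenius ι ^ n) (qFrobenius ι x) = _
    rw [ih, qFrobenius_apply, ← pow_mul, pow_succ, mul_comm]

/-- The `q`-power Frobenius as an endomorphism of the additive group of `L`. -/
def frobeniusEnd : AddMonoid.End L := (qFrobenius ι).toAddMonoidHom

theorem frobeniusEnd_pow_apply (n : ℕ) (x : L) :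
    (frobeniusEnd ι ^ n) x = x ^ (Nat.card Fq ^ n) := by
  induction n generalizing x with
  | zero => simp
  | succ n ih =>
    rw [pow_succ]
    change (frobeniusEnd ι ^ n) (qFrobenius ι x) = _
    rw [ih, qFrobenius_apply, ← pow_mul, pow_succ, mul_comm]

/-- A ring homomorphism `f : L → M` induces `L{τ} → M{τ}`, applying `f` to the coefficients. -/
def map {M : Type*} [Field M] (f : L →+* M) : TwistedPoly ι →+* TwistedPoly (f.comp ι) :=
  letI := frobeniusAction ι
  SkewMonoidAlgebra.liftNCRingHom ((const (f.comp ι)).comp f) (tauPow (f.comp ι)) (by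
    intro x y
    change const (f.comp ι) (f ((qFrobenius ι ^ y.toAdd) x)) * _ = _ * const (f.comp ι) (f x)
    rw [tauPow_mul_const, map_qFrobenius_pow])

theorem map_const {M : Type*} [Field M] (f : L →+* M) (x : L) :
    map ι f (const ι x) = const (f.comp ι) (f x) := by
  let := frobeniusAction ι
  refine (SkewMonoidAlgebra.liftNC_single _ _ _ _).trans ?_
  simp

theorem map_tauPow {M : Type*} [Field M] (f : L →+* M) (n : Multiplicative ℕ) :
    map ι f (tauPow ι n) = tauPow (f.comp ι) n := by
  let := frobeniusAction ι
  refine (SkewMonoidAlgebra.liftNC_single _ _ _ _).trans ?_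
  simp

theorem coeff_map {M : Type*} [Field M] (f : L →+* M) (P : TwistedPoly ι) (n : ℕ) :
    (map ι f P).coeff n = f (P.coeff n) := by
  induction P using induction with
  | zero => rw [map_zero]; exact (map_zero f).symm
  | add P Q hP hQ => rw [map_add, coeff_add, coeff_add, hP, hQ, map_add]
  | monomial x m =>
    rw [map_mul, map_const, map_tauPow, coeff_const_mul_tauPow, coeff_const_mul_tauPow]
    split_ifs <;> simp

/-- The action of `L{τ}` on the additive group of an extension `E` of `L`:
`∑ cᵢ τ ^ i` acts as `x ↦ ∑ cᵢ x ^ (q ^ i)`. -/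
def eval (E : Type*) [Field E] [Algebra L E] : TwistedPoly ι →+* AddMonoid.End E :=
  letI := frobeniusAction ι
  SkewMonoidAlgebra.liftNCRingHom (k := L) (G := Multiplicative ℕ)
    ((Module.toAddMonoidEnd E E).comp (algebraMap L E))
    (powersHom (AddMonoid.End E) (frobeniusEnd ((algebraMap L E).comp ι))) (by
    intro x y
    ext z
    change algebraMap L E ((qFrobenius ι ^ y.toAdd) x) *
      (frobeniusEnd ((algebraMap L E).comp ι) ^ y.toAdd) z =
      (frobeniusEnd ((algebraMap L E).comp ι) ^ y.toAdd) (algebraMap L E x * z)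
    rw [qFrobenius_pow_apply, frobeniusEnd_pow_apply, frobeniusEnd_pow_apply, map_pow, mul_pow])

theorem eval_const_mul_tauPow (E : Type*) [Field E] [Algebra L E] (c : L) (n : ℕ) (x : E) :
    eval ι E (const ι c * tauPow ι (Multiplicative.ofAdd n)) x =
      algebraMap L E c * x ^ (Nat.card Fq ^ n) := by
  let := frobeniusAction ι
  rw [const_mul_tauPow]
  refine (DFunLike.congr_fun (SkewMonoidAlgebra.liftNC_single _ _ _ _) x).trans ?_
  change algebraMap L E c *
    (frobeniusEnd ((algebraMap L E).comp ι) ^ n) x = _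
  rw [frobeniusEnd_pow_apply]

/-- The action of `L{τ}` on `E` commutes with `L`-automorphisms of `E`. -/
theorem eval_algEquiv (E : Type*) [Field E] [Algebra L E] (σ : E ≃ₐ[L] E) (P : TwistedPoly ι)
    (x : E) : σ (eval ι E P x) = eval ι E P (σ x) := by
  induction P using induction with
  | zero => simp
  | add P Q hP hQ =>
    rw [map_add]
    exact (map_add σ _ _).trans (congrArg₂ _ hP hQ)
  | monomial c n =>
    rw [eval_const_mul_tauPow, eval_const_mul_tauPow, map_mul, map_pow, AlgEquiv.commutes]

end

end TwistedPoly

/-! ### Drinfeld modules -/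

/-- A Drinfeld module of rank `r` over the `A`-field `(L, ι)`: an `Fq`-algebra homomorphism
`φ : A → L{τ}` with `φ_X = ι(X) + c₁ τ + ⋯ + c_r τ ^ r` and `c_r ≠ 0`. -/
structure DrinfeldModule {Fq L : Type*} [Field Fq] [Finite Fq] [Field L] (ι : Fq[X] →+* L)
    (r : ℕ) where
  toRingHom : Fq[X] →+* TwistedPoly ι
  map_C : ∀ a : Fq, toRingHom (C a) = TwistedPoly.const ι (ι (C a))
  coeff_zero : (toRingHom X).coeff 0 = ι X
  coeff_rank_ne_zero : (toRingHom X).coeff r ≠ 0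
  coeff_eq_zero : ∀ n, r < n → (toRingHom X).coeff n = 0

namespace DrinfeldModule

section

variable {Fq L : Type*} [Field Fq] [Finite Fq] [Field L] {ι : Fq[X] →+* L} {r : ℕ}

/-- The coefficient `cᵢ` of `φ_X = ι(X) + c₁ τ + ⋯ + c_r τ ^ r`. -/
def coeff (φ : DrinfeldModule ι r) (i : ℕ) : L := (φ.toRingHom X).coeff i

/-- Morphisms `φ → ψ`: elements `f ∈ L{τ}` with `f φ_a = ψ_a f` for all `a`. -/
def IsMorphism {s : ℕ} (φ : DrinfeldModule ι r) (ψ : DrinfeldModule ι s) (f : TwistedPoly ι) :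
    Prop :=
  ∀ a : Fq[X], f * φ.toRingHom a = ψ.toRingHom a * f

/-- `φ` and `ψ` are isomorphic over `L`. -/
def IsIsomorphic {s : ℕ} (φ : DrinfeldModule ι r) (ψ : DrinfeldModule ι s) : Prop :=
  ∃ f g : TwistedPoly ι, IsMorphism φ ψ f ∧ IsMorphism ψ φ g ∧ f * g = 1 ∧ g * f = 1

/-- Base change of a Drinfeld module along a field homomorphism. -/
def map {M : Type*} [Field M] (φ : DrinfeldModule ι r) (f : L →+* M) :
    DrinfeldModule (f.comp ι) r where
  toRingHom := (TwistedPoly.map ι f).comp φ.toRingHom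
  map_C a := by
    rw [RingHom.comp_apply, φ.map_C, TwistedPoly.map_const]
    rfl
  coeff_zero := by
    rw [RingHom.comp_apply, TwistedPoly.coeff_map, φ.coeff_zero]
    rfl
  coeff_rank_ne_zero := by
    rw [RingHom.comp_apply, TwistedPoly.coeff_map]
    exact (map_ne_zero f).2 φ.coeff_rank_ne_zero
  coeff_eq_zero n hn := by
    rw [RingHom.comp_apply, TwistedPoly.coeff_map, φ.coeff_eq_zero n hn, map_zero]

/-- The Carlitz module `C_X = ι(X) + τ`. -/
def carlitz (ι : Fq[X] →+* L) : DrinfeldModule ι 1 where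
  toRingHom := eval₂RingHom' ((TwistedPoly.const ι).comp (ι.comp C))
    (TwistedPoly.const ι (ι X) + TwistedPoly.tau ι) (by
      intro a
      refine Commute.add_right ?_ ?_
      · change TwistedPoly.const ι _ * _ = _ * TwistedPoly.const ι _
        rw [← map_mul, ← map_mul, mul_comm]
      · change TwistedPoly.const ι (ι (C a)) * _ = _ * TwistedPoly.const ι (ι (C a))
        rw [TwistedPoly.tau_mul_const, ← qFrobenius_apply ι, qFrobenius_const])
  map_C a := by simp
  coeff_zero := by simp [TwistedPoly.coeff_add, TwistedPoly.coeff_const, TwistedPoly.coeff_tau]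
  coeff_rank_ne_zero := by
    simp [TwistedPoly.coeff_add, TwistedPoly.coeff_const, TwistedPoly.coeff_tau]
  coeff_eq_zero n hn := by
    simp [TwistedPoly.coeff_add, TwistedPoly.coeff_const, TwistedPoly.coeff_tau, hn.ne,
      (zero_lt_one.trans hn).ne]

/-! ### Torsion points and Galois representations -/

/-- The additive group of an extension `E` of `L`, with the `A`-module structure
`a • x = φ_a(x)`. -/
def Points (_φ : DrinfeldModule ι r) (E : Type*) [Field E] [Algebra L E] : Type _ := E

instance (φ : DrinfeldModule ι r) (E : Type*) [Field E] [Algebra L E] :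
    AddCommGroup (φ.Points E) :=
  inferInstanceAs (AddCommGroup E)

instance (φ : DrinfeldModule ι r) (E : Type*) [Field E] [Algebra L E] :
    Module Fq[X] (φ.Points E) :=
  Module.compHom E ((TwistedPoly.eval ι E).comp φ.toRingHom)

theorem smul_def (φ : DrinfeldModule ι r) (E : Type*) [Field E] [Algebra L E] (a : Fq[X])
    (x : φ.Points E) : a • x = TwistedPoly.eval ι E (φ.toRingHom a) x := rfl

/-- The `A`-module `φ[a]` of `a`-torsion points of `φ` in the separable closure of `L`. -/
abbrev torsion (φ : DrinfeldModule ι r) (a : Fq[X]) :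
    Submodule Fq[X] (φ.Points (SeparableClosure L)) :=
  Submodule.torsionBy Fq[X] (φ.Points (SeparableClosure L)) a

/-- The underlying set of `φ[a]` in the separable closure of `L`. -/
def torsionSet (φ : DrinfeldModule ι r) (a : Fq[X]) : Set (SeparableClosure L) :=
  {x | TwistedPoly.eval ι (SeparableClosure L) (φ.toRingHom a) x = 0}

theorem mem_torsion_iff (φ : DrinfeldModule ι r) (a : Fq[X]) (x : SeparableClosure L) :
    (x : φ.Points (SeparableClosure L)) ∈ φ.torsion a ↔ x ∈ φ.torsionSet a := Iff.rfl

/-- A Galois automorphism as an automorphism of the `A`-module `φ[a]`. -/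
def galTorsion (φ : DrinfeldModule ι r) (a : Fq[X])
    (σ : SeparableClosure L ≃ₐ[L] SeparableClosure L) : φ.torsion a →ₗ[Fq[X]] φ.torsion a where
  toFun x := ⟨(σ x.1 : SeparableClosure L), by
    have hx : TwistedPoly.eval ι (SeparableClosure L) (φ.toRingHom a) x.1 = 0 := x.2
    refine (φ.mem_torsion_iff a _).2 ?_
    exact (TwistedPoly.eval_algEquiv ι _ σ (φ.toRingHom a) x.1).symm.trans
      ((congrArg σ hx).trans (map_zero σ))⟩
  map_add' x y := Subtype.ext (map_add σ x.1 y.1)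
  map_smul' b x := Subtype.ext (TwistedPoly.eval_algEquiv ι _ σ (φ.toRingHom b) x.1)

/-- The representation of the absolute Galois group of `L` on the `A/aA`-module `φ[a]`. -/
def modRep (φ : DrinfeldModule ι r) (a : Fq[X]) :
    Representation (Fq[X] ⧸ Ideal.span {a}) (SeparableClosure L ≃ₐ[L] SeparableClosure L)
      (φ.torsion a) where
  toFun σ :=
    { toFun := φ.galTorsion a σ
      map_add' := map_add (φ.galTorsion a σ)
      map_smul' := by
        intro b x
        obtain ⟨b, rfl⟩ := Ideal.Quotient.mk_surjective b
        exact map_smul (φ.galTorsion a σ) b x }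
  map_one' := rfl
  map_mul' _ _ := rfl

/-- The field `L(φ[a])`. -/
def torsionField (φ : DrinfeldModule ι r) (a : Fq[X]) :
    IntermediateField L (SeparableClosure L) :=
  IntermediateField.adjoin L (φ.torsionSet a)

/-- The field `L(φ[a ^ ∞])` generated by `⋃_{n ≥ 1} φ[a ^ n]`. -/
def powTorsionField (φ : DrinfeldModule ι r) (a : Fq[X]) :
    IntermediateField L (SeparableClosure L) :=
  IntermediateField.adjoin L (⋃ n ≥ 1, φ.torsionSet (a ^ n))

theorem torsionField_le_powTorsionField (φ : DrinfeldModule ι r) (a : Fq[X]) :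
    φ.torsionField a ≤ φ.powTorsionField a := by
  refine IntermediateField.adjoin.mono _ _ _ fun x hx => ?_
  refine Set.mem_iUnion₂.2 ⟨1, le_refl _, ?_⟩
  rwa [pow_one]

end

end DrinfeldModule

/-- The mod `π` Carlitz character of the absolute Galois group of `L`: the action on the
`A/πA`-line `C[π]`, where the automorphisms of a line are identified with scalars by `det`. -/
def carlitzCharacter {Fq L : Type*} [Field Fq] [Finite Fq] [Field L] (ι : Fq[X] →+* L)
    (π : Fq[X]) :
    (SeparableClosure L ≃ₐ[L] SeparableClosure L) →* (Fq[X] ⧸ Ideal.span {π})ˣ :=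
  MonoidHom.toHomUnits (LinearMap.det.comp ((DrinfeldModule.carlitz ι).modRep π))

/-! ### Finite places, reduction and ramification -/

/-- A finite place of an extension `(L, ι)` of `A`: a nontrivial valuation ring of `L`
containing the image of `A`. -/
structure FinitePlace {Fq L : Type*} [Field Fq] [Field L] (ι : Fq[X] →+* L) where
  ring : ValuationSubring L
  ne_top : ring ≠ ⊤
  map_mem : ∀ a : Fq[X], ι a ∈ ring

namespace FinitePlace

variable {Fq L : Type*} [Field Fq] [Field L] {ι : Fq[X] →+* L}

/-- `v` lies above `π`, i.e. `π` has positive valuation at `v`. -/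
def LiesAbove (v : FinitePlace ι) (π : Fq[X]) : Prop := v.ring.valuation (ι π) < 1

/-- The completion of `L` at `v`. -/
abbrev completion (v : FinitePlace ι) : Type _ := v.ring.valuation.Completion

/-- The embedding of `L` in its completion at `v`. -/
def toCompletion (v : FinitePlace ι) : L →+* v.completion :=
  UniformSpace.Completion.coeRingHom.comp (WithVal.equiv v.ring.valuation).symm.toRingHom

end FinitePlace

namespace DrinfeldModule

variable {Fq L : Type*} [Field Fq] [Finite Fq] [Field L] {ι : Fq[X] →+* L} {r : ℕ}

/-- `ψ` is a Drinfeld module over the completion `L_v`, isomorphic to `φ` over `L_v`, with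
`ψ_X = ι(X) + c₁' τ + ⋯ + c_r' τ ^ r` where all `cᵢ'` are in the valuation ring of `L_v` and some
`cᵢ'`, `1 ≤ i ≤ r`, is a unit of it. -/
def IsStableModel (φ : DrinfeldModule ι r) (v : FinitePlace ι)
    (ψ : DrinfeldModule (v.toCompletion.comp ι) r) : Prop :=
  (φ.map v.toCompletion).IsIsomorphic ψ ∧
    (∀ i, 1 ≤ i → i ≤ r → Valued.v (ψ.coeff i) ≤ 1) ∧
    ∃ i, 1 ≤ i ∧ i ≤ r ∧ Valued.v (ψ.coeff i) = 1

/-- `φ` has good reduction at `v`: it has a stable model over `L_v` whose top coefficient is a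
unit. -/
def HasGoodReduction (φ : DrinfeldModule ι r) (v : FinitePlace ι) : Prop :=
  ∃ ψ : DrinfeldModule (v.toCompletion.comp ι) r,
    φ.IsStableModel v ψ ∧ Valued.v (ψ.coeff r) = 1

end DrinfeldModule

/-- `M/L` is unramified at the valuation ring `w` of `L`: the inertia group of every valuation
ring of `M` above `w` is trivial (for `M/L` Galois, possibly infinite). -/
def IsUnramifiedAtPlace (L M : Type*) [Field L] [Field M] [Algebra L M] (w : ValuationSubring L) :
    Prop :=
  ∀ W : ValuationSubring M, W.comap (algebraMap L M) = w → W.inertiaSubgroup L = ⊥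

/-- `M/L` is a finite Galois extension whose Galois group is a `p`-group. -/
def IsPExtension (p : ℕ) (L M : Type*) [Field L] [Field M] [Algebra L M] : Prop :=
  FiniteDimensional L M ∧ IsGalois L M ∧ IsPGroup p (M ≃ₐ[L] M)

/-- `M/L` is a Galois extension whose (profinite) Galois group is pro-`p`: every open normal
subgroup has index a power of `p`. -/
def IsProPExtension (p : ℕ) (L M : Type*) [Field L] [Field M] [Algebra L M] : Prop :=
  IsGalois L M ∧
    ∀ U : Subgroup (M ≃ₐ[L] M), U.Normal → IsOpen (U : Set (M ≃ₐ[L] M)) → ∃ k, U.index = p ^ k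

/-! ### The three conditions -/

/-- The structure map of an extension `K` of `F = Fq(X)` as an `A`-field: `A ⊆ F → K`. -/
def structureMap (Fq K : Type*) [Field Fq] [Field K] [Algebra (RatFunc Fq) K] : Fq[X] →+* K :=
  (algebraMap (RatFunc Fq) K).comp (algebraMap Fq[X] (RatFunc Fq))

namespace DrinfeldModule

variable {Fq K : Type*} [Field Fq] [Finite Fq] [Field K] {ι : Fq[X] →+* K} {r : ℕ}

/-- The field `L = K(φ[π]) ∩ K(C[π])`. -/
def interField (φ : DrinfeldModule ι r) (π : Fq[X]) : IntermediateField K (SeparableClosure K) :=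
  φ.torsionField π ⊓ (carlitz ι).torsionField π

theorem interField_le_torsionField (φ : DrinfeldModule ι r) (π : Fq[X]) :
    φ.interField π ≤ φ.torsionField π := inf_le_left

theorem interField_le_powTorsionField (φ : DrinfeldModule ι r) (π : Fq[X]) :
    φ.interField π ≤ φ.powTorsionField π :=
  (φ.interField_le_torsionField π).trans (φ.torsionField_le_powTorsionField π)

/-- Good reduction at every finite place of `K` not lying above `π`. -/
def HasGoodReductionOutside (φ : DrinfeldModule ι r) (π : Fq[X]) : Prop :=
  ∀ v : FinitePlace ι, ¬ v.LiesAbove π → φ.HasGoodReduction v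

/-- In some basis of `φ[π]` over `A/πA`, the mod `π` representation is upper triangular with
diagonal entries `χ_π ^ i₁, …, χ_π ^ i_r`, where `0 ≤ i₁, …, i_r ≤ #(A/πA) - 1`. -/
def IsCarlitzTriangular (φ : DrinfeldModule ι r) (π : Fq[X]) : Prop :=
  ∃ (b : Module.Basis (Fin r) (Fq[X] ⧸ Ideal.span {π}) (φ.torsion π)) (i : Fin r → ℕ),
    (∀ j, i j ≤ Nat.card (Fq[X] ⧸ Ideal.span {π}) - 1) ∧
    ∀ σ : SeparableClosure K ≃ₐ[K] SeparableClosure K,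
      (∀ j k, k < j → LinearMap.toMatrix b b (φ.modRep π σ) j k = 0) ∧
      ∀ j, LinearMap.toMatrix b b (φ.modRep π σ) j j = (carlitzCharacter ι π σ) ^ i j

/-- `K(φ[π ^ ∞])/L` is a pro-`p` extension, unramified at every finite place of `L` not lying
above `π`. -/
def ConditionDR1 (p : ℕ) (φ : DrinfeldModule ι r) (π : Fq[X]) : Prop :=
  IsProPExtension p (φ.interField π)
      (IntermediateField.extendScalars (φ.interField_le_powTorsionField π)) ∧
    ∀ w : FinitePlace ((algebraMap K (φ.interField π)).comp ι), ¬ w.LiesAbove π →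
      IsUnramifiedAtPlace (φ.interField π)
        (IntermediateField.extendScalars (φ.interField_le_powTorsionField π)) w.ring

/-- `φ` has good reduction at every finite place of `K` not lying above `π`, and `K(φ[π])/L` is a
`p`-extension. -/
def ConditionDR2 (p : ℕ) (φ : DrinfeldModule ι r) (π : Fq[X]) : Prop :=
  φ.HasGoodReductionOutside π ∧
    IsPExtension p (φ.interField π)
      (IntermediateField.extendScalars (φ.interField_le_torsionField π))

/-- `φ` has good reduction at every finite place of `K` not lying above `π`, and its mod `π`
representation is triangular with powers of the mod `π` Carlitz character on the diagonal. -/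
def ConditionDR3 (φ : DrinfeldModule ι r) (π : Fq[X]) : Prop :=
  φ.HasGoodReductionOutside π ∧ φ.IsCarlitzTriangular π

end DrinfeldModule

end

/-! Conditions (DR-2) and (DR-3) differ only in their Galois-theoretic half, and both halves say
that the kernel of $\chi_\pi$ acts on $\phi[\pi]$ through a $p$-group. For (DR-2) this is
`isPExtension_torsionField_iff`: the group fixing $L$ is generated by the groups fixing
$K(\phi[\pi])$ and $K(\mathcal C[\pi])$, and the first acts trivially on $\phi[\pi]$. For (DR-3) it
is pure representation theory (`exists_triangular_basis_iff`): a $p$-group acting in characteristic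
$p$ has a nonzero fixed vector, the fixed space of $\ker\chi_\pi$ carries an action of the cyclic
image of $\chi_\pi$, whose eigenvalues are powers of the value at a generator, and one inducts on
quotients. Conversely, a triangular matrix with ones on the diagonal has $p$-power order.

The group-theoretic halves of (DR-1) and (DR-2) agree because an automorphism trivial on $\phi[\pi]$
is unipotent on every $\phi[\pi^n]$, hence of $p$-power order there (`exists_pow_apply_eq`).

The ramification half is a Néron–Ogg–Shafarevich criterion. If $\phi$ has a model with integral
coefficients and unit top coefficient at a place away from $\pi$, its $\pi$-power division points
are integral and reduce injectively, so inertia fixes them (`IsGoodModel.inertia_apply_eq`).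

For the converse, the only consequence of unramifiedness that is needed concerns absolute values.
The extension $K(\phi[\pi^\infty])/L$ is unramified outside $\pi$, and $L$ lies in $K(\mathcal
C[\pi])$, which is unramified outside $\pi$ because the Carlitz module has good reduction
everywhere. Hence every nonzero $\pi$-power division point has the absolute value of an element of
$K$ (`exists_valuation_eq_of_inertiaSubgroup_eq_bot`). Rescaling by an element of $K$ makes the
smallest nonzero point of $\phi[\pi]$ a unit, so $\phi_\pi$ becomes integral with a unit coefficient
beyond the constant one. If the top coefficient were not a unit, some division point would have
absolute value above one; repeated preimages under $\phi_\pi$ would keep that property while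
shrinking strictly, which a discrete valuation forbids (`valuation_top_eq_one`). Finally $\phi_t$ is
integral because it commutes with $\phi_\pi$ (`valuation_coeff_le_one`). -/

/-! ### Arithmetic of twisted polynomials and their additive polynomials. -/

namespace TwistedPoly

variable {Fq L : Type*} [Field Fq] [Finite Fq] [Field L] {ι : Fq[X] →+* L}

theorem coeff_zero_apply (n : ℕ) : (0 : TwistedPoly ι).coeff n = 0 := rfl

theorem ext_coeff {f g : TwistedPoly ι} (h : ∀ n, f.coeff n = g.coeff n) : f = g :=
  SkewPolynomial.ext h

theorem coeff_one (n : ℕ) : (1 : TwistedPoly ι).coeff n = if 0 = n then 1 else 0 := by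
  rw [← map_one (const ι), coeff_const]

/-- The coefficient maps as additive homomorphisms. -/
def coeffHom (ι : Fq[X] →+* L) (n : ℕ) : TwistedPoly ι →+ L where
  toFun f := f.coeff n
  map_zero' := rfl
  map_add' f g := coeff_add ι f g n

theorem coeff_sum {α : Type*} (s : Finset α) (f : α → TwistedPoly ι) (n : ℕ) :
    (∑ i ∈ s, f i).coeff n = ∑ i ∈ s, (f i).coeff n :=
  map_sum (coeffHom ι n) f s

theorem monomial_mul_monomial (x y : L) (m n : ℕ) :
    const ι x * tauPow ι (Multiplicative.ofAdd m) * (const ι y * tauPow ι (Multiplicative.ofAdd n)) =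
      const ι (x * y ^ Nat.card Fq ^ m) * tauPow ι (Multiplicative.ofAdd (m + n)) := by
  rw [mul_assoc, ← mul_assoc (tauPow ι _), tauPow_mul_const, qFrobenius_pow_apply, ofAdd_add,
    map_mul, map_mul, mul_assoc, mul_assoc]
  rfl

theorem card_pow_ne_zero (n : ℕ) : Nat.card Fq ^ n ≠ 0 := pow_ne_zero _ Nat.card_pos.ne'

theorem add_pow_card_pow (ι : Fq[X] →+* L) (x y : L) (n : ℕ) :
    (x + y) ^ Nat.card Fq ^ n = x ^ Nat.card Fq ^ n + y ^ Nat.card Fq ^ n := by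
  simp only [← frobeniusEnd_pow_apply ι, map_add]

theorem coeff_mul (f g : TwistedPoly ι) (n : ℕ) :
    (f * g).coeff n =
      ∑ ij ∈ Finset.HasAntidiagonal.antidiagonal n, f.coeff ij.1 * g.coeff ij.2 ^ Nat.card Fq ^ ij.1 := by
  induction f using induction with
  | zero => simp [coeff_zero_apply]
  | add f f' hf hf' =>
    rw [add_mul, coeff_add, hf, hf', ← Finset.sum_add_distrib]
    exact Finset.sum_congr rfl fun ij _ => by rw [coeff_add, add_mul]
  | monomial x i =>
    induction g using induction with
    | zero =>
      simp [coeff_zero_apply, zero_pow (card_pow_ne_zero _)]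
    | add g g' hg hg' =>
      rw [mul_add, coeff_add, hg, hg', ← Finset.sum_add_distrib]
      exact Finset.sum_congr rfl fun ij _ => by rw [coeff_add, add_pow_card_pow ι, mul_add]
    | monomial y j =>
      rw [monomial_mul_monomial, coeff_const_mul_tauPow]
      simp only [coeff_const_mul_tauPow]
      split_ifs with h
      · rw [Finset.sum_eq_single (i, j)]
        · simp
        · rintro ⟨a, b⟩ hab hne
          by_cases ha : i = a
          · have hb : j ≠ b := by
              rintro rfl; exact hne (by simp [ha])
            simp [hb, zero_pow (card_pow_ne_zero _)]
          · simp [ha]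
        · intro hn
          exact absurd (Finset.HasAntidiagonal.mem_antidiagonal.2 h) hn
      · symm
        refine Finset.sum_eq_zero ?_
        rintro ⟨a, b⟩ hab
        rw [Finset.HasAntidiagonal.mem_antidiagonal] at hab
        by_cases ha : i = a
        · have hb : j ≠ b := by
            rintro rfl; exact h (by simpa [ha] using hab)
          simp [hb, zero_pow (card_pow_ne_zero _)]
        · simp [ha]

theorem coeff_const_mul (x : L) (f : TwistedPoly ι) (n : ℕ) :
    (const ι x * f).coeff n = x * f.coeff n := by
  rw [coeff_mul, Finset.sum_eq_single (0, n)]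
  · simp [coeff_const]
  · rintro ⟨a, b⟩ hab hne
    have : (0 : ℕ) ≠ a := by
      rintro rfl
      rw [Finset.HasAntidiagonal.mem_antidiagonal] at hab
      exact hne (by simpa using hab)
    simp [coeff_const, this]
  · intro h; simp at h

theorem coeff_mul_const (f : TwistedPoly ι) (x : L) (n : ℕ) :
    (f * const ι x).coeff n = f.coeff n * x ^ Nat.card Fq ^ n := by
  rw [coeff_mul, Finset.sum_eq_single (n, 0)]
  · simp [coeff_const]
  · rintro ⟨a, b⟩ hab hne
    have : (0 : ℕ) ≠ b := by
      rintro rfl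
      rw [Finset.HasAntidiagonal.mem_antidiagonal] at hab
      exact hne (by simpa using hab)
    simp [coeff_const, this, zero_pow (card_pow_ne_zero _)]
  · intro h; simp at h

theorem coeff_mul_zero (f g : TwistedPoly ι) : (f * g).coeff 0 = f.coeff 0 * g.coeff 0 := by
  simp [coeff_mul]

/-- Top coefficient of a product. -/
theorem coeff_mul_add_of_le {f g : TwistedPoly ι} {m n : ℕ} (hf : ∀ i, m < i → f.coeff i = 0)
    (hg : ∀ i, n < i → g.coeff i = 0) :
    (f * g).coeff (m + n) = f.coeff m * g.coeff n ^ Nat.card Fq ^ m := by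
  rw [coeff_mul, Finset.sum_eq_single (m, n)]
  · rintro ⟨a, b⟩ hab hne
    rw [Finset.HasAntidiagonal.mem_antidiagonal] at hab
    dsimp only at hab ⊢
    rcases lt_trichotomy m a with h | h | h
    · rw [hf a h, zero_mul]
    · exact absurd (by rw [Prod.mk.injEq]; omega) hne
    · rw [hg b (by omega), zero_pow (card_pow_ne_zero _), mul_zero]
  · intro h; simp at h

theorem coeff_mul_eq_zero {f g : TwistedPoly ι} {m n : ℕ} (hf : ∀ i, m < i → f.coeff i = 0)
    (hg : ∀ i, n < i → g.coeff i = 0) (k : ℕ) (hk : m + n < k) : (f * g).coeff k = 0 := by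
  rw [coeff_mul]
  refine Finset.sum_eq_zero ?_
  rintro ⟨a, b⟩ hab
  rw [Finset.HasAntidiagonal.mem_antidiagonal] at hab
  dsimp only at hab ⊢
  rcases lt_or_ge m a with h | h
  · rw [hf a h, zero_mul]
  · rw [hg b (by omega), zero_pow (card_pow_ne_zero _), mul_zero]

theorem exists_coeff_eq_zero (f : TwistedPoly ι) : ∃ n, ∀ i, n < i → f.coeff i = 0 := by
  induction f using induction with
  | zero => exact ⟨0, fun _ _ => rfl⟩
  | add f g hf hg =>
    obtain ⟨m, hm⟩ := hf
    obtain ⟨n, hn⟩ := hg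
    refine ⟨max m n, fun i hi => ?_⟩
    rw [coeff_add, hm i (lt_of_le_of_lt (le_max_left _ _) hi),
      hn i (lt_of_le_of_lt (le_max_right _ _) hi), add_zero]
  | monomial x n =>
    exact ⟨n, fun i hi => by rw [coeff_const_mul_tauPow, if_neg hi.ne]⟩

theorem exists_degree {f : TwistedPoly ι} (hf : f ≠ 0) :
    ∃ n, f.coeff n ≠ 0 ∧ ∀ i, n < i → f.coeff i = 0 := by
  classical
  have h := exists_coeff_eq_zero f
  have hs := Nat.find_spec h
  refine ⟨Nat.find h, fun h0 => ?_, hs⟩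
  rcases Nat.eq_zero_or_pos (Nat.find h) with hz | hpos
  · refine hf (ext_coeff fun i => ?_)
    rw [hz] at h0 hs
    rcases Nat.eq_zero_or_pos i with rfl | hi
    · exact h0
    · exact hs i hi
  · refine Nat.find_min h (m := Nat.find h - 1) (by omega) fun i hi => ?_
    rcases eq_or_lt_of_le (show Nat.find h ≤ i by omega) with he | hl
    · rw [← he]; exact h0
    · exact hs i hl

/-- The invertible twisted polynomials are the nonzero constants. -/
theorem eq_const_of_mul_eq_one {f g : TwistedPoly ι} (h : f * g = 1) :
    f = const ι (f.coeff 0) ∧ f.coeff 0 * g.coeff 0 = 1 := by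
  have h0 : f.coeff 0 * g.coeff 0 = 1 := by
    rw [← coeff_mul_zero, h, coeff_one, if_pos rfl]
  refine ⟨?_, h0⟩
  have hf : f ≠ 0 := by rintro rfl; simp [coeff_zero_apply] at h0
  have hg : g ≠ 0 := by rintro rfl; simp [coeff_zero_apply] at h0
  obtain ⟨m, hm, hm'⟩ := exists_degree hf
  obtain ⟨n, hn, hn'⟩ := exists_degree hg
  have ht := coeff_mul_add_of_le hm' hn'
  rw [h, coeff_one] at ht
  -- Degrees add under multiplication, since the product of the top coefficients does not vanish.
  have : m + n = 0 := by
    by_contra hne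
    rw [if_neg (Ne.symm hne)] at ht
    exact mul_ne_zero hm (pow_ne_zero _ hn) ht.symm
  refine ext_coeff fun i => ?_
  rw [coeff_const]
  split_ifs with hi
  · rw [hi]
  · exact hm' i (by omega)

theorem eq_sum_monomial (f : TwistedPoly ι) (n : ℕ) (h : ∀ i, n < i → f.coeff i = 0) :
    f = ∑ i ∈ Finset.range (n + 1), const ι (f.coeff i) * tauPow ι (Multiplicative.ofAdd i) := by
  refine ext_coeff fun k => ?_
  rw [coeff_sum]
  simp only [coeff_const_mul_tauPow]
  rw [Finset.sum_ite_eq' (Finset.range (n + 1)) k]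
  split_ifs with hk
  · rfl
  · exact h k (by simpa using hk)

theorem eval_eq_sum (E : Type*) [Field E] [Algebra L E] (f : TwistedPoly ι) (n : ℕ)
    (h : ∀ i, n < i → f.coeff i = 0) (x : E) :
    eval ι E f x = ∑ i ∈ Finset.range (n + 1), algebraMap L E (f.coeff i) * x ^ Nat.card Fq ^ i := by
  conv_lhs => rw [eq_sum_monomial f n h]
  rw [map_sum]
  refine (AddMonoidHom.finsetSum_apply _ _ _).trans ?_
  exact Finset.sum_congr rfl fun i _ => eval_const_mul_tauPow ι E _ _ _

theorem eval_const (E : Type*) [Field E] [Algebra L E] (c : L) (x : E) :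
    eval ι E (const ι c) x = algebraMap L E c * x := by
  have := eval_const_mul_tauPow ι E c 0 x
  rwa [ofAdd_zero, map_one, mul_one, pow_zero, pow_one] at this

theorem eval_mul (E : Type*) [Field E] [Algebra L E] (f g : TwistedPoly ι) (x : E) :
    eval ι E (f * g) x = eval ι E f (eval ι E g x) := by
  rw [map_mul]; rfl

theorem eval_algHom {E E' : Type*} [Field E] [Algebra L E] [Field E'] [Algebra L E']
    (σ : E →ₐ[L] E') (P : TwistedPoly ι) (x : E) : σ (eval ι E P x) = eval ι E' P (σ x) := by
  obtain ⟨n, hn⟩ := exists_coeff_eq_zero P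
  rw [eval_eq_sum E P n hn, eval_eq_sum E' P n hn, map_sum]
  exact Finset.sum_congr rfl fun i _ => by rw [map_mul, map_pow, AlgHom.commutes]

/-- The polynomial `∑ cᵢ X ^ (q ^ i)` inducing the action of `∑ cᵢ τ ^ i`, where the sum is
truncated at `i = n`. -/
noncomputable def toPoly (f : TwistedPoly ι) (n : ℕ) : L[X] :=
  ∑ i ∈ Finset.range (n + 1), C (f.coeff i) * X ^ Nat.card Fq ^ i

theorem aeval_toPoly (E : Type*) [Field E] [Algebra L E] (f : TwistedPoly ι) (n : ℕ)
    (h : ∀ i, n < i → f.coeff i = 0) (x : E) : aeval x (f.toPoly n) = eval ι E f x := by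
  rw [eval_eq_sum E f n h, toPoly, map_sum]
  exact Finset.sum_congr rfl fun i _ => by simp

theorem one_lt_card : 1 < Nat.card Fq := Finite.one_lt_card

theorem coeff_toPoly (f : TwistedPoly ι) (n i : ℕ) (hi : i ≤ n) :
    (f.toPoly n).coeff (Nat.card Fq ^ i) = f.coeff i := by
  rw [toPoly, finsetSum_coeff, Finset.sum_eq_single i]
  · simp
  · intro j _ hj
    rw [coeff_C_mul, coeff_X_pow, if_neg, mul_zero]
    exact fun h => hj (Nat.pow_right_injective one_lt_card h).symm
  · intro h; simp at h; omega

theorem natDegree_toPoly_le (f : TwistedPoly ι) (n : ℕ) :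
    (f.toPoly n).natDegree ≤ Nat.card Fq ^ n := by
  refine natDegree_sum_le_of_forall_le _ _ fun i hi => (natDegree_C_mul_X_pow_le _ _).trans ?_
  exact Nat.pow_le_pow_right Nat.card_pos (by simpa [Nat.lt_succ_iff] using hi)

theorem natDegree_toPoly (f : TwistedPoly ι) (n : ℕ) (h : f.coeff n ≠ 0) :
    (f.toPoly n).natDegree = Nat.card Fq ^ n :=
  le_antisymm (natDegree_toPoly_le f n)
    (le_natDegree_of_ne_zero (by rwa [coeff_toPoly f n n le_rfl]))

theorem coeff_toPoly_zero (f : TwistedPoly ι) (n : ℕ) : (f.toPoly n).coeff 0 = 0 := by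
  rw [toPoly, finsetSum_coeff]
  refine Finset.sum_eq_zero fun i _ => ?_
  rw [coeff_C_mul, coeff_X_pow, if_neg (card_pow_ne_zero i).symm, mul_zero]

theorem card_eq_zero (ι : Fq[X] →+* L) : ((Nat.card Fq : ℕ) : L) = 0 := by
  let : Fintype Fq := Fintype.ofFinite Fq
  have : ((Nat.card Fq : ℕ) : Fq) = 0 := by
    rw [Nat.card_eq_fintype_card, FiniteField.cast_card_eq_zero]
  have h := congrArg (ι.comp C) this
  rwa [map_natCast, map_zero] at h

/-- All exponents other than the first are multiples of $q$, which vanishes in the field; this is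
why torsion polynomials are separable as soon as the constant coefficient of $f$ is nonzero. -/
theorem derivative_toPoly (f : TwistedPoly ι) (n : ℕ) :
    derivative (f.toPoly n) = C (f.coeff 0) := by
  rw [toPoly, derivative_sum, Finset.sum_eq_single 0]
  · simp
  · intro i _ hi
    rw [derivative_C_mul_X_pow, Nat.cast_pow, card_eq_zero ι, zero_pow hi, mul_zero, map_zero,
      zero_mul]
  · intro h; simp at h

theorem separable_toPoly_add (f : TwistedPoly ι) (n : ℕ) (h : f.coeff 0 ≠ 0) (c : L) :
    (f.toPoly n + C c).Separable := by
  rw [separable_def, derivative_add, derivative_C, add_zero, derivative_toPoly]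
  exact ⟨0, C (f.coeff 0)⁻¹, by rw [zero_mul, zero_add, ← C_mul, inv_mul_cancel₀ h, C_1]⟩

end TwistedPoly

/-! ### Drinfeld modules: conjugation, degrees and the size of the torsion. -/

namespace DrinfeldModule

theorem card_quotient_span {Fq : Type*} [Field Fq] {π : Fq[X]} (hπ : π ≠ 0) :
    Nat.card (Fq[X] ⧸ Ideal.span {π}) = Nat.card Fq ^ π.natDegree := by
  let b := (AdjoinRoot.powerBasis hπ).basis
  rw [← AdjoinRoot.powerBasis_dim hπ]
  have : Module.Finite Fq (AdjoinRoot π) := Module.Finite.of_basis b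
  change Nat.card (AdjoinRoot π) = _
  rw [Module.natCard_eq_pow_finrank (K := Fq), Module.finrank_eq_card_basis b, Fintype.card_fin]

theorem finite_quotient_span {Fq : Type*} [Field Fq] [Finite Fq] {π : Fq[X]} (hπ : π ≠ 0) : Finite (Fq[X] ⧸ Ideal.span {π}) :=
  Nat.finite_of_card_ne_zero (by
    rw [card_quotient_span hπ]
    exact pow_ne_zero _ Nat.card_pos.ne')

theorem isMaximal_span {Fq : Type*} [Field Fq] {π : Fq[X]} (hπ : Irreducible π) : (Ideal.span {π}).IsMaximal :=
  PrincipalIdealRing.isMaximal_of_irreducible hπ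

variable {Fq L : Type*} [Field Fq] [Finite Fq] [Field L] {ι : Fq[X] →+* L} {r : ℕ}

/-- Taking the constant coefficient is a ring homomorphism, so it suffices to compare on constants
and on `X`. -/
theorem coeff_zero_apply (φ : DrinfeldModule ι r) (a : Fq[X]) :
    (φ.toRingHom a).coeff 0 = ι a := by
  let f : TwistedPoly ι →+* L :=
    { TwistedPoly.coeffHom ι 0 with
      map_one' := by
        change (1 : TwistedPoly ι).coeff 0 = 1
        rw [TwistedPoly.coeff_one, if_pos rfl]
      map_mul' := TwistedPoly.coeff_mul_zero }
  have h : f.comp φ.toRingHom = ι := by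
    refine Polynomial.ringHom_ext (fun c => ?_) φ.coeff_zero
    change (φ.toRingHom (C c)).coeff 0 = _
    rw [φ.map_C, TwistedPoly.coeff_const, if_pos rfl]
  exact DFunLike.congr_fun h a

/-- The Drinfeld module `u φ u⁻¹`. -/
noncomputable def conj (φ : DrinfeldModule ι r) (u : L) (hu : u ≠ 0) : DrinfeldModule ι r where
  toRingHom :=
    { toFun a := TwistedPoly.const ι u * φ.toRingHom a * TwistedPoly.const ι u⁻¹
      map_one' := by rw [map_one, mul_one, ← map_mul, mul_inv_cancel₀ hu, map_one]
      map_mul' a b := by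
        have h : TwistedPoly.const ι u⁻¹ * TwistedPoly.const ι u = 1 := by
          rw [← map_mul, inv_mul_cancel₀ hu, map_one]
        rw [map_mul]
        calc _ = TwistedPoly.const ι u * φ.toRingHom a * 1 * φ.toRingHom b *
              TwistedPoly.const ι u⁻¹ := by rw [mul_one, ← mul_assoc]
          _ = _ := by rw [← h]; simp only [mul_assoc]
      map_zero' := by rw [map_zero, mul_zero, zero_mul]
      map_add' a b := by rw [map_add, mul_add, add_mul] }
  map_C a := by
    change TwistedPoly.const ι u * φ.toRingHom (C a) * TwistedPoly.const ι u⁻¹ = _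
    rw [φ.map_C, ← map_mul, ← map_mul, mul_right_comm, mul_inv_cancel₀ hu, one_mul]
  coeff_zero := by
    change (TwistedPoly.const ι u * φ.toRingHom X * TwistedPoly.const ι u⁻¹).coeff 0 = _
    rw [TwistedPoly.coeff_mul_const, TwistedPoly.coeff_const_mul, φ.coeff_zero, pow_zero, pow_one,
      mul_right_comm, mul_inv_cancel₀ hu, one_mul]
  coeff_rank_ne_zero := by
    change (TwistedPoly.const ι u * φ.toRingHom X * TwistedPoly.const ι u⁻¹).coeff r ≠ _
    rw [TwistedPoly.coeff_mul_const, TwistedPoly.coeff_const_mul]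
    exact mul_ne_zero (mul_ne_zero hu φ.coeff_rank_ne_zero) (pow_ne_zero _ (inv_ne_zero hu))
  coeff_eq_zero n hn := by
    change (TwistedPoly.const ι u * φ.toRingHom X * TwistedPoly.const ι u⁻¹).coeff n = _
    rw [TwistedPoly.coeff_mul_const, TwistedPoly.coeff_const_mul, φ.coeff_eq_zero n hn, mul_zero,
      zero_mul]

theorem conj_apply (φ : DrinfeldModule ι r) (u : L) (hu : u ≠ 0) (a : Fq[X]) :
    (φ.conj u hu).toRingHom a =
      TwistedPoly.const ι u * φ.toRingHom a * TwistedPoly.const ι u⁻¹ := rfl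

theorem coeff_conj_apply (φ : DrinfeldModule ι r) (u : L) (hu : u ≠ 0) (a : Fq[X]) (n : ℕ) :
    ((φ.conj u hu).toRingHom a).coeff n =
      u * (φ.toRingHom a).coeff n * u⁻¹ ^ Nat.card Fq ^ n := by
  rw [conj_apply, TwistedPoly.coeff_mul_const, TwistedPoly.coeff_const_mul]

theorem eval_conj_apply (φ : DrinfeldModule ι r) (u : L) (hu : u ≠ 0) (E : Type*) [Field E]
    [Algebra L E] (a : Fq[X]) (x : E) :
    TwistedPoly.eval ι E ((φ.conj u hu).toRingHom a) (algebraMap L E u * x) =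
      algebraMap L E u * TwistedPoly.eval ι E (φ.toRingHom a) x := by
  rw [conj_apply, TwistedPoly.eval_mul, TwistedPoly.eval_mul, TwistedPoly.eval_const,
    TwistedPoly.eval_const, ← mul_assoc, ← map_mul, inv_mul_cancel₀ hu, map_one, one_mul]

/-- `u` is an isomorphism from `φ` to `u φ u⁻¹`. -/
theorem isIsomorphic_conj (φ : DrinfeldModule ι r) (u : L) (hu : u ≠ 0) :
    φ.IsIsomorphic (φ.conj u hu) := by
  have h1 : TwistedPoly.const ι u * TwistedPoly.const ι u⁻¹ = 1 := by
    rw [← map_mul, mul_inv_cancel₀ hu, map_one]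
  have h2 : TwistedPoly.const ι u⁻¹ * TwistedPoly.const ι u = 1 := by
    rw [← map_mul, inv_mul_cancel₀ hu, map_one]
  refine ⟨TwistedPoly.const ι u, TwistedPoly.const ι u⁻¹, fun a => ?_, fun a => ?_, h1, h2⟩
  · rw [conj_apply, mul_assoc _ (TwistedPoly.const ι u⁻¹), h2, mul_one]
  · rw [conj_apply, ← mul_assoc, ← mul_assoc, h2, one_mul]

/-- Isomorphic Drinfeld modules are conjugate by a nonzero constant. -/
theorem IsIsomorphic.exists_coeff_eq {φ ψ : DrinfeldModule ι r} (h : φ.IsIsomorphic ψ) :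
    ∃ u : L, u ≠ 0 ∧ ∀ i, ψ.coeff i = u * φ.coeff i * u⁻¹ ^ Nat.card Fq ^ i := by
  obtain ⟨f, g, hf, -, hfg, -⟩ := h
  obtain ⟨h1, h2⟩ := TwistedPoly.eq_const_of_mul_eq_one hfg
  have hu : f.coeff 0 ≠ 0 := left_ne_zero_of_mul_eq_one h2
  refine ⟨f.coeff 0, hu, fun i => ?_⟩
  have h3 := congrArg (fun P => TwistedPoly.coeff P i) (hf X)
  rw [h1, TwistedPoly.coeff_const_mul, TwistedPoly.coeff_mul_const] at h3
  change (ψ.toRingHom X).coeff i = _ * (φ.toRingHom X).coeff i * _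
  rw [h3, inv_pow, mul_assoc, mul_inv_cancel₀ (pow_ne_zero _ hu), mul_one]

theorem coeff_X_pow_eq_zero (φ : DrinfeldModule ι r) (d n : ℕ) (hn : r * d < n) :
    (φ.toRingHom (X ^ d)).coeff n = 0 := by
  induction d generalizing n with
  | zero =>
    rw [pow_zero, map_one, TwistedPoly.coeff_one, if_neg]
    omega
  | succ d ih =>
    rw [pow_succ, map_mul]
    exact TwistedPoly.coeff_mul_eq_zero ih φ.coeff_eq_zero n (by rwa [mul_add, mul_one] at hn)

/-- Each further factor of $\phi_X$ contributes its top coefficient twisted by the Frobenius power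
of the degree already reached, whence the sum in the exponent. Only its being a power of $c_r$
matters later. -/
theorem coeff_X_pow_mul (φ : DrinfeldModule ι r) (d : ℕ) :
    (φ.toRingHom (X ^ d)).coeff (r * d) =
      φ.coeff r ^ ∑ i ∈ Finset.range d, Nat.card Fq ^ (r * i) := by
  induction d with
  | zero => rw [pow_zero, map_one, TwistedPoly.coeff_one]; simp
  | succ d ih =>
    rw [pow_succ, map_mul, mul_add, mul_one,
      TwistedPoly.coeff_mul_add_of_le (φ.coeff_X_pow_eq_zero d) φ.coeff_eq_zero, ih,
      Finset.sum_range_succ, pow_add]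
    rfl

theorem apply_eq_sum (φ : DrinfeldModule ι r) (a : Fq[X]) :
    φ.toRingHom a = ∑ i ∈ Finset.range (a.natDegree + 1),
      TwistedPoly.const ι (ι (C (a.coeff i))) * φ.toRingHom (X ^ i) := by
  conv_lhs => rw [a.as_sum_range_C_mul_X_pow]
  rw [map_sum]
  exact Finset.sum_congr rfl fun i _ => by rw [map_mul, φ.map_C]

theorem coeff_apply_eq_zero (φ : DrinfeldModule ι r) (a : Fq[X]) (n : ℕ)
    (hn : r * a.natDegree < n) : (φ.toRingHom a).coeff n = 0 := by
  rw [apply_eq_sum, TwistedPoly.coeff_sum]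
  refine Finset.sum_eq_zero fun i hi => ?_
  rw [TwistedPoly.coeff_const_mul, coeff_X_pow_eq_zero, mul_zero]
  refine lt_of_le_of_lt (Nat.mul_le_mul_left r ?_) hn
  simpa [Nat.lt_succ_iff] using hi

theorem coeff_apply_top (φ : DrinfeldModule ι r) (hr : 0 < r) (a : Fq[X]) :
    (φ.toRingHom a).coeff (r * a.natDegree) = ι (C a.leadingCoeff) *
      φ.coeff r ^ ∑ i ∈ Finset.range a.natDegree, Nat.card Fq ^ (r * i) := by
  rw [apply_eq_sum, TwistedPoly.coeff_sum, Finset.sum_range_succ, Finset.sum_eq_zero, zero_add,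
    TwistedPoly.coeff_const_mul, coeff_X_pow_mul, leadingCoeff]
  intro i hi
  rw [TwistedPoly.coeff_const_mul, coeff_X_pow_eq_zero, mul_zero]
  exact Nat.mul_lt_mul_of_pos_left (by simpa using hi) hr

theorem coeff_apply_top_ne_zero (φ : DrinfeldModule ι r) (hr : 0 < r) {a : Fq[X]} (ha : a ≠ 0) :
    (φ.toRingHom a).coeff (r * a.natDegree) ≠ 0 := by
  rw [coeff_apply_top φ hr]
  refine mul_ne_zero ?_ (pow_ne_zero _ φ.coeff_rank_ne_zero)
  intro h
  have := (map_eq_zero (ι.comp C)).1 h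
  exact ha (leadingCoeff_eq_zero.1 this)

/-! ### Division points -/

/-- The polynomial `φ_a(x)`. -/
noncomputable def divPoly (φ : DrinfeldModule ι r) (a : Fq[X]) : L[X] :=
  (φ.toRingHom a).toPoly (r * a.natDegree)

theorem aeval_divPoly (φ : DrinfeldModule ι r) (a : Fq[X]) (E : Type*) [Field E] [Algebra L E]
    (x : E) : aeval x (φ.divPoly a) = TwistedPoly.eval ι E (φ.toRingHom a) x :=
  TwistedPoly.aeval_toPoly E _ _ (φ.coeff_apply_eq_zero a) x

theorem natDegree_divPoly (φ : DrinfeldModule ι r) (hr : 0 < r) {a : Fq[X]} (ha : a ≠ 0) :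
    (φ.divPoly a).natDegree = Nat.card Fq ^ (r * a.natDegree) :=
  TwistedPoly.natDegree_toPoly _ _ (φ.coeff_apply_top_ne_zero hr ha)

theorem divPoly_ne_zero (φ : DrinfeldModule ι r) (hr : 0 < r) {a : Fq[X]} (ha : a ≠ 0) :
    φ.divPoly a ≠ 0 := by
  intro h
  have := φ.natDegree_divPoly hr ha
  rw [h, natDegree_zero] at this
  exact TwistedPoly.card_pow_ne_zero _ this.symm

theorem separable_divPoly_add (φ : DrinfeldModule ι r) {a : Fq[X]} (ha : ι a ≠ 0) (c : L) :
    (φ.divPoly a + C c).Separable :=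
  TwistedPoly.separable_toPoly_add _ _ (by rwa [coeff_zero_apply]) c

theorem separable_divPoly (φ : DrinfeldModule ι r) {a : Fq[X]} (ha : ι a ≠ 0) :
    (φ.divPoly a).Separable := by
  simpa using φ.separable_divPoly_add ha 0

theorem torsionSet_eq_rootSet (φ : DrinfeldModule ι r) (hr : 0 < r) {a : Fq[X]} (ha : a ≠ 0) :
    φ.torsionSet a = (φ.divPoly a).rootSet (SeparableClosure L) := by
  ext x
  rw [mem_rootSet_of_ne (φ.divPoly_ne_zero hr ha), aeval_divPoly]
  rfl

theorem card_torsionSet (φ : DrinfeldModule ι r) (hr : 0 < r) {a : Fq[X]} (ha : ι a ≠ 0) :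
    Nat.card (φ.torsionSet a) = Nat.card Fq ^ (r * a.natDegree) := by
  have ha0 : a ≠ 0 := by rintro rfl; exact ha (map_zero ι)
  have hs := φ.separable_divPoly ha
  rw [torsionSet_eq_rootSet φ hr ha0, Nat.card_eq_fintype_card,
    card_rootSet_eq_natDegree hs (IsSepClosed.splits_codomain _ hs), natDegree_divPoly φ hr ha0]

theorem finite_torsionSet (φ : DrinfeldModule ι r) (hr : 0 < r) {a : Fq[X]} (ha : a ≠ 0) :
    (φ.torsionSet a).Finite := by
  rw [torsionSet_eq_rootSet φ hr ha]
  exact rootSet_finite _ _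

/-- Separability of $\phi_\pi$ gives $q^{r\deg\pi}$ torsion points, and the residue field has
$q^{\deg\pi}$ elements; comparing cardinalities gives the dimension. -/
theorem finrank_torsion (φ : DrinfeldModule ι r) (hr : 0 < r) {π : Fq[X]} (hπ : Irreducible π)
    (h : ι π ≠ 0) : Module.finrank (Fq[X] ⧸ Ideal.span {π}) (φ.torsion π) = r := by
  have := isMaximal_span hπ
  let _ : Field (Fq[X] ⧸ Ideal.span {π}) := Ideal.Quotient.field _
  have := finite_quotient_span hπ.ne_zero
  have h1 : Nat.card (φ.torsion π) = Nat.card Fq ^ (r * π.natDegree) := φ.card_torsionSet hr h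
  have : Finite (φ.torsion π) :=
    Nat.finite_of_card_ne_zero (by rw [h1]; exact TwistedPoly.card_pow_ne_zero _)
  rw [Module.natCard_eq_pow_finrank (K := Fq[X] ⧸ Ideal.span {π}), card_quotient_span hπ.ne_zero,
    ← pow_mul, mul_comm] at h1
  exact Nat.eq_of_mul_eq_mul_right hπ.natDegree_pos (Nat.pow_right_injective Finite.one_lt_card h1)

end DrinfeldModule

/-! ### Roots and coefficients of split polynomials over a valued field. -/

namespace Valuation

variable {E Γ₀ : Type*} [Field E] [LinearOrderedCommGroupWithZero Γ₀] (v : Valuation E Γ₀)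

/-- The $k$-th coefficient is a sum of products of all but $k$ of the roots, and each omitted root
has value at least `ρ`. This is the Newton polygon inequality for the smallest slope. -/
theorem coeff_prod_X_sub_C_mul_pow_le (s : Multiset E) (ρ : Γ₀) (h : ∀ y ∈ s, ρ ≤ v y) (k : ℕ) :
    v ((s.map fun y => X - C y).prod.coeff k) * ρ ^ k ≤ (s.map v).prod := by
  induction s using Multiset.induction generalizing k with
  | empty =>
    rw [Multiset.map_zero, Multiset.prod_zero, Polynomial.coeff_one, Multiset.map_zero,
      Multiset.prod_zero]
    split_ifs with hk <;> simp [hk]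
  | cons y s ih =>
    have ih := ih fun z hz => h z (Multiset.mem_cons_of_mem hz)
    have hy := h y (Multiset.mem_cons_self y s)
    rw [Multiset.map_cons, Multiset.prod_cons, Multiset.map_cons, Multiset.prod_cons, sub_mul,
      Polynomial.coeff_sub, Polynomial.coeff_C_mul]
    have h2 : v (y * (s.map fun y => X - C y).prod.coeff k) * ρ ^ k ≤ v y * (s.map v).prod := by
      rw [map_mul, mul_assoc]
      exact mul_le_mul_right (ih k) _
    have h1 : v ((X * (s.map fun y => X - C y).prod).coeff k) * ρ ^ k ≤ v y * (s.map v).prod := by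
      rcases k with _ | k
      · simp
      · rw [Polynomial.coeff_X_mul, pow_succ, ← mul_assoc, mul_comm (v y)]
        exact mul_le_mul' (ih k) hy
    rcases le_total (v ((X * (s.map fun y => X - C y).prod).coeff k))
      (v (y * (s.map fun y => X - C y).prod.coeff k)) with hle | hle
    · exact (mul_le_mul_left ((v.map_sub _ _).trans (max_le hle le_rfl)) _).trans h2
    · exact (mul_le_mul_left ((v.map_sub _ _).trans (max_le le_rfl hle)) _).trans h1

theorem coeff_prod_X_sub_C_le_one (s : Multiset E) (h : ∀ y ∈ s, v y ≤ 1) (k : ℕ) :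
    v ((s.map fun y => X - C y).prod.coeff k) ≤ 1 := by
  induction s using Multiset.induction generalizing k with
  | empty =>
    rw [Multiset.map_zero, Multiset.prod_zero, Polynomial.coeff_one]
    split_ifs <;> simp
  | cons y s ih =>
    have ih := ih fun z hz => h z (Multiset.mem_cons_of_mem hz)
    rw [Multiset.map_cons, Multiset.prod_cons, sub_mul, Polynomial.coeff_sub,
      Polynomial.coeff_C_mul]
    refine (v.map_sub _ _).trans (max_le ?_ ?_)
    · rcases k with _ | k
      · simp
      · rw [Polynomial.coeff_X_mul]; exact ih k
    · rw [map_mul]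
      exact mul_le_one' (h y (Multiset.mem_cons_self y s)) (ih k)

/-- A root of smallest absolute value of a split polynomial controls all coefficients. -/
theorem exists_root_coeff_mul_pow_le {f : E[X]} (hf : f.Splits) (h0 : f.coeff 0 ≠ 0)
    (hd : f.natDegree ≠ 0) :
    ∃ y, f.IsRoot y ∧ ∀ k, v (f.coeff k) * v y ^ k ≤ v (f.coeff 0) := by
  have hf0 : f ≠ 0 := by rintro rfl; simp at h0
  have hroots : f.roots ≠ 0 := by
    intro h
    have := hf.natDegree_eq_card_roots
    rw [h, Multiset.card_zero] at this
    exact hd this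
  classical
  obtain ⟨z, hz⟩ := Multiset.exists_mem_of_ne_zero hroots
  obtain ⟨y, hy, hmin⟩ := Finset.exists_min_image f.roots.toFinset v ⟨z, by simpa using hz⟩
  have hy : y ∈ f.roots := by simpa using hy
  refine ⟨y, (mem_roots hf0).1 hy, fun k => ?_⟩
  have key := v.coeff_prod_X_sub_C_mul_pow_le f.roots (v y)
    (fun x hx => hmin x (by simpa using hx)) k
  have hfe := hf.eq_prod_roots
  have hc : v (f.coeff 0) = v f.leadingCoeff * (f.roots.map v).prod := by
    conv_lhs => rw [hfe]
    rw [Polynomial.coeff_C_mul, map_mul, Polynomial.coeff_zero_eq_eval_zero, eval_multiset_prod,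
      map_multiset_prod, Multiset.map_map, Multiset.map_map]
    congr 3
    funext x
    simp [Valuation.map_neg]
  rw [hc]
  conv_lhs => rw [hfe]
  rw [Polynomial.coeff_C_mul, map_mul, mul_assoc]
  exact mul_le_mul_right key _

/-- If all roots were integral, every coefficient would be the leading one times an integral
symmetric function. -/
theorem exists_root_one_lt {f : E[X]} (hf : f.Splits) (k : ℕ)
    (hk : v f.leadingCoeff < v (f.coeff k)) : ∃ y, f.IsRoot y ∧ 1 < v y := by
  by_contra! h
  have hf0 : f ≠ 0 := by rintro rfl; simp at hk
  have key := v.coeff_prod_X_sub_C_le_one f.roots (fun y hy => h y ((mem_roots hf0).1 hy)) k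
  refine hk.not_ge ?_
  conv_lhs => rw [hf.eq_prod_roots]
  rw [Polynomial.coeff_C_mul, map_mul]
  exact mul_le_of_le_one_right' key

end Valuation

/-! ### From values of division points to a good model. -/

namespace DrinfeldModule

variable {Fq K E Γ₀ : Type*} [Field Fq] [Finite Fq] [Field K] [Field E] [Algebra K E]
  [LinearOrderedCommGroupWithZero Γ₀] {ι : Fq[X] →+* K} {r : ℕ}

/-- The `a`-power division points of `φ` in `E`. -/
def powTorsionPoints (φ : DrinfeldModule ι r) (a : Fq[X]) (E : Type*) [Field E] [Algebra K E] :
    Set E :=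
  {x | ∃ n, TwistedPoly.eval ι E (φ.toRingHom (a ^ n)) x = 0}

theorem mem_powTorsionPoints_of_eval (φ : DrinfeldModule ι r) (a : Fq[X]) {x : E}
    (h : TwistedPoly.eval ι E (φ.toRingHom a) x ∈ φ.powTorsionPoints a E) :
    x ∈ φ.powTorsionPoints a E := by
  obtain ⟨n, hn⟩ := h
  refine ⟨n + 1, ?_⟩
  rw [pow_succ, map_mul, TwistedPoly.eval_mul, hn]

theorem mul_mem_powTorsionPoints_conj (φ : DrinfeldModule ι r) (u : K) (hu : u ≠ 0) (a : Fq[X])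
    {x : E} : algebraMap K E u * x ∈ (φ.conj u hu).powTorsionPoints a E ↔
      x ∈ φ.powTorsionPoints a E := by
  refine exists_congr fun n => ?_
  rw [eval_conj_apply, mul_eq_zero, or_iff_right]
  exact (_root_.map_ne_zero _).2 hu

variable (v : Valuation E Γ₀)

/-- All values of `φ_a` at points of absolute value at most one have absolute value at most one. -/
theorem valuation_eval_le_one (f : TwistedPoly ι)
    (hf : ∀ i, v (algebraMap K E (f.coeff i)) ≤ 1) {x : E} (hx : v x ≤ 1) :
    v (TwistedPoly.eval ι E f x) ≤ 1 := by
  obtain ⟨n, hn⟩ := TwistedPoly.exists_coeff_eq_zero f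
  rw [TwistedPoly.eval_eq_sum E f n hn]
  refine v.map_sum_le fun i _ => ?_
  rw [map_mul, map_pow]
  exact mul_le_one' (hf i) (pow_le_one' hx _)

/-- Take for `y` the smallest root of $\phi_\pi(Y)-x$: the Newton polygon inequality at the index
$q^N$, where the coefficient is a unit, bounds it. This is the step of the descent in
`valuation_top_eq_one`. -/
theorem exists_eval_eq [IsSepClosed E] (φ : DrinfeldModule ι r) (hr : 0 < r) {π : Fq[X]}
    (hπ : ι π ≠ 0) (N : ℕ) {x : E} (hx : x ≠ 0)
    (hN : v (algebraMap K E ((φ.toRingHom π).coeff N)) = 1) (hNle : N ≤ r * π.natDegree) :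
    ∃ y, TwistedPoly.eval ι E (φ.toRingHom π) y = x ∧ v y ^ Nat.card Fq ^ N ≤ v x := by
  have hπ0 : π ≠ 0 := by rintro rfl; exact hπ (map_zero ι)
  let f : E[X] := (φ.divPoly π).map (algebraMap K E) + C (-x)
  have hsep : f.Separable := by
    have h1 : ((φ.divPoly π).map (algebraMap K E)).derivative =
        C (algebraMap K E (ι π)) := by
      rw [derivative_map, divPoly, TwistedPoly.derivative_toPoly, coeff_zero_apply, Polynomial.map_C]
    rw [separable_def, derivative_add, derivative_C, add_zero, h1]
    refine ⟨0, C (algebraMap K E (ι π))⁻¹, ?_⟩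
    rw [zero_mul, zero_add, ← C_mul, inv_mul_cancel₀ ((_root_.map_ne_zero _).2 hπ), C_1]
  have hsplit := IsSepClosed.splits_of_separable f hsep
  have hc0 : f.coeff 0 = -x := by
    rw [coeff_add, coeff_map, divPoly, TwistedPoly.coeff_toPoly_zero, map_zero, zero_add,
      coeff_C_zero]
  have hck : ∀ k, k ≠ 0 → f.coeff k = algebraMap K E ((φ.divPoly π).coeff k) := by
    intro k hk
    rw [coeff_add, coeff_map, coeff_C_of_ne_zero hk, add_zero]
  have hdeg : f.natDegree ≠ 0 := by
    rw [natDegree_add_C, natDegree_map, natDegree_divPoly φ hr hπ0]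
    exact TwistedPoly.card_pow_ne_zero _
  obtain ⟨y, hy, hyk⟩ := v.exists_root_coeff_mul_pow_le hsplit (by rwa [hc0, neg_ne_zero]) hdeg
  refine ⟨y, ?_, ?_⟩
  · rw [IsRoot.def, eval_add, eval_C, eval_map_algebraMap, aeval_divPoly] at hy
    exact (eq_neg_of_add_eq_zero_left hy).trans (neg_neg x)
  · have := hyk (Nat.card Fq ^ N)
    rwa [hck _ (TwistedPoly.card_pow_ne_zero _), divPoly, TwistedPoly.coeff_toPoly _ _ _ hNle, hN,
      one_mul, hc0, Valuation.map_neg] at this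

theorem splits_divPoly_map [IsSepClosed E] (φ : DrinfeldModule ι r) {π : Fq[X]}
    (hπ : ι π ≠ 0) : ((φ.divPoly π).map (algebraMap K E)).Splits :=
  IsSepClosed.splits_codomain _ (φ.separable_divPoly hπ)

/-- If the division points of `φ` have values in the discrete value group of `K`, and `φ_π` has
integral coefficients not all of which (beyond the constant one) are in the maximal ideal, then
its top coefficient is a unit. -/
theorem valuation_top_eq_one [IsSepClosed E] (φ : DrinfeldModule ι r) (hr : 0 < r) {π : Fq[X]}
    (hπ : v (algebraMap K E (ι π)) = 1)
    (hval : ∀ x ∈ φ.powTorsionPoints π E, x ≠ 0 → ∃ y : K, v (algebraMap K E y) = v x)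
    (μ : K → ℕ) (hμ : ∀ x y : K, 1 < v (algebraMap K E x) →
      v (algebraMap K E x) < v (algebraMap K E y) → μ x < μ y)
    (hint : ∀ i, v (algebraMap K E ((φ.toRingHom π).coeff i)) ≤ 1) {N : ℕ} (hN0 : N ≠ 0)
    (hN : v (algebraMap K E ((φ.toRingHom π).coeff N)) = 1) :
    v (algebraMap K E ((φ.toRingHom π).coeff (r * π.natDegree))) = 1 := by
  have hπι : ι π ≠ 0 := by intro h; rw [h] at hπ; simp at hπ
  have hπ0 : π ≠ 0 := by rintro rfl; exact hπι (map_zero ι)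
  have hNle : N ≤ r * π.natDegree := by
    by_contra! h
    rw [φ.coeff_apply_eq_zero π N h] at hN
    simp at hN
  by_contra hne
  have hlt := lt_of_le_of_ne (hint _) hne
  -- The coefficient of index $1=q^0$ is the unit `ι π`, so a top coefficient in the maximal ideal
  -- forces a root that is not integral.
  obtain ⟨x, hx, hx1⟩ : ∃ x ∈ φ.powTorsionPoints π E, 1 < v x := by
    obtain ⟨x, hx, hx1⟩ := v.exists_root_one_lt (φ.splits_divPoly_map (E := E) hπι) 1 (by
      rw [leadingCoeff_map, leadingCoeff, natDegree_divPoly φ hr hπ0, coeff_map, divPoly,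
        TwistedPoly.coeff_toPoly _ _ _ le_rfl]
      have := TwistedPoly.coeff_toPoly (φ.toRingHom π) (r * π.natDegree) 0 (Nat.zero_le _)
      rw [pow_zero] at this
      rwa [this, coeff_zero_apply, hπ])
    refine ⟨x, ⟨1, ?_⟩, hx1⟩
    rwa [IsRoot.def, eval_map_algebraMap, aeval_divPoly, ← pow_one π] at hx
  -- Infinite descent on `μ`: a preimage of a non-integral division point under $\phi_\pi$ is again
  -- non-integral but strictly smaller.
  have key : ∀ n : ℕ, ∀ x ∈ φ.powTorsionPoints π E, 1 < v x → ∀ z : K,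
      v (algebraMap K E z) = v x → μ z = n → False := by
    intro n
    induction n using Nat.strong_induction_on with
    | _ n ih =>
      intro x hx hx1 z hz hzn
      have hx0 : x ≠ 0 := by rintro rfl; simp at hx1
      obtain ⟨y, hy, hyle⟩ := φ.exists_eval_eq v hr hπι N hx0 hN hNle
      have hyS : y ∈ φ.powTorsionPoints π E :=
        φ.mem_powTorsionPoints_of_eval π (by rwa [hy])
      -- An integral `y` would have an integral image, since $\phi_\pi$ has integral coefficients.
      have hy1 : 1 < v y := by
        by_contra! h
        have := valuation_eval_le_one v (φ.toRingHom π) hint h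
        rw [hy] at this
        exact this.not_gt hx1
      have hy0 : y ≠ 0 := by rintro rfl; simp at hy1
      have hyx : v y < v x := by
        refine lt_of_lt_of_le ?_ hyle
        exact lt_self_pow₀ hy1 (Nat.one_lt_pow hN0 TwistedPoly.one_lt_card)
      obtain ⟨w, hw⟩ := hval y hyS hy0
      exact ih (μ w) (hzn ▸ hμ w z (by rwa [hw]) (by rwa [hw, hz])) y hyS hy1 w hw rfl
  have hx0 : x ≠ 0 := by rintro rfl; simp at hx1
  obtain ⟨z, hz⟩ := hval x hx hx0
  exact key _ x hx hx1 z hz rfl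

/-- If `φ_π` has integral coefficients and a unit as top coefficient, then so does `φ_X`. -/
theorem valuation_coeff_le_one (φ : DrinfeldModule ι r) (hr : 0 < r) {π : Fq[X]}
    (hmon : π.Monic) (hdeg : π.natDegree ≠ 0)
    (hint : ∀ i, v (algebraMap K E ((φ.toRingHom π).coeff i)) ≤ 1)
    (htop : v (algebraMap K E ((φ.toRingHom π).coeff (r * π.natDegree))) = 1) :
    (∀ i, v (algebraMap K E (φ.coeff i)) ≤ 1) ∧ v (algebraMap K E (φ.coeff r)) = 1 := by
  constructor
  · obtain ⟨i₀, -, hi₀⟩ := Finset.exists_max_image (Finset.range (r + 1))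
      (fun i => v (algebraMap K E (φ.coeff i))) ⟨0, by simp⟩
    have hmax : ∀ i, v (algebraMap K E (φ.coeff i)) ≤ v (algebraMap K E (φ.coeff i₀)) := by
      intro i
      rcases lt_or_ge r i with h | h
      · have : φ.coeff i = 0 := φ.coeff_eq_zero i h
        rw [this, map_zero, map_zero]
        exact zero_le
      · exact hi₀ i (by simpa [Nat.lt_succ_iff] using h)
    by_contra! hcon
    obtain ⟨i, hi⟩ := hcon
    have hρ : 1 < v (algebraMap K E (φ.coeff i₀)) := lt_of_lt_of_le hi (hmax i)
    -- Let $\rho>1$ be the largest coefficient size of $\phi_X$, attained at `i₀`. In the degree `r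
    -- * π.natDegree + i₀`, one order of the product has a coefficient of size $\rho^D$ with
    -- $D=q^{r\deg\pi}>1$, the other has one of size at most $\rho$.
    have hcomm : φ.toRingHom π * φ.toRingHom X = φ.toRingHom X * φ.toRingHom π := by
      rw [← map_mul, ← map_mul, mul_comm]
    have hD : 1 < Nat.card Fq ^ (r * π.natDegree) :=
      Nat.one_lt_pow (Nat.mul_ne_zero hr.ne' hdeg) TwistedPoly.one_lt_card
    have h1 : v (algebraMap K E ((φ.toRingHom π * φ.toRingHom X).coeff (r * π.natDegree + i₀))) =
        v (algebraMap K E (φ.coeff i₀)) ^ Nat.card Fq ^ (r * π.natDegree) := by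
      have hterm : v (algebraMap K E ((φ.toRingHom π).coeff (r * π.natDegree) *
          (φ.toRingHom X).coeff i₀ ^ Nat.card Fq ^ (r * π.natDegree))) =
          v (algebraMap K E (φ.coeff i₀)) ^ Nat.card Fq ^ (r * π.natDegree) := by
        rw [map_mul, map_mul, htop, one_mul, map_pow, map_pow]
        rfl
      rw [TwistedPoly.coeff_mul, map_sum, ← hterm]
      refine v.map_sum_eq_of_lt (j := (r * π.natDegree, i₀)) (by simp) ?_
      rintro ⟨a, b⟩ hab
      simp only [Finset.mem_sdiff, Finset.HasAntidiagonal.mem_antidiagonal,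
        Finset.mem_singleton] at hab
      rw [hterm]
      rcases lt_trichotomy a (r * π.natDegree) with h | h | h
      · have hle : v (algebraMap K E ((φ.toRingHom π).coeff a *
            (φ.toRingHom X).coeff b ^ Nat.card Fq ^ a)) ≤
            v (algebraMap K E (φ.coeff i₀)) ^ Nat.card Fq ^ a := by
          rw [map_mul, map_mul, map_pow, map_pow]
          exact (mul_le_mul' (hint a) (pow_le_pow_left' (hmax b) _)).trans_eq (one_mul _)
        refine hle.trans_lt (pow_lt_pow_right₀ hρ ?_)
        exact Nat.pow_lt_pow_right TwistedPoly.one_lt_card h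
      · exact absurd (by rw [Prod.mk.injEq]; omega) hab.2
      · dsimp only
        rw [φ.coeff_apply_eq_zero π a h, zero_mul, map_zero, map_zero]
        exact pow_pos (zero_lt_one.trans hρ) _
    have h2 : v (algebraMap K E ((φ.toRingHom X * φ.toRingHom π).coeff (r * π.natDegree + i₀))) ≤
        v (algebraMap K E (φ.coeff i₀)) := by
      rw [TwistedPoly.coeff_mul, map_sum]
      refine v.map_sum_le fun ab _ => ?_
      rw [map_mul, map_mul, map_pow, map_pow]
      exact (mul_le_mul' (hmax _) (pow_le_one' (hint _) _)).trans_eq (mul_one _)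
    rw [← hcomm, h1] at h2
    exact h2.not_gt (lt_self_pow₀ hρ hD)
  · rw [coeff_apply_top φ hr, hmon.leadingCoeff, C_1, map_one, one_mul, map_pow, map_pow] at htop
    -- The exponent is a nonempty sum of powers of $q$, hence nonzero, so the power being a unit
    -- forces the base to be one.
    refine (pow_eq_one_iff.1 htop).resolve_right fun h => ?_
    rw [Finset.sum_eq_zero_iff] at h
    exact TwistedPoly.card_pow_ne_zero (Fq := Fq) _ (h 0 (by simpa using Nat.pos_of_ne_zero hdeg))

/-- The potential good reduction criterion in terms of the values of division points. -/
theorem exists_good_model [IsSepClosed E] (φ : DrinfeldModule ι r) (hr : 0 < r) {π : Fq[X]}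
    (hmon : π.Monic) (hdeg : π.natDegree ≠ 0) (hπ : v (algebraMap K E (ι π)) = 1)
    (hval : ∀ x ∈ φ.powTorsionPoints π E, x ≠ 0 → ∃ y : K, v (algebraMap K E y) = v x)
    (μ : K → ℕ) (hμ : ∀ x y : K, 1 < v (algebraMap K E x) →
      v (algebraMap K E x) < v (algebraMap K E y) → μ x < μ y) :
    ∃ (u : K) (hu : u ≠ 0), (∀ i, v (algebraMap K E ((φ.conj u hu).coeff i)) ≤ 1) ∧
      v (algebraMap K E ((φ.conj u hu).coeff r)) = 1 := by
  have hπι : ι π ≠ 0 := by intro h; rw [h] at hπ; simp at hπ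
  have hπ0 : π ≠ 0 := hmon.ne_zero
  -- the nonzero division point of smallest absolute value
  obtain ⟨y, hy0, hy, hyk⟩ : ∃ y : E, y ≠ 0 ∧ TwistedPoly.eval ι E (φ.toRingHom π) y = 0 ∧
      ∀ i, i ≠ 0 → v (algebraMap K E ((φ.toRingHom π).coeff i)) * v y ^ Nat.card Fq ^ i ≤ v y := by
    let f : E[X] := (φ.divPoly π).map (algebraMap K E)
    have hf0 : f ≠ 0 := (Polynomial.map_ne_zero_iff (algebraMap K E).injective).2
      (φ.divPoly_ne_zero hr hπ0)
    -- Dividing by `X` discards the zero root and leaves the unit `ι π` as constant coefficient, so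
    -- the smallest root of `divX` is the desired point.
    have hfX : f.divX * X = f := by
      have := f.divX_mul_X_add
      have h0 : f.coeff 0 = 0 := by
        rw [coeff_map, divPoly, TwistedPoly.coeff_toPoly_zero, map_zero]
      rwa [h0, C_0, add_zero] at this
    have hs : f.divX.Splits := (φ.splits_divPoly_map hπι).of_dvd hf0 ⟨X, hfX.symm⟩
    have hc0 : f.divX.coeff 0 = algebraMap K E (ι π) := by
      have := TwistedPoly.coeff_toPoly (φ.toRingHom π) (r * π.natDegree) 0 (Nat.zero_le _)
      rw [pow_zero] at this
      rw [coeff_divX, zero_add, coeff_map, divPoly, this, coeff_zero_apply]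
    have hd : f.divX.natDegree ≠ 0 := by
      rw [natDegree_divX_eq_natDegree_tsub_one, natDegree_map, natDegree_divPoly φ hr hπ0]
      have : 1 < Nat.card Fq ^ (r * π.natDegree) :=
        Nat.one_lt_pow (Nat.mul_ne_zero hr.ne' hdeg) TwistedPoly.one_lt_card
      omega
    obtain ⟨y, hy, hyk⟩ := v.exists_root_coeff_mul_pow_le hs
      (by rw [hc0]; exact (_root_.map_ne_zero _).2 hπι) hd
    refine ⟨y, ?_, ?_, fun i hi => ?_⟩
    · rintro rfl
      rw [IsRoot.def, ← coeff_zero_eq_eval_zero, hc0] at hy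
      exact hπι ((map_eq_zero _).1 hy)
    · have : f.eval y = 0 := by rw [← hfX, eval_mul, hy, zero_mul]
      rwa [eval_map_algebraMap, aeval_divPoly] at this
    · rcases le_or_gt i (r * π.natDegree) with hle | hlt
      · have h1 := hyk (Nat.card Fq ^ i - 1)
        have h2 : Nat.card Fq ^ i - 1 + 1 = Nat.card Fq ^ i :=
          Nat.sub_add_cancel (Nat.one_le_pow _ _ Nat.card_pos)
        rw [coeff_divX, h2, coeff_map, divPoly, TwistedPoly.coeff_toPoly _ _ _ hle, hc0, hπ] at h1
        rw [← h2, pow_succ, ← mul_assoc]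
        exact mul_le_of_le_one_left' h1
      · rw [φ.coeff_apply_eq_zero π i hlt, map_zero, map_zero, zero_mul]
        exact zero_le
  have hvy0 : v y ≠ 0 := (v.ne_zero_iff).2 hy0
  -- Otherwise the linear term would dominate strictly and $\phi_\pi(y)$ would have the nonzero
  -- value of `y`.
  obtain ⟨N, hN0, hN⟩ : ∃ N, N ≠ 0 ∧
      v (algebraMap K E ((φ.toRingHom π).coeff N)) * v y ^ Nat.card Fq ^ N = v y := by
    by_contra! hcon
    have h1 := TwistedPoly.eval_eq_sum E (φ.toRingHom π) _ (φ.coeff_apply_eq_zero π) y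
    rw [hy] at h1
    have h2 := congrArg v h1
    have hterm : v (algebraMap K E ((φ.toRingHom π).coeff 0) * y ^ Nat.card Fq ^ 0) = v y := by
      rw [coeff_zero_apply, map_mul, hπ, one_mul, pow_zero, pow_one]
    rw [v.map_sum_eq_of_lt (j := 0) (by simp), hterm, map_zero] at h2
    · exact hvy0 h2.symm
    · intro i hi
      simp only [Finset.mem_sdiff, Finset.mem_singleton] at hi
      rw [hterm, map_mul, map_pow]
      exact lt_of_le_of_ne (hyk i hi.2) (hcon i hi.2)
  -- The scalar `z⁻¹` moves `y` to a point of value one; the bounds on the coefficients of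
  -- $\phi_\pi$ then become integrality, with a unit at `N`.
  obtain ⟨z, hz⟩ := hval y ⟨1, by rwa [pow_one]⟩ hy0
  have hz0 : z ≠ 0 := by rintro rfl; rw [map_zero, map_zero] at hz; exact hvy0 hz.symm
  have hcoeff : ∀ i, v (algebraMap K E (((φ.conj z⁻¹ (inv_ne_zero hz0)).toRingHom π).coeff i)) =
      (v y)⁻¹ * (v (algebraMap K E ((φ.toRingHom π).coeff i)) * v y ^ Nat.card Fq ^ i) := by
    intro i
    rw [coeff_conj_apply, inv_inv, map_mul, map_mul, map_mul, map_mul, map_pow, map_pow, hz,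
      map_inv₀, map_inv₀, hz, mul_assoc]
  have hint : ∀ i,
      v (algebraMap K E (((φ.conj z⁻¹ (inv_ne_zero hz0)).toRingHom π).coeff i)) ≤ 1 := by
    intro i
    rcases eq_or_ne i 0 with rfl | hi
    · rw [coeff_zero_apply, hπ]
    · rw [hcoeff]
      exact inv_mul_le_one_of_le₀ (hyk i hi) zero_le
  have hunit : v (algebraMap K E (((φ.conj z⁻¹ (inv_ne_zero hz0)).toRingHom π).coeff N)) = 1 := by
    rw [hcoeff, hN, inv_mul_cancel₀ hvy0]
  refine ⟨z⁻¹, inv_ne_zero hz0, valuation_coeff_le_one v _ hr hmon hdeg hint ?_⟩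
  refine valuation_top_eq_one v _ hr hπ (fun x hx hx0 => ?_) μ hμ hint hN0 hunit
  have hzE : algebraMap K E z ≠ 0 := (_root_.map_ne_zero _).2 hz0
  have hx' : algebraMap K E z⁻¹ * (algebraMap K E z * x) = x := by
    rw [map_inv₀, inv_mul_cancel_left₀ hzE]
  rw [← hx', mul_mem_powTorsionPoints_conj] at hx
  obtain ⟨w, hw⟩ := hval _ hx (mul_ne_zero hzE hx0)
  refine ⟨z⁻¹ * w, ?_⟩
  rw [map_mul, map_mul, hw, ← map_mul, hx']

end DrinfeldModule

/-! ### Good reduction tested over the field itself, and reduction of division points. -/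

namespace FinitePlace

variable {Fq L : Type*} [Field Fq] [Field L] {ι : Fq[X] →+* L}

theorem valued_toCompletion (v : FinitePlace ι) (x : L) :
    Valued.v (v.toCompletion x) = v.ring.valuation x :=
  Valued.valuedCompletion_apply (K := WithVal v.ring.valuation) _

theorem exists_valued_toCompletion_eq (v : FinitePlace ι) (x : v.completion) :
    ∃ y : L, Valued.v (v.toCompletion y) = Valued.v x := by
  obtain ⟨y, hy⟩ := Valued.exists_coe_eq_v (K := WithVal v.ring.valuation) x
  exact ⟨y.ofVal, (valued_toCompletion v _).trans hy.symm⟩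

theorem valuation_map_le_one (v : FinitePlace ι) (a : Fq[X]) : v.ring.valuation (ι a) ≤ 1 :=
  (v.ring.valuation_le_one_iff _).2 (v.map_mem a)

theorem valuation_map_eq_one (v : FinitePlace ι) {π : Fq[X]} (h : ¬ v.LiesAbove π) :
    v.ring.valuation (ι π) = 1 :=
  le_antisymm (v.valuation_map_le_one π) (not_lt.1 h)

end FinitePlace

namespace DrinfeldModule

variable {Fq K : Type*} [Field Fq] [Finite Fq] [Field K] {ι : Fq[X] →+* K} {r : ℕ}

theorem coeff_map {M : Type*} [Field M] (φ : DrinfeldModule ι r) (f : K →+* M) (i : ℕ) :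
    (φ.map f).coeff i = f (φ.coeff i) :=
  TwistedPoly.coeff_map ι f _ i

theorem coeff_conj (φ : DrinfeldModule ι r) (u : K) (hu : u ≠ 0) (i : ℕ) :
    (φ.conj u hu).coeff i = u * φ.coeff i * u⁻¹ ^ Nat.card Fq ^ i :=
  coeff_conj_apply φ u hu X i

/-- All coefficients of `φ_X` are integral at the valuation `v` and the top one is a unit. -/
def IsGoodModel {Γ₀ : Type*} [LinearOrderedCommGroupWithZero Γ₀] (φ : DrinfeldModule ι r)
    (v : Valuation K Γ₀) : Prop :=
  (∀ i, v (φ.coeff i) ≤ 1) ∧ v (φ.coeff r) = 1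

/-- Good reduction can be tested over `K` instead of the completion `K_v`. -/
theorem hasGoodReduction_iff (φ : DrinfeldModule ι r) (hr : 0 < r) (v : FinitePlace ι) :
    φ.HasGoodReduction v ↔
      ∃ (u : K) (hu : u ≠ 0), (φ.conj u hu).IsGoodModel v.ring.valuation := by
  constructor
  · rintro ⟨ψ, ⟨hiso, hle, -⟩, htop⟩
    obtain ⟨u, hu, hψ⟩ := hiso.exists_coeff_eq
    -- Completion does not enlarge the value group, and only the value of the conjugating scalar
    -- matters for integrality.
    obtain ⟨w, hw⟩ := v.exists_valued_toCompletion_eq u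
    have hw0 : w ≠ 0 := by
      rintro rfl
      rw [map_zero, map_zero, eq_comm, Valuation.zero_iff] at hw
      exact hu hw
    have key : ∀ i, v.ring.valuation ((φ.conj w hw0).coeff i) = Valued.v (ψ.coeff i) := by
      intro i
      rw [hψ, coeff_conj, coeff_map, map_mul, map_mul, map_mul, map_mul, map_pow, map_pow,
        map_inv₀, map_inv₀, ← v.valued_toCompletion w, hw, v.valued_toCompletion]
    refine ⟨w, hw0, fun i => ?_, by rw [key, htop]⟩
    rcases Nat.eq_zero_or_pos i with rfl | hi
    · have : (φ.conj w hw0).coeff 0 = ι X := (φ.conj w hw0).coeff_zero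
      rw [this]
      exact v.valuation_map_le_one X
    · rcases le_or_gt i r with h | h
      · rw [key]; exact hle i hi h
      · have : (φ.conj w hw0).coeff i = 0 := (φ.conj w hw0).coeff_eq_zero i h
        rw [this, map_zero]
        exact zero_le
  · rintro ⟨u, hu, hle, htop⟩
    have hu' : v.toCompletion u ≠ 0 := (_root_.map_ne_zero _).2 hu
    have key : ∀ i, Valued.v (((φ.map v.toCompletion).conj _ hu').coeff i) =
        v.ring.valuation ((φ.conj u hu).coeff i) := by
      intro i
      rw [← v.valued_toCompletion, coeff_conj, coeff_conj, coeff_map, map_mul v.toCompletion,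
        map_mul v.toCompletion, map_pow v.toCompletion, map_inv₀ v.toCompletion]
    refine ⟨(φ.map v.toCompletion).conj _ hu', ⟨isIsomorphic_conj _ _ _, fun i _ _ => ?_,
      r, hr, le_rfl, ?_⟩, ?_⟩
    · rw [key]; exact hle i
    · rw [key, htop]
    · rw [key, htop]

section

variable {E Γ₀ : Type*} [Field E] [Algebra K E] [LinearOrderedCommGroupWithZero Γ₀]
  {v : Valuation E Γ₀}

/-- Twisted products and sums preserve integral coefficients, so integrality of $\phi_X$ spreads to
every $\phi_a$. -/
theorem IsGoodModel.valuation_coeff_apply_le_one {φ : DrinfeldModule ι r} {v : Valuation K Γ₀}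
    (h : φ.IsGoodModel v) (hι : ∀ a, v (ι a) ≤ 1) (a : Fq[X]) (i : ℕ) :
    v ((φ.toRingHom a).coeff i) ≤ 1 := by
  induction a using Polynomial.induction_on' generalizing i with
  | add p q hp hq =>
    rw [map_add, TwistedPoly.coeff_add]
    exact (v.map_add _ _).trans (max_le (hp i) (hq i))
  | monomial n c =>
    rw [← C_mul_X_pow_eq_monomial, map_mul, φ.map_C, TwistedPoly.coeff_const_mul, map_mul]
    refine mul_le_one' (hι _) ?_
    clear c
    induction n generalizing i with
    | zero =>
      rw [pow_zero, map_one, TwistedPoly.coeff_one]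
      split_ifs <;> simp
    | succ n ih =>
      rw [pow_succ, map_mul, TwistedPoly.coeff_mul]
      refine v.map_sum_le fun ab _ => ?_
      rw [map_mul v, map_pow v]
      exact mul_le_one' (ih _) (pow_le_one' (h.1 _) _)

/-- For monic `a` the top coefficient of $\phi_a$ is a power of the unit $c_r$; at a non-integral
point the top term dominates strictly and cannot cancel. -/
theorem IsGoodModel.valuation_le_one_of_eval_eq_zero {φ : DrinfeldModule ι r} (hr : 0 < r)
    (h : φ.IsGoodModel (v.comap (algebraMap K E))) (hι : ∀ a, v (algebraMap K E (ι a)) ≤ 1)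
    {a : Fq[X]} (ha : a.Monic) {x : E} (hx : TwistedPoly.eval ι E (φ.toRingHom a) x = 0) :
    v x ≤ 1 := by
  by_contra! h1
  rw [TwistedPoly.eval_eq_sum E _ _ (φ.coeff_apply_eq_zero a)] at hx
  have htop : v (algebraMap K E ((φ.toRingHom a).coeff (r * a.natDegree))) = 1 := by
    rw [coeff_apply_top φ hr, ha.leadingCoeff, C_1, map_one, one_mul, map_pow, map_pow]
    have : v (algebraMap K E (φ.coeff r)) = 1 := h.2
    rw [this, one_pow]
  have hx := congrArg v hx
  rw [v.map_sum_eq_of_lt (j := r * a.natDegree) (by simp), map_zero, map_mul, htop, one_mul,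
    map_pow] at hx
  · exact (pow_pos (zero_lt_one.trans h1) _).ne' hx
  · intro i hi
    simp only [Finset.mem_sdiff, Finset.mem_singleton, Finset.mem_range] at hi
    rw [map_mul, map_mul, map_pow, map_pow, htop, one_mul]
    refine lt_of_le_of_lt (mul_le_of_le_one_left' (h.valuation_coeff_apply_le_one hι a i)) ?_
    exact pow_lt_pow_right₀ h1 (Nat.pow_lt_pow_right TwistedPoly.one_lt_card (by omega))

/-- Near zero the linear term $\iota(a)x$ dominates because $\iota(a)$ is a unit. Applied to
differences, this says that reduction is injective on the `a`-torsion. -/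
theorem IsGoodModel.eq_zero_of_eval_eq_zero {φ : DrinfeldModule ι r}
    (h : φ.IsGoodModel (v.comap (algebraMap K E))) (hι : ∀ a, v (algebraMap K E (ι a)) ≤ 1)
    {a : Fq[X]} (ha : v (algebraMap K E (ι a)) = 1) {x : E}
    (hx : TwistedPoly.eval ι E (φ.toRingHom a) x = 0) (hx1 : v x < 1) : x = 0 := by
  by_contra hx0
  have hvx : v x ≠ 0 := v.ne_zero_iff.2 hx0
  rw [TwistedPoly.eval_eq_sum E _ _ (φ.coeff_apply_eq_zero a)] at hx
  have hx := congrArg v hx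
  have hterm : v (algebraMap K E ((φ.toRingHom a).coeff 0) * x ^ Nat.card Fq ^ 0) = v x := by
    rw [coeff_zero_apply, map_mul, ha, one_mul, pow_zero, pow_one]
  rw [v.map_sum_eq_of_lt (j := 0) (by simp), hterm, map_zero] at hx
  · exact hvx hx
  · intro i hi
    simp only [Finset.mem_sdiff, Finset.mem_singleton, Finset.mem_range] at hi
    rw [hterm, map_mul, map_pow]
    refine lt_of_le_of_lt (mul_le_of_le_one_left' (h.valuation_coeff_apply_le_one hι a i)) ?_
    exact pow_lt_self_of_lt_one₀ (zero_lt_iff.2 hvx) hx1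
      (Nat.one_lt_pow hi.2 TwistedPoly.one_lt_card)

end

end DrinfeldModule

/-! ### Inertia as congruence modulo the valuation ideal, and its action on division points. -/

open scoped Pointwise in
theorem ValuationSubring.mem_inertiaSubgroup_iff {L M : Type*} [Field L] [Field M] [Algebra L M]
    {W : ValuationSubring M} {σ : W.decompositionSubgroup L} :
    σ ∈ W.inertiaSubgroup L ↔ ∀ x ∈ W, W.valuation (σ.1 x - x) < 1 := by
  have key : ∀ x : W, (MulSemiringAction.toRingAut (W.decompositionSubgroup L)
      (IsLocalRing.ResidueField W) σ) (IsLocalRing.residue W x) = IsLocalRing.residue W (σ • x) :=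
    fun x => rfl
  have h2 : ∀ x : W, IsLocalRing.residue W (σ • x) = IsLocalRing.residue W x ↔
      W.valuation (σ.1 x.1 - x.1) < 1 := by
    intro x
    rw [← sub_eq_zero, ← map_sub, IsLocalRing.residue_eq_zero_iff, W.valuation_lt_one_iff]
    rfl
  rw [ValuationSubring.inertiaSubgroup, MonoidHom.mem_ker]
  constructor
  · intro h x hx
    have := key ⟨x, hx⟩
    rw [h] at this
    exact (h2 ⟨x, hx⟩).1 this.symm
  · intro h
    ext y
    obtain ⟨x, rfl⟩ := IsLocalRing.residue_surjective y
    rw [key]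
    exact (h2 x).2 (h x.1 x.2)

namespace DrinfeldModule

variable {Fq K L M : Type*} [Field Fq] [Finite Fq] [Field K] {ι : Fq[X] →+* K} {r : ℕ}
  [Field L] [Field M] [Algebra K L] [Algebra L M] [Algebra K M] [IsScalarTower K L M]

/-- Good reduction implies that inertia acts trivially on division points. -/
theorem IsGoodModel.inertia_apply_eq {φ : DrinfeldModule ι r} (hr : 0 < r)
    {W : ValuationSubring M} {u : K} {hu : u ≠ 0}
    (h : (φ.conj u hu).IsGoodModel (W.valuation.comap (algebraMap K M)))
    (hι : ∀ a, W.valuation (algebraMap K M (ι a)) ≤ 1) {a : Fq[X]} (ham : a.Monic)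
    (ha : W.valuation (algebraMap K M (ι a)) = 1) {σ : W.decompositionSubgroup L}
    (hσ : σ ∈ W.inertiaSubgroup L) {x : M}
    (hx : TwistedPoly.eval ι M (φ.toRingHom a) x = 0) : σ.1 x = x := by
  have hu' : algebraMap K M u ≠ 0 := (_root_.map_ne_zero _).2 hu
  have h1 : TwistedPoly.eval ι M ((φ.conj u hu).toRingHom a) (algebraMap K M u * x) = 0 := by
    rw [eval_conj_apply, hx, mul_zero]
  have h2 := h.valuation_le_one_of_eval_eq_zero hr hι ham h1
  have h3 := ValuationSubring.mem_inertiaSubgroup_iff.1 hσ _ ((W.valuation_le_one_iff _).1 h2)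
  have hσu : σ.1 (algebraMap K M u) = algebraMap K M u := by
    rw [IsScalarTower.algebraMap_apply K L M, AlgEquiv.commutes]
  have h4 : TwistedPoly.eval ι M ((φ.conj u hu).toRingHom a)
      (σ.1 (algebraMap K M u * x)) = 0 := by
    have := TwistedPoly.eval_algHom ((σ.1 : M ≃ₐ[L] M).restrictScalars K).toAlgHom
      ((φ.conj u hu).toRingHom a) (algebraMap K M u * x)
    rw [h1, map_zero] at this
    exact this.symm
  -- The difference of a division point and its image under inertia is a division point in the
  -- maximal ideal.
  have h5 := h.eq_zero_of_eval_eq_zero hι ha (x := σ.1 (algebraMap K M u * x) - algebraMap K M u * x)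
    (by rw [map_sub, h1, h4, sub_zero]) h3
  rw [map_mul, hσu, ← mul_sub] at h5
  exact sub_eq_zero.1 ((mul_eq_zero.1 h5).resolve_left hu')

end DrinfeldModule

/-! ### Inertia in possibly infinite algebraic extensions. -/

namespace ValuationSubring

variable {L N : Type*} [Field L] [Field N] [Algebra L N]

/-- An element outside an integrally closed subring is missed by some valuation ring containing that
subring. -/
theorem mem_integralClosure_of_forall (w : ValuationSubring L) {y : N}
    (h : ∀ V : ValuationSubring N, (∀ a ∈ w, algebraMap L N a ∈ V) → y ∈ V) :
    y ∈ integralClosure w N := by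
  by_contra hy
  have : IsIntegrallyClosedIn (integralClosure w N).toSubring N :=
    inferInstanceAs (IsIntegrallyClosedIn (integralClosure w N) N)
  obtain ⟨V, hV, hyV⟩ := Subring.exists_le_valuationSubring_of_isIntegrallyClosedIn
    (R := (integralClosure w N).toSubring) (x := y) hy
  exact hyV (h V fun a ha => hV ((integralClosure w N).algebraMap_mem ⟨a, ha⟩))

theorem mem_of_mem_integralClosure {w : ValuationSubring L} {W : ValuationSubring N}
    (h : W.comap (algebraMap L N) = w) {y : N} (hy : y ∈ integralClosure w N) : y ∈ W := by
  have h1 : IsIntegral w y := hy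
  let f : w →+* W := ((algebraMap L N).comp w.subtype).codRestrict W.toSubring fun a => by
    have ha : a.1 ∈ W.comap (algebraMap L N) := h ▸ a.2
    exact ha
  obtain ⟨p, hp, hpy⟩ := h1
  have h2 : IsIntegral W y := ⟨p.map f, hp.map f, by rw [eval₂_map]; exact hpy⟩
  obtain ⟨z, hz⟩ := IsIntegrallyClosed.isIntegral_iff.1 h2
  rw [← hz]
  exact z.2

/-- A valuation ring in an algebraic extension is generated by fractions of integral elements. -/
theorem exists_integral_mul_mem [Algebra.IsAlgebraic L N] {w : ValuationSubring L}
    {W : ValuationSubring N} (h : W.comap (algebraMap L N) = w) {x : N} (hx : x ∈ W) :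
    ∃ b ∈ integralClosure w N, x * b ∈ integralClosure w N ∧ W.valuation b = 1 := by
  classical
  rcases eq_or_ne x 0 with rfl | hx0
  · exact ⟨1, (integralClosure w N).one_mem, by
      rw [zero_mul]; exact (integralClosure w N).zero_mem, map_one _⟩
  have hxint := Algebra.IsIntegral.isIntegral (R := L) x
  let m := minpoly L x
  -- Dividing by a coefficient of largest value gives an integral equation for `x` with coefficient
  -- one at `j`.
  obtain ⟨j, hj, hmax⟩ := Finset.exists_max_image m.support (fun i => w.valuation (m.coeff i))
    (nonempty_support_iff.2 (minpoly.ne_zero hxint))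
  have hj0 : m.coeff j ≠ 0 := mem_support_iff.1 hj
  let p : L[X] := C (m.coeff j)⁻¹ * m
  have hpj : p.coeff j = 1 := by rw [coeff_C_mul, inv_mul_cancel₀ hj0]
  have hpw : ∀ i, p.coeff i ∈ w := by
    intro i
    rw [← w.valuation_le_one_iff, coeff_C_mul, map_mul, map_inv₀]
    rcases eq_or_ne (m.coeff i) 0 with h0 | h0
    · rw [h0, map_zero, mul_zero]; exact zero_le
    · exact inv_mul_le_one_of_le₀ (hmax i (mem_support_iff.2 h0)) zero_le
  have hpx : aeval x p = 0 := by rw [map_mul, minpoly.aeval, mul_zero]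
  let n := p.natDegree
  let a : ℕ → N := fun i => algebraMap L N (p.coeff i)
  have hsum : ∑ i ∈ Finset.range (n + 1), a i * x ^ i = 0 := by
    rw [← hpx, aeval_eq_sum_range]
    exact Finset.sum_congr rfl fun i _ => by rw [Algebra.smul_def]
  -- the truncations of `p` at `x`
  let b : ℕ → N := fun k => ∑ i ∈ Finset.Ico k (n + 1), a i * x ^ (i - k)
  have hb : ∀ k, b k * x ^ k = ∑ i ∈ Finset.Ico k (n + 1), a i * x ^ i := by
    intro k
    rw [Finset.sum_mul]
    refine Finset.sum_congr rfl fun i hi => ?_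
    rw [mul_assoc, ← pow_add, Nat.sub_add_cancel (Finset.mem_Ico.1 hi).1]
  have hb' : ∀ k ≤ n + 1, b k = - ∑ i ∈ Finset.range k, a i * x⁻¹ ^ (k - i) := by
    intro k hk
    have h1 : b k * x ^ k + ∑ i ∈ Finset.range k, a i * x ^ i = 0 := by
      rw [hb, add_comm, Finset.sum_range_add_sum_Ico _ hk, hsum]
    have h2 : (∑ i ∈ Finset.range k, a i * x⁻¹ ^ (k - i)) * x ^ k =
        ∑ i ∈ Finset.range k, a i * x ^ i := by
      rw [Finset.sum_mul]
      refine Finset.sum_congr rfl fun i hi => ?_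
      have hik := (Finset.mem_range.1 hi).le
      rw [mul_assoc, inv_pow, ← Nat.sub_add_cancel hik, Nat.add_sub_cancel, pow_add,
        inv_mul_cancel_left₀ (pow_ne_zero _ hx0)]
    have h3 : (b k + ∑ i ∈ Finset.range k, a i * x⁻¹ ^ (k - i)) * x ^ k = 0 := by
      rw [add_mul, h2, h1]
    exact eq_neg_of_add_eq_zero_left
      ((mul_eq_zero.1 h3).resolve_right (pow_ne_zero _ hx0))
  have hbint : ∀ k ≤ n + 1, b k ∈ integralClosure w N := by
    intro k hk
    -- Every valuation ring contains `x` or `x⁻¹`; the definition of `b k` is polynomial in the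
    -- former, `hb'` rewrites it as polynomial in the latter.
    refine mem_integralClosure_of_forall w fun V hV => ?_
    rcases V.mem_or_inv_mem x with hxV | hxV
    · exact sum_mem fun i _ => V.mul_mem _ _ (hV _ (hpw i)) (pow_mem hxV _)
    · rw [hb' k hk]
      exact V.neg_mem _ (sum_mem fun i _ => V.mul_mem _ _ (hV _ (hpw i)) (pow_mem hxV _))
  have hrec : ∀ k ≤ n, b k = a k + x * b (k + 1) := by
    intro k hk
    change ∑ i ∈ Finset.Ico k (n + 1), _ = _ + x * ∑ i ∈ Finset.Ico (k + 1) (n + 1), _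
    rw [Finset.sum_eq_sum_Ico_succ_bot (by omega), Nat.sub_self, pow_zero, mul_one, Finset.mul_sum]
    congr 1
    refine Finset.sum_congr rfl fun i hi => ?_
    have := (Finset.mem_Ico.1 hi).1
    rw [show i - k = i - (k + 1) + 1 by omega, pow_succ]
    ring
  have haint : ∀ k, a k ∈ integralClosure w N := fun k =>
    (integralClosure w N).algebraMap_mem ⟨_, hpw k⟩
  have hxbint : ∀ k ≤ n, x * b (k + 1) ∈ integralClosure w N := by
    intro k hk
    rw [← sub_eq_iff_eq_add'.2 (hrec k hk)]
    exact sub_mem (hbint k (by omega)) (haint k)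
  have hjn : j ≤ n := le_natDegree_of_ne_zero (by rw [hpj]; exact one_ne_zero)
  have hb0 : b 0 = 0 := by rw [hb' 0 (by omega)]; simp
  have haj : a j = 1 := by change algebraMap L N (p.coeff j) = 1; rw [hpj, map_one]
  have hle : ∀ y ∈ integralClosure w N, W.valuation y ≤ 1 := fun y hy =>
    (W.valuation_le_one_iff y).2 (mem_of_mem_integralClosure h hy)
  have hj1 := hrec j hjn
  rw [haj] at hj1
  have hxW := (W.valuation_le_one_iff x).2 hx
  -- Since `b j = 1 + x * b (j + 1)`, either `b (j + 1)` is a unit at `W` or `b j` is, and then the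
  -- index one lower gives the fraction. The index zero cannot occur, as `b 0 = 0`.
  by_cases hu : W.valuation (b (j + 1)) = 1
  · exact ⟨b (j + 1), hbint _ (by omega), hxbint j hjn, hu⟩
  · have hlt : W.valuation (x * b (j + 1)) < 1 := by
      rw [map_mul]
      exact (mul_le_of_le_one_left' hxW).trans_lt (lt_of_le_of_ne (hle _ (hbint _ (by omega))) hu)
    have hbj : W.valuation (b j) = 1 := by
      rw [hj1, Valuation.map_add_eq_of_lt_left _ (by rwa [map_one]), map_one]
    rcases j with _ | j
    · rw [hb0, map_zero] at hbj
      exact absurd hbj zero_ne_one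
    · exact ⟨b (j + 1), hbint _ (by omega), hxbint j (by omega), hbj⟩

open scoped Pointwise in
/-- The inertia group of a valuation ring is determined by the action on integral elements. -/
theorem exists_mem_inertiaSubgroup [Algebra.IsAlgebraic L N] {w : ValuationSubring L}
    {W : ValuationSubring N} (h : W.comap (algebraMap L N) = w) {k : Type*} [Field k] [Algebra k N]
    (σ : N ≃ₐ[k] N) (hσ : ∀ b ∈ integralClosure w N, W.valuation (σ b - b) < 1) :
    ∃ hD : σ ∈ W.decompositionSubgroup k, (⟨σ, hD⟩ : W.decompositionSubgroup k) ∈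
      W.inertiaSubgroup k := by
  have hle : ∀ y ∈ integralClosure w N, W.valuation y ≤ 1 := fun y hy =>
    (W.valuation_le_one_iff y).2 (mem_of_mem_integralClosure h hy)
  have hσle : ∀ y ∈ integralClosure w N, W.valuation (σ y) ≤ 1 := fun y hy => by
    have := W.valuation.map_add (σ y - y) y
    rw [sub_add_cancel] at this
    exact this.trans (max_le (hσ y hy).le (hle y hy))
  have key : ∀ x ∈ W, W.valuation (σ x - x) < 1 := by
    intro x hx
    obtain ⟨b, hb, hxb, hb1⟩ := exists_integral_mul_mem h hx
    have hb0 : b ≠ 0 := by rintro rfl; simp at hb1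
    have hσb1 : W.valuation (σ b) = 1 := by
      have := W.valuation.map_add_eq_of_lt_right (x := σ b - b) (y := b)
        (by rw [hb1]; exact hσ b hb)
      rwa [sub_add_cancel, hb1] at this
    -- Writing `x` as the fraction of the integral elements `x * b` and `b`, the congruence for `x`
    -- follows from the two for them, because `σ b` is still a unit.
    have hid : (σ x - x) * σ b = (σ (x * b) - x * b) - x * (σ b - b) := by
      rw [map_mul]; ring
    have h2 : W.valuation ((σ x - x) * σ b) < 1 := by
      rw [hid]
      refine (W.valuation.map_sub _ _).trans_lt (max_lt (hσ _ hxb) ?_)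
      rw [map_mul]
      exact (mul_le_of_le_one_left' ((W.valuation_le_one_iff x).2 hx)).trans_lt (hσ b hb)
    rwa [map_mul, hσb1, mul_one] at h2
  have hmem : ∀ x ∈ W, σ x ∈ W := by
    intro x hx
    have := W.add_mem _ _ ((W.valuation_le_one_iff _).1 (key x hx).le) hx
    rwa [sub_add_cancel] at this
  have hmem' : ∀ x, σ x ∈ W → x ∈ W := by
    intro x hx
    by_contra hxW
    have hx0 : x ≠ 0 := by rintro rfl; exact hxW W.zero_mem
    have hinv : x⁻¹ ∈ W := (W.mem_or_inv_mem x).resolve_left hxW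
    have h1 := hmem _ hinv
    have hlt : W.valuation x⁻¹ < 1 := by
      rw [map_inv₀]
      refine inv_lt_one_of_one_lt₀ ?_
      by_contra! hcon
      exact hxW ((W.valuation_le_one_iff x).1 hcon)
    have h2 : W.valuation (σ x⁻¹) < 1 := by
      have := W.valuation.map_add (σ x⁻¹ - x⁻¹) x⁻¹
      rw [sub_add_cancel] at this
      exact this.trans_lt (max_lt (key _ hinv) hlt)
    have h3 : W.valuation (σ x) * W.valuation (σ x⁻¹) = 1 := by
      rw [← map_mul, ← map_mul, mul_inv_cancel₀ hx0, map_one, map_one]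
    have h4 : W.valuation (σ x) * W.valuation (σ x⁻¹) < 1 :=
      (mul_le_of_le_one_left' ((W.valuation_le_one_iff _).2 hx)).trans_lt h2
    exact h4.ne h3
  refine ⟨?_, ValuationSubring.mem_inertiaSubgroup_iff.2 key⟩
  rw [MulAction.mem_stabilizer_iff]
  ext x
  rw [ValuationSubring.mem_smul_pointwise_iff_exists]
  constructor
  · rintro ⟨y, hy, rfl⟩
    exact hmem y hy
  · intro hx
    refine ⟨σ.symm x, hmem' _ ?_, σ.apply_symm_apply x⟩
    rwa [σ.apply_symm_apply]

end ValuationSubring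

open scoped Pointwise in
/-- For a profinite group `G` acting on `B` with ring of invariants `A`, an automorphism of `B`
which acts trivially on `A` modulo a prime `Q` of `B` is trivial modulo `Q` up to `G`. -/
theorem Algebra.IsInvariant.exists_smul_sub_mem {A B G : Type*} [CommRing A] [CommRing B]
    [Algebra A B] [Group G] [MulSemiringAction G B] [SMulCommClass G A B] [TopologicalSpace G]
    [CompactSpace G] [TotallyDisconnectedSpace G] [IsTopologicalGroup G] [TopologicalSpace B]
    [DiscreteTopology B] [ContinuousSMul G B] [Algebra.IsInvariant A B G] (Q : Ideal B)
    [Q.IsPrime] (τ : A ≃+* A) (g : B ≃+* B)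
    (hg : ∀ a, g (algebraMap A B a) = algebraMap A B (τ a))
    (hτ : ∀ a, τ a - a ∈ Q.under A) : ∃ h : G, ∀ b, h • g b - b ∈ Q := by
  have hτ' : ∀ a, τ.symm a ∈ Q.under A ↔ a ∈ Q.under A := by
    intro a
    have := hτ (τ.symm a)
    rw [τ.apply_symm_apply] at this
    refine ⟨fun h => ?_, fun h => ?_⟩
    · have := add_mem this h
      rwa [sub_add_cancel] at this
    · have := sub_mem h this
      rwa [sub_sub_cancel] at this
  have hgs : ∀ a, g.symm (algebraMap A B a) = algebraMap A B (τ.symm a) := by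
    intro a
    rw [g.symm_apply_eq, hg, τ.apply_symm_apply]
  -- This is the image of `Q` under `g`. It has the same contraction as `Q` because `τ` is trivial
  -- modulo that contraction, so transitivity of `G` on primes lets `g` be corrected to preserve
  -- `Q`.
  let Q' : Ideal B := Q.comap (g.symm : B →+* B)
  have hQ' : Q'.under A = Q.under A := by
    ext a
    rw [← hτ' a]
    change g.symm (algebraMap A B a) ∈ Q ↔ algebraMap A B (τ.symm a) ∈ Q
    rw [hgs]
  obtain ⟨h₁, hh₁⟩ := Algebra.IsInvariant.exists_smul_of_under_eq_of_profinite (A := A) (G := G)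
    Q' Q hQ'
  let g₁ : B ≃+* B := g.trans (MulSemiringAction.toRingEquiv G B h₁)
  have hg₁ : ∀ b, g₁ b = h₁ • g b := fun b => rfl
  have hg₁Q : ∀ b, g₁ b ∈ Q ↔ b ∈ Q := by
    intro b
    rw [hg₁]
    conv_lhs => rw [hh₁]
    rw [Ideal.smul_mem_pointwise_smul_iff]
    change g.symm (g b) ∈ Q ↔ _
    rw [g.symm_apply_apply]
  have hmap : Q = Q.map (g₁ : B →+* B) := by
    refine le_antisymm (fun b hb => ?_) (Ideal.map_le_iff_le_comap.2 fun b hb => (hg₁Q b).2 hb)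
    have := Ideal.mem_map_of_mem (g₁ : B →+* B) ((hg₁Q (g₁.symm b)).1 (by
      rwa [g₁.apply_symm_apply]))
    change g₁ (g₁.symm b) ∈ _ at this
    rwa [g₁.apply_symm_apply] at this
  -- The corrected map acts on the residue ring over that of `A`; surjectivity of the stabiliser
  -- onto such automorphisms removes this action as well.
  let σ : (B ⧸ Q) ≃ₐ[A ⧸ Q.under A] (B ⧸ Q) := AlgEquiv.ofRingEquiv
    (f := Ideal.quotientEquiv Q Q g₁ hmap) (by
      intro a
      obtain ⟨a, rfl⟩ := Ideal.Quotient.mk_surjective a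
      change Ideal.Quotient.mk Q (g₁ (algebraMap A B a)) = Ideal.Quotient.mk Q (algebraMap A B a)
      rw [Ideal.Quotient.eq, hg₁, hg, smul_algebraMap, ← map_sub]
      exact hτ a)
  obtain ⟨h₂, hh₂⟩ := Ideal.Quotient.stabilizerHom_surjective_of_profinite (G := G)
    (Q.under A) Q σ
  refine ⟨h₂.1⁻¹ * h₁, fun b => ?_⟩
  have h3 : Ideal.Quotient.mk Q (h₂.1 • b) = Ideal.Quotient.mk Q (g₁ b) :=
    DFunLike.congr_fun hh₂ (Ideal.Quotient.mk Q b)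
  rw [eq_comm, Ideal.Quotient.eq, hg₁] at h3
  have h4 : h₂.1⁻¹ • Q = Q := by
    rw [inv_smul_eq_iff]
    exact h₂.2.symm
  have h5 := Ideal.smul_mem_pointwise_smul h₂.1⁻¹ _ _ h3
  rwa [h4, smul_sub, inv_smul_smul, ← mul_smul] at h5

namespace ValuationSubring

variable {L N : Type*} [Field L] [Field N] [Algebra L N]

/-- The centre of a valuation ring `W` on the integral closure of `w = W ∩ L`. -/
def center (w : ValuationSubring L) (W : ValuationSubring N) (h : W.comap (algebraMap L N) = w) :
    Ideal (integralClosure w N) where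
  carrier := {b | W.valuation b.1 < 1}
  add_mem' {a b} ha hb := (W.valuation.map_add _ _).trans_lt (max_lt ha hb)
  zero_mem' := by
    change W.valuation 0 < 1
    rw [map_zero]
    exact zero_lt_one
  smul_mem' c x hx := by
    change W.valuation (c.1 * x.1) < 1
    rw [map_mul]
    exact (mul_le_of_le_one_left'
      ((W.valuation_le_one_iff _).2 (mem_of_mem_integralClosure h c.2))).trans_lt hx

theorem mem_center {w : ValuationSubring L} {W : ValuationSubring N}
    {h : W.comap (algebraMap L N) = w} {b : integralClosure w N} :
    b ∈ center w W h ↔ W.valuation b.1 < 1 := Iff.rfl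

instance isPrime_center (w : ValuationSubring L) (W : ValuationSubring N)
    (h : W.comap (algebraMap L N) = w) : (center w W h).IsPrime where
  ne_top' := by
    rw [Ne, Ideal.eq_top_iff_one, mem_center]
    simp
  mem_or_mem' {x y} hxy := by
    by_contra! hcon
    simp only [mem_center, not_lt] at hcon hxy
    rw [MulMemClass.coe_mul, map_mul] at hxy
    exact (one_le_mul hcon.1 hcon.2).not_gt hxy

theorem valuation_algebraMap_lt_one_iff {w : ValuationSubring L} {W : ValuationSubring N}
    (h : W.comap (algebraMap L N) = w) (x : L) :
    W.valuation (algebraMap L N x) < 1 ↔ w.valuation x < 1 := by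
  subst h
  rw [← mem_nonunits_iff, ← mem_nonunits_iff, mem_nonunits_iff_or, mem_nonunits_iff_or,
    mem_comap, map_inv₀, map_eq_zero]

open scoped Pointwise in
/-- Elements of the inertia group of a Galois subextension lift to elements of the inertia
group. -/
theorem exists_inertia_lift [IsGalois L N] (F : IntermediateField L N) [Normal L F]
    (W : ValuationSubring N) (W₀ : ValuationSubring F) (h : W.comap (algebraMap F N) = W₀)
    (τ : W₀.decompositionSubgroup L) (hτ : τ ∈ W₀.inertiaSubgroup L) :
    ∃ σ : W.decompositionSubgroup L, σ ∈ W.inertiaSubgroup L ∧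
      ∀ x : F, σ.1 (algebraMap F N x) = algebraMap F N (τ.1 x) := by
  have hg : ∀ x : F, (AlgEquiv.liftNormal τ.1 N) (algebraMap F N x) = algebraMap F N (τ.1 x) :=
    AlgEquiv.liftNormal_commutes τ.1 N
  set g : N ≃ₐ[L] N := AlgEquiv.liftNormal τ.1 N
  have hmem : ∀ x, x ∈ W₀ ↔ τ.1 x ∈ W₀ := by
    intro x
    have h1 : τ.1 • W₀ = W₀ := τ.2
    have h2 : τ.1 x ∈ τ.1 • W₀ ↔ x ∈ W₀ := ValuationSubring.smul_mem_pointwise_smul_iff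
    rw [h1] at h2
    exact h2.symm
  have hmem' : ∀ x, x ∈ W₀ ↔ τ.1.symm x ∈ W₀ := fun x => by
    rw [hmem (τ.1.symm x), AlgEquiv.apply_symm_apply]
  have hgs : ∀ x : F, g.symm (algebraMap F N x) = algebraMap F N (τ.1.symm x) := by
    intro x
    rw [AlgEquiv.symm_apply_eq, hg, AlgEquiv.apply_symm_apply]
  let t : W₀ ≃+* W₀ :=
    { toFun a := ⟨τ.1 a.1, (hmem _).1 a.2⟩
      invFun a := ⟨τ.1.symm a.1, (hmem' _).1 a.2⟩
      left_inv a := Subtype.ext (τ.1.symm_apply_apply a.1)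
      right_inv a := Subtype.ext (τ.1.apply_symm_apply a.1)
      map_mul' a b := Subtype.ext (map_mul τ.1 a.1 b.1)
      map_add' a b := Subtype.ext (map_add τ.1 a.1 b.1) }
  have hint : ∀ b ∈ integralClosure W₀ N, g b ∈ integralClosure W₀ N := fun b hb =>
    IsIntegral.map_of_comp_eq (t : W₀ →+* W₀) (g : N →+* N)
      (RingHom.ext fun a => (hg a.1).symm) hb
  have hint' : ∀ b ∈ integralClosure W₀ N, g.symm b ∈ integralClosure W₀ N := fun b hb =>
    IsIntegral.map_of_comp_eq (t.symm : W₀ →+* W₀) (g.symm : N →+* N)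
      (RingHom.ext fun a => (hgs a.1).symm) hb
  let gB : integralClosure W₀ N ≃+* integralClosure W₀ N :=
    { toFun b := ⟨g b.1, hint _ b.2⟩
      invFun b := ⟨g.symm b.1, hint' _ b.2⟩
      left_inv b := Subtype.ext (g.symm_apply_apply b.1)
      right_inv b := Subtype.ext (g.apply_symm_apply b.1)
      map_mul' a b := Subtype.ext (map_mul g a.1 b.1)
      map_add' a b := Subtype.ext (map_add g a.1 b.1) }
  have : Algebra.IsAlgebraic W₀ N :=
    (IsFractionRing.comap_isAlgebraic_iff (A := W₀) (K := F) (C := N)).2 inferInstance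
  have hfrac : IsFractionRing (integralClosure W₀ N) N :=
    integralClosure.isFractionRing_of_algebraic fun x hx => by
      rw [IsScalarTower.algebraMap_apply W₀ F N, map_eq_zero] at hx
      exact Subtype.ext hx
  have : IsGaloisGroup (N ≃ₐ[F] N) W₀ (integralClosure W₀ N) :=
    IsGaloisGroup.of_isFractionRing (N ≃ₐ[F] N) W₀ (integralClosure W₀ N) F N
  -- With the discrete topology, continuity of the action amounts to stabilisers being open, which
  -- holds because all elements are algebraic.
  let : TopologicalSpace (integralClosure W₀ N) := ⊥
  have : DiscreteTopology (integralClosure W₀ N) := ⟨rfl⟩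
  have : ContinuousSMul (N ≃ₐ[F] N) (integralClosure W₀ N) := by
    rw [continuousSMul_iff_stabilizer_isOpen]
    intro b
    have h1 : MulAction.stabilizer (N ≃ₐ[F] N) b = MulAction.stabilizer (N ≃ₐ[F] N) b.1 := by
      ext σ
      rw [MulAction.mem_stabilizer_iff, MulAction.mem_stabilizer_iff]
      exact Subtype.ext_iff
    rw [h1]
    exact stabilizer_isOpen_of_isIntegral b.1
  obtain ⟨s, hs⟩ := Algebra.IsInvariant.exists_smul_sub_mem (G := N ≃ₐ[F] N) (center W₀ W h) t gB
    (fun a => Subtype.ext (hg a.1)) (fun a => by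
      have h2 := mem_inertiaSubgroup_iff.1 hτ a.1 a.2
      change W.valuation (algebraMap F N (τ.1 a.1 - a.1)) < 1
      rwa [valuation_algebraMap_lt_one_iff h])
  let σ : N ≃ₐ[L] N := g.trans (s.restrictScalars L)
  obtain ⟨hD, hI⟩ := exists_mem_inertiaSubgroup h σ fun b hb => hs ⟨b, hb⟩
  refine ⟨⟨σ, hD⟩, hI, fun x => ?_⟩
  -- The correction `s` fixes `F`, so the restriction to `F` is still `τ`.
  change s (g (algebraMap F N x)) = _
  rw [hg, AlgEquiv.commutes]

/-- Every inertia element of the subextension lifts to one of `W` by `exists_inertia_lift`, hence is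
a restriction of the identity. This reduces questions on values to finite subextensions. -/
theorem inertiaSubgroup_comap_eq_bot [IsGalois L N] (F : IntermediateField L N) [Normal L F]
    (W : ValuationSubring N) (h : W.inertiaSubgroup L = ⊥) :
    (W.comap (algebraMap F N)).inertiaSubgroup L = ⊥ := by
  rw [eq_bot_iff]
  intro τ hτ
  obtain ⟨σ, hσ, hστ⟩ := exists_inertia_lift F W _ rfl τ hτ
  rw [h, Subgroup.mem_bot] at hσ
  rw [Subgroup.mem_bot]
  refine Subtype.ext (AlgEquiv.ext fun x => (algebraMap F N).injective ?_)
  rw [← hστ, hσ]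
  rfl

end ValuationSubring

/-! ### Unramified extensions keep the value group. -/

namespace ValuationSubring

variable {L N : Type*} [Field L] [Field N]

theorem comap_valuation_le_iff (W : ValuationSubring N) (f : L →+* N) (x y : L) :
    (W.comap f).valuation x ≤ (W.comap f).valuation y ↔ W.valuation (f x) ≤ W.valuation (f y) := by
  rcases eq_or_ne y 0 with rfl | hy
  · rw [map_zero, map_zero, map_zero, le_zero_iff, le_zero_iff, Valuation.zero_iff,
      Valuation.zero_iff, map_eq_zero]
  · have h1 : (W.comap f).valuation y ≠ 0 := (Valuation.ne_zero_iff _).2 hy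
    have h2 : W.valuation (f y) ≠ 0 := (Valuation.ne_zero_iff _).2 ((_root_.map_ne_zero f).2 hy)
    rw [← div_le_one₀ (zero_lt_iff.2 h1), ← div_le_one₀ (zero_lt_iff.2 h2), ← map_div₀, ← map_div₀,
      ← map_div₀, valuation_le_one_iff, valuation_le_one_iff, mem_comap]

theorem comap_valuation_lt_iff (W : ValuationSubring N) (f : L →+* N) (x y : L) :
    (W.comap f).valuation x < (W.comap f).valuation y ↔ W.valuation (f x) < W.valuation (f y) := by
  rw [← not_le, ← not_le, comap_valuation_le_iff]

theorem comap_valuation_eq_iff (W : ValuationSubring N) (f : L →+* N) (x y : L) :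
    (W.comap f).valuation x = (W.comap f).valuation y ↔ W.valuation (f x) = W.valuation (f y) := by
  rw [le_antisymm_iff, le_antisymm_iff, comap_valuation_le_iff, comap_valuation_le_iff]

theorem comap_valuation_le_one_iff (W : ValuationSubring N) (f : L →+* N) (x : L) :
    (W.comap f).valuation x ≤ 1 ↔ W.valuation (f x) ≤ 1 := by
  rw [valuation_le_one_iff, valuation_le_one_iff, mem_comap]

theorem comap_valuation_eq_one_iff (W : ValuationSubring N) (f : L →+* N) (x : L) :
    (W.comap f).valuation x = 1 ↔ W.valuation (f x) = 1 := by
  simpa using comap_valuation_eq_iff W f x 1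

variable [Algebra L N]

/-- For a perfect residue field the ramification index is the order of the inertia group of the
centre, and by `exists_mem_inertiaSubgroup` that group embeds in the inertia group of `W`. -/
theorem ramificationIdx_center_eq_one [FiniteDimensional L N] [IsGalois L N]
    {w : ValuationSubring L} [IsDiscreteValuationRing w]
    [PerfectField (IsLocalRing.maximalIdeal w).ResidueField] {W : ValuationSubring N}
    (h : W.comap (algebraMap L N) = w) (hI : W.inertiaSubgroup L = ⊥)
    [(center w W h).LiesOver (IsLocalRing.maximalIdeal w)] :
    (center w W h).ramificationIdx w = 1 := by
  have : IsFractionRing (integralClosure w N) N :=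
    integralClosure.isFractionRing_of_finite_extension L N
  have : IsGaloisGroup (N ≃ₐ[L] N) w (integralClosure w N) :=
    IsGaloisGroup.of_isFractionRing (N ≃ₐ[L] N) w (integralClosure w N) L N
  have : Module.Finite w (integralClosure w N) := IsIntegralClosure.finite w L N _
  have : Module.Free w (integralClosure w N) := IsIntegralClosure.module_free w L N _
  have h1 : Ideal.inertia (N ≃ₐ[L] N) (center w W h) = ⊥ := by
    rw [eq_bot_iff]
    intro σ hσ
    obtain ⟨hD, hσI⟩ := exists_mem_inertiaSubgroup h σ fun b hb => hσ ⟨b, hb⟩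
    rw [hI, Subgroup.mem_bot] at hσI
    exact congrArg Subtype.val hσI
  have h2 := Ideal.card_inertia_eq_ramificationIdxIn (G := N ≃ₐ[L] N)
    (IsLocalRing.maximalIdeal w) (center w W h)
  rw [h1, Ideal.ramificationIdxIn_eq_ramificationIdx (IsLocalRing.maximalIdeal w) (center w W h)
    (N ≃ₐ[L] N)] at h2
  rw [← h2]
  simp

/-- With ramification index one, the adic valuation at the centre of `W` restricts to the normalised
one on `L`, which takes all integral exponents. The adic valuation ring is contained in `W`, so
equality of adic values passes to `W`. -/
theorem exists_valuation_eq_of_finite [FiniteDimensional L N] [IsGalois L N]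
    {w : ValuationSubring L} [IsDiscreteValuationRing w]
    [PerfectField (IsLocalRing.maximalIdeal w).ResidueField] {W : ValuationSubring N}
    (h : W.comap (algebraMap L N) = w) (hI : W.inertiaSubgroup L = ⊥) {x : N} (hx : x ≠ 0) :
    ∃ y : L, W.valuation (algebraMap L N y) = W.valuation x := by
  have : IsFractionRing (integralClosure w N) N :=
    integralClosure.isFractionRing_of_finite_extension L N
  have : IsDedekindDomain (integralClosure w N) := integralClosure.isDedekindDomain w L N
  have : Module.Free w (integralClosure w N) := IsIntegralClosure.module_free w L N _
  have hover : (center w W h).LiesOver (IsLocalRing.maximalIdeal w) := by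
    constructor
    ext a
    rw [valuation_lt_one_iff, ← valuation_algebraMap_lt_one_iff h]
    rfl
  have hp0 : IsLocalRing.maximalIdeal w ≠ ⊥ := IsDiscreteValuationRing.not_a_field w
  have hP0 : center w W h ≠ ⊥ := Ideal.ne_bot_of_liesOver_of_ne_bot hp0 _
  let v : IsDedekindDomain.HeightOneSpectrum w := ⟨IsLocalRing.maximalIdeal w, inferInstance, hp0⟩
  let V : IsDedekindDomain.HeightOneSpectrum (integralClosure w N) :=
    ⟨center w W h, inferInstance, hP0⟩
  have : V.asIdeal.LiesOver v.asIdeal := hover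
  have he : v.asIdeal.ramificationIdx' V.asIdeal = 1 :=
    (Ideal.ramificationIdx'_eq_ramificationIdx _ _ hp0).trans (ramificationIdx_center_eq_one h hI)
  have hv : ∀ y : L, v.valuation L y = V.valuation N (algebraMap L N y) := by
    intro y
    rw [← IsDedekindDomain.HeightOneSpectrum.valuation_liesOver N v V y, he, pow_one]
  have hle : ∀ z : N, V.valuation N z ≤ 1 → W.valuation z ≤ 1 := by
    intro z hz
    obtain ⟨n, d, hd⟩ :=
      IsDedekindDomain.HeightOneSpectrum.exists_primeCompl_mul_eq_of_integer V z hz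
    have hd1 : W.valuation d.1.1 = 1 := by
      refine le_antisymm ((W.valuation_le_one_iff _).2 (mem_of_mem_integralClosure h d.1.2)) ?_
      by_contra! hlt
      exact d.2 hlt
    have hd := congrArg W.valuation hd
    change W.valuation (z * d.1.1) = W.valuation n.1 at hd
    rw [map_mul, hd1, mul_one] at hd
    rw [hd]
    exact (W.valuation_le_one_iff _).2 (mem_of_mem_integralClosure h n.2)
  obtain ⟨ϖ, hϖ⟩ := v.valuation_exists_uniformizer L
  have hx0 : V.valuation N x ≠ 0 := (Valuation.ne_zero_iff _).2 hx
  obtain ⟨y, hy⟩ : ∃ y : L, v.valuation L y = V.valuation N x := by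
    refine ⟨ϖ ^ (-(V.valuation N x).log), ?_⟩
    rw [map_zpow₀, hϖ, ← WithZero.exp_zsmul]
    simp [WithZero.exp_log hx0]
  have hy0 : algebraMap L N y ≠ 0 := by
    intro h0
    rw [hv, h0, map_zero] at hy
    exact hx0 hy.symm
  refine ⟨y, ?_⟩
  rw [hv] at hy
  have key : ∀ a b : N, b ≠ 0 → V.valuation N a = V.valuation N b →
      W.valuation a ≤ W.valuation b := by
    intro a b hb hab
    have hb1 : W.valuation b ≠ 0 := (Valuation.ne_zero_iff _).2 hb
    rw [← div_le_one₀ (zero_lt_iff.2 hb1), ← map_div₀]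
    refine hle _ ?_
    rw [map_div₀, hab, div_self ((Valuation.ne_zero_iff _).2 hb)]
  exact le_antisymm (key _ _ hx hy) (key _ _ hy0 hy.symm)

/-- An unramified Galois extension does not enlarge a discrete value group. -/
theorem exists_valuation_eq_of_inertiaSubgroup_eq_bot [IsGalois L N]
    {w : ValuationSubring L} [IsDiscreteValuationRing w]
    [PerfectField (IsLocalRing.maximalIdeal w).ResidueField] {W : ValuationSubring N}
    (h : W.comap (algebraMap L N) = w) (hI : W.inertiaSubgroup L = ⊥) {x : N} (hx : x ≠ 0) :
    ∃ y : L, W.valuation (algebraMap L N y) = W.valuation x := by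
  let F := FiniteGaloisIntermediateField.adjoin L {x}
  have hxF : x ∈ F.toIntermediateField :=
    FiniteGaloisIntermediateField.subset_adjoin L {x} (Set.mem_singleton x)
  have hIF := inertiaSubgroup_comap_eq_bot F.toIntermediateField W hI
  have hF : (W.comap (algebraMap F.toIntermediateField N)).comap
      (algebraMap L F.toIntermediateField) = w := by
    rw [comap_comap, ← IsScalarTower.algebraMap_eq, h]
  obtain ⟨y, hy⟩ := exists_valuation_eq_of_finite hF hIF
    (x := (⟨x, hxF⟩ : F.toIntermediateField)) (by
      intro h0
      exact hx (congrArg Subtype.val h0))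
  exact ⟨y, (comap_valuation_eq_iff W _ _ _).1 hy⟩

end ValuationSubring

/-! ### Finite places of function fields: discreteness and perfect residue fields. -/

/-- `L` is a field extension of bounded degree of the fraction field of `Fq[X]`: the structure map
is injective and every element of `L` is a root of a primitive polynomial of degree at most `n`. -/
structure IsFunctionField {Fq L : Type*} [Field Fq] [Field L] (ι : Fq[X] →+* L) (n : ℕ) : Prop where
  injective : Function.Injective ι
  exists_isPrimitive : ∀ x : L, ∃ p : Fq[X][X], p.IsPrimitive ∧ p.natDegree ≤ n ∧ p.eval₂ ι x = 0

/-- Clear denominators in the minimal polynomial and divide by the content; neither changes the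
degree, which is at most that of the extension. -/
theorem isFunctionField_structureMap (Fq L : Type*) [Field Fq] [Field L] [Algebra (RatFunc Fq) L]
    [FiniteDimensional (RatFunc Fq) L] :
    IsFunctionField (structureMap Fq L) (Module.finrank (RatFunc Fq) L) where
  injective := (algebraMap (RatFunc Fq) L).injective.comp
    (IsFractionRing.injective Fq[X] (RatFunc Fq))
  exists_isPrimitive x := by
    classical
    let : NormalizedGCDMonoid Fq[X] := Nonempty.some inferInstance
    obtain ⟨b, hbm, hb⟩ := IsLocalization.integerNormalization_spec (nonZeroDivisors Fq[X])
      (minpoly (RatFunc Fq) x)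
    set g := IsLocalization.integerNormalization (nonZeroDivisors Fq[X])
      (minpoly (RatFunc Fq) x) with hg
    have hb0 : algebraMap Fq[X] (RatFunc Fq) b ≠ 0 :=
      IsFractionRing.to_map_ne_zero_of_mem_nonZeroDivisors hbm
    have hm0 : minpoly (RatFunc Fq) x ≠ 0 := minpoly.ne_zero (Algebra.IsIntegral.isIntegral x)
    have hb' : g.map (algebraMap Fq[X] (RatFunc Fq)) =
        C (algebraMap Fq[X] (RatFunc Fq) b) * minpoly (RatFunc Fq) x := by
      rw [hb, ← Polynomial.smul_eq_C_mul, algebraMap_smul]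
    have hinj := IsFractionRing.injective Fq[X] (RatFunc Fq)
    have hg0 : g ≠ 0 := by
      intro h0
      rw [h0, Polynomial.map_zero] at hb'
      exact mul_ne_zero (C_ne_zero.2 hb0) hm0 hb'.symm
    refine ⟨g.primPart, g.isPrimitive_primPart, ?_, ?_⟩
    · rw [natDegree_primPart, ← natDegree_map_eq_of_injective hinj, hb', natDegree_C_mul hb0]
      exact minpoly.natDegree_le x
    · have h1 : g.eval₂ (structureMap Fq L) x = 0 := by
        rw [structureMap, ← eval₂_map, hb', eval₂_mul, ← aeval_def (p := minpoly _ x),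
          minpoly.aeval, mul_zero]
      rw [g.eq_C_content_mul_primPart, eval₂_mul, eval₂_C] at h1
      refine (mul_eq_zero.1 h1).resolve_left ?_
      rw [structureMap, RingHom.comp_apply, ← Ne, _root_.map_ne_zero]
      exact (map_ne_zero_iff _ hinj).2 (content_eq_zero_iff.not.2 hg0)

namespace FinitePlace

variable {Fq L : Type*} [Field Fq] [Field L] {ι : Fq[X] →+* L} {n : ℕ}

/-- The residue characteristic of a finite place: a generator of the prime of `Fq[X]` below. -/
theorem exists_prime (hι : IsFunctionField ι n) (v : FinitePlace ι) :
    ∃ f : Fq[X], Irreducible f ∧ ∀ a, v.ring.valuation (ι a) < 1 ↔ f ∣ a := by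
  let P : Ideal Fq[X] := (IsLocalRing.maximalIdeal v.ring).comap
    (ι.codRestrict v.ring.toSubring v.map_mem)
  have hP : ∀ a, a ∈ P ↔ v.ring.valuation (ι a) < 1 := fun a =>
    (v.ring.valuation_lt_one_iff ⟨ι a, v.map_mem a⟩)
  have hprime : P.IsPrime := Ideal.IsPrime.comap _
  have hgen : ∀ a, v.ring.valuation (ι a) < 1 ↔ Submodule.IsPrincipal.generator P ∣ a :=
    fun a => by rw [← hP, Submodule.IsPrincipal.mem_iff_generator_dvd]
  -- If no prime lay below, all nonzero elements of $A$ would be units, and the leading term of an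
  -- equation would dominate at any non-integral element; so every element would be integral.
  have hbot : P ≠ ⊥ := by
    intro hbot
    have h1 : ∀ a, a ≠ 0 → v.ring.valuation (ι a) = 1 := by
      intro a ha
      refine le_antisymm (v.valuation_map_le_one a) (not_lt.1 fun h => ha ?_)
      rwa [← hP, hbot] at h
    refine v.ne_top (eq_top_iff.2 fun x _ => ?_)
    rw [← ValuationSubring.valuation_le_one_iff]
    by_contra! hx
    obtain ⟨p, hp, -, hpx⟩ := hι.exists_isPrimitive x
    rw [eval₂_eq_sum_range] at hpx
    have hterm : v.ring.valuation (ι (p.coeff p.natDegree) * x ^ p.natDegree) =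
        v.ring.valuation x ^ p.natDegree := by
      rw [map_mul, map_pow, h1 (p.coeff p.natDegree) (leadingCoeff_ne_zero.2 hp.ne_zero), one_mul]
    have := congrArg v.ring.valuation hpx
    rw [Valuation.map_sum_eq_of_lt (j := p.natDegree) _ (by simp), hterm, map_zero] at this
    · exact (pow_pos (zero_lt_one.trans hx) _).ne' this
    · intro i hi
      simp only [Finset.mem_sdiff, Finset.mem_singleton, Finset.mem_range] at hi
      rw [hterm, map_mul, map_pow]
      exact (mul_le_of_le_one_left' (v.valuation_map_le_one _)).trans_lt
        (pow_lt_pow_right₀ hx (by omega))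
  exact ⟨_, (Submodule.IsPrincipal.prime_generator_of_isPrime P hbot).irreducible, hgen⟩

theorem exists_valuation_eq_pow (v : FinitePlace ι) {f : Fq[X]} (hf : Irreducible f)
    (hvf : ∀ a, v.ring.valuation (ι a) < 1 ↔ f ∣ a) {a : Fq[X]} (ha : a ≠ 0) :
    ∃ k : ℕ, v.ring.valuation (ι a) = v.ring.valuation (ι f) ^ k := by
  have hfin := (FiniteMultiplicity.of_not_isUnit hf.not_isUnit ha)
  obtain ⟨b, hab, hb⟩ := hfin.exists_eq_pow_mul_and_not_dvd
  refine ⟨multiplicity f a, ?_⟩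
  have : v.ring.valuation (ι b) = 1 := le_antisymm (v.valuation_map_le_one b)
    (not_lt.1 ((hvf b).not.2 hb))
  conv_lhs => rw [hab, map_mul, map_mul, map_pow, map_pow, this, mul_one]

/-- A finite place is discrete: some power of the value group is infinite cyclic. -/
theorem exists_zpow_eq (hι : IsFunctionField ι n) (v : FinitePlace ι) {f : Fq[X]}
    (hf : Irreducible f) (hvf : ∀ a, v.ring.valuation (ι a) < 1 ↔ f ∣ a) {x : L} (hx : x ≠ 0) :
    ∃ m : ℤ, v.ring.valuation x ^ n.factorial = v.ring.valuation (ι f) ^ m := by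
  classical
  obtain ⟨p, hp, hdeg, hpx⟩ := hι.exists_isPrimitive x
  have hvx : v.ring.valuation x ≠ 0 := (Valuation.ne_zero_iff _).2 hx
  have hvf0 : v.ring.valuation (ι f) ≠ 0 :=
    (Valuation.ne_zero_iff _).2 ((map_ne_zero_iff _ hι.injective).2 hf.ne_zero)
  -- Two terms of the equation must have the same value, as a unique largest term could not cancel.
  -- Hence the power of `x` with exponent `j - i` has the value of a power of `f`.
  have key : ∃ i ∈ p.support, ∃ j ∈ p.support, i < j ∧
      v.ring.valuation (ι (p.coeff i) * x ^ i) = v.ring.valuation (ι (p.coeff j) * x ^ j) := by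
    by_contra! hne
    have hne' : ∀ i ∈ p.support, ∀ j ∈ p.support, i ≠ j →
      v.ring.valuation (ι (p.coeff i) * x ^ i) ≠ v.ring.valuation (ι (p.coeff j) * x ^ j) := by
      intro i hi j hj hij
      rcases lt_or_gt_of_ne hij with h | h
      · exact hne i hi j hj h
      · exact (hne j hj i hi h).symm
    obtain ⟨j, hj, hmax⟩ := p.support.exists_max_image
      (fun i => v.ring.valuation (ι (p.coeff i) * x ^ i)) (nonempty_support_iff.2 hp.ne_zero)
    rw [eval₂_eq_sum, Polynomial.sum] at hpx
    have := congrArg v.ring.valuation hpx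
    rw [Valuation.map_sum_eq_of_lt (j := j) _ hj, map_zero, Valuation.zero_iff] at this
    · exact mul_ne_zero ((map_ne_zero_iff _ hι.injective).2 (mem_support_iff.1 hj))
        (pow_ne_zero _ hx) this
    · intro i hi
      simp only [Finset.mem_sdiff, Finset.mem_singleton] at hi
      exact lt_of_le_of_ne (hmax i hi.1) (hne' i hi.1 j hj hi.2)
  obtain ⟨i, hi, j, hj, hij, h⟩ := key
  obtain ⟨k, hk⟩ := v.exists_valuation_eq_pow hf hvf (mem_support_iff.1 hi)
  obtain ⟨l, hl⟩ := v.exists_valuation_eq_pow hf hvf (mem_support_iff.1 hj)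
  have hjn : j ≤ n := (le_natDegree_of_mem_supp j hj).trans hdeg
  -- The exponent `j - i` depends on `x` but is at most `n`; the factorial is a common multiple for
  -- all `x`.
  obtain ⟨d, hd⟩ := Nat.dvd_factorial (Nat.sub_pos_of_lt hij) ((Nat.sub_le j i).trans hjn)
  refine ⟨((k : ℤ) - l) * d, ?_⟩
  rw [hd, pow_mul, zpow_mul, zpow_natCast, zpow_sub₀ hvf0, zpow_natCast, zpow_natCast, ← hk, ← hl]
  congr 1
  rw [map_mul, map_mul, map_pow, map_pow] at h
  have hvj : v.ring.valuation (ι (p.coeff j)) ≠ 0 :=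
    (Valuation.ne_zero_iff _).2 ((map_ne_zero_iff _ hι.injective).2 (mem_support_iff.1 hj))
  rw [eq_div_iff hvj, pow_sub₀ _ hvx hij.le]
  rw [mul_right_comm, mul_comm (_ ^ j), ← h, mul_assoc, mul_inv_cancel₀ (pow_ne_zero _ hvx),
    mul_one]

/-- The normalized order at a finite place, up to a positive constant. -/
theorem exists_order (hι : IsFunctionField ι n) (v : FinitePlace ι) :
    ∃ m : L → ℤ, (∀ x y, x ≠ 0 → y ≠ 0 → m (x * y) = m x + m y) ∧
      (∀ x y, x ≠ 0 → y ≠ 0 → (m x < m y ↔ v.ring.valuation y < v.ring.valuation x)) ∧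
      ∃ x, x ≠ 0 ∧ 0 < m x := by
  obtain ⟨f, hf, hvf⟩ := v.exists_prime hι
  have h := fun x (hx : x ≠ 0) => v.exists_zpow_eq hι hf hvf hx
  choose! m hm using h
  have hf0 : 0 < v.ring.valuation (ι f) :=
    zero_lt_iff.2 ((Valuation.ne_zero_iff _).2 ((map_ne_zero_iff _ hι.injective).2 hf.ne_zero))
  have hf1 : v.ring.valuation (ι f) < 1 := (hvf f).2 dvd_rfl
  have hanti := zpow_right_strictAnti₀ hf0 hf1
  have hlt : ∀ x y, x ≠ 0 → y ≠ 0 → (m x < m y ↔ v.ring.valuation y < v.ring.valuation x) := by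
    intro x y hx hy
    rw [← hanti.lt_iff_gt, ← hm x hx, ← hm y hy]
    exact pow_lt_pow_iff_left₀ zero_le zero_le n.factorial_ne_zero
  have hmul : ∀ x y, x ≠ 0 → y ≠ 0 → m (x * y) = m x + m y := by
    intro x y hx hy
    apply hanti.injective
    simp only
    rw [← hm _ (mul_ne_zero hx hy), map_mul, mul_pow, hm x hx, hm y hy, ← zpow_add₀ hf0.ne']
  refine ⟨m, hmul, hlt, ι f, (map_ne_zero_iff _ hι.injective).2 hf.ne_zero, ?_⟩
  have h1 : m 1 = 0 := by
    have := hmul 1 1 one_ne_zero one_ne_zero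
    rw [mul_one] at this
    omega
  rw [← h1, hlt _ _ one_ne_zero ((map_ne_zero_iff _ hι.injective).2 hf.ne_zero), map_one]
  exact hf1

/-- The negative of the order is positive at non-integral elements and grows with the value. It is
the measure on which the descent in `valuation_top_eq_one` ends. -/
theorem exists_nat_order (hι : IsFunctionField ι n) (v : FinitePlace ι) :
    ∃ μ : L → ℕ, ∀ x y, 1 < v.ring.valuation x → v.ring.valuation x < v.ring.valuation y →
      μ x < μ y := by
  obtain ⟨m, hmul, hlt, -⟩ := v.exists_order hι
  refine ⟨fun x => (-m x).toNat, fun x y hx hxy => ?_⟩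
  have hx0 : x ≠ 0 := by rintro rfl; simp at hx
  have hy0 : y ≠ 0 := by rintro rfl; simp at hxy
  have h1 : m 1 = 0 := by
    have := hmul 1 1 one_ne_zero one_ne_zero
    rw [mul_one] at this
    omega
  have h2 : m x < m 1 := (hlt x 1 hx0 one_ne_zero).2 (by rwa [map_one])
  have h3 : m y < m x := (hlt y x hy0 hx0).2 hxy
  simp only
  omega

/-- The order need not take the value one, so an element of least positive order serves as
uniformizer: the remainder after division by its order is zero by minimality. -/
theorem isDiscreteValuationRing (hι : IsFunctionField ι n) (v : FinitePlace ι) :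
    IsDiscreteValuationRing v.ring := by
  obtain ⟨m, hmul, hlt, x₀, hx₀, hmx₀⟩ := v.exists_order hι
  have h1 : m 1 = 0 := by
    have := hmul 1 1 one_ne_zero one_ne_zero
    rw [mul_one] at this
    omega
  have hpow : ∀ x, x ≠ 0 → ∀ k : ℕ, m (x ^ k) = k * m x := by
    intro x hx k
    induction k with
    | zero => simp [h1]
    | succ k ih => rw [pow_succ, hmul _ _ (pow_ne_zero _ hx) hx, ih]; push_cast; ring
  have hdiv : ∀ x y, x ≠ 0 → y ≠ 0 → m (x / y) = m x - m y := by
    intro x y hx hy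
    have := hmul (x / y) y (div_ne_zero hx hy) hy
    rw [div_mul_cancel₀ _ hy] at this
    omega
  have hmem : ∀ x, x ≠ 0 → (x ∈ v.ring ↔ 0 ≤ m x) := by
    intro x hx
    rw [← ValuationSubring.valuation_le_one_iff, ← not_lt, ← not_lt, ← h1, hlt x 1 hx one_ne_zero,
      map_one]
  have hunit : ∀ x : v.ring, x.1 ≠ 0 → (IsUnit x ↔ m x = 0) := by
    intro x hx
    rw [v.ring.valuation_eq_one_iff x, le_antisymm_iff, ← not_lt, ← not_lt,
      ← map_one v.ring.valuation, ← hlt _ _ hx one_ne_zero, ← hlt _ _ one_ne_zero hx, h1]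
    omega
  have hex : ∃ k : ℕ, 0 < k ∧ ∃ x : L, x ≠ 0 ∧ m x = k := ⟨(m x₀).toNat, by omega, x₀, hx₀, by omega⟩
  classical
  obtain ⟨k₀, ⟨hk, ϖ, hϖ, hmϖ⟩, hmin'⟩ := Nat.findX hex
  have hmin : ∀ x, x ≠ 0 → 0 < m x → m ϖ ≤ m x := by
    intro x hx hmx
    by_contra! h
    exact hmin' (m x).toNat (by omega) ⟨by omega, x, hx, by omega⟩
  have hϖmem : ϖ ∈ v.ring := (hmem _ hϖ).2 (by omega)
  refine IsDiscreteValuationRing.ofHasUnitMulPowIrreducibleFactorization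
    ⟨⟨ϖ, hϖmem⟩, ⟨?_, ?_⟩, ?_⟩
  · rw [hunit _ hϖ]
    change m ϖ ≠ 0
    omega
  · intro a b hab
    have hab' : ϖ = a.1 * b.1 := congrArg Subtype.val hab
    have ha : a.1 ≠ 0 := by intro h; exact hϖ (by rw [hab', h, zero_mul])
    have hb : b.1 ≠ 0 := by intro h; exact hϖ (by rw [hab', h, mul_zero])
    rw [hunit _ ha, hunit _ hb]
    have h2 := hmul _ _ ha hb
    rw [← hab'] at h2
    have h3 := (hmem _ ha).1 a.2
    have h4 := (hmem _ hb).1 b.2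
    have h5 := hmin _ ha
    have h6 := hmin _ hb
    omega
  · intro x hx
    have hx0 : x.1 ≠ 0 := fun h => hx (Subtype.ext h)
    have hmx := (hmem _ hx0).1 x.2
    have hdm := Int.mul_ediv_add_emod (m x.1) (m ϖ)
    have hpos : 0 < m ϖ := by omega
    have hq : 0 ≤ m x.1 / m ϖ := Int.ediv_nonneg hmx hpos.le
    obtain ⟨k, hk'⟩ := Int.eq_ofNat_of_zero_le hq
    have hr0 := Int.emod_nonneg (m x.1) hpos.ne'
    have hr1 := Int.emod_lt_of_pos (m x.1) hpos
    have hy0 : x.1 / ϖ ^ k ≠ 0 := div_ne_zero hx0 (pow_ne_zero _ hϖ)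
    have hmy : m (x.1 / ϖ ^ k) = m x.1 % m ϖ := by
      rw [hdiv _ _ hx0 (pow_ne_zero _ hϖ), hpow _ hϖ]
      rw [hk'] at hdm
      linarith [mul_comm (m ϖ) k]
    have hmy0 : m (x.1 / ϖ ^ k) = 0 := by
      have := hmin _ hy0
      omega
    have hymem : x.1 / ϖ ^ k ∈ v.ring := (hmem _ hy0).2 hmy0.ge
    refine ⟨k, ((hunit ⟨_, hymem⟩ hy0).2 hmy0).unit, Subtype.ext ?_⟩
    exact mul_div_cancel₀ _ (pow_ne_zero _ hϖ)

/-- The residue field is algebraic over the finite field $A/f$: a primitive equation does not vanish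
modulo `f`, so it still gives an algebraic relation after reduction. -/
theorem perfectField [Finite Fq] (hι : IsFunctionField ι n) (v : FinitePlace ι) :
    PerfectField (IsLocalRing.maximalIdeal v.ring).ResidueField := by
  obtain ⟨f, hf, hvf⟩ := v.exists_prime hι
  have hmax := DrinfeldModule.isMaximal_span hf
  let : Field (Fq[X] ⧸ Ideal.span {f}) := Ideal.Quotient.field _
  have : Finite (Fq[X] ⧸ Ideal.span {f}) := DrinfeldModule.finite_quotient_span hf.ne_zero
  let g : Fq[X] →+* v.ring := ι.codRestrict v.ring.toSubring v.map_mem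
  let h : (Fq[X] ⧸ Ideal.span {f}) →+* (IsLocalRing.maximalIdeal v.ring).ResidueField :=
    Ideal.Quotient.lift _ ((algebraMap v.ring _).comp g) (by
      intro a ha
      rw [Ideal.mem_span_singleton] at ha
      change algebraMap v.ring _ (g a) = 0
      rw [Ideal.algebraMap_residueField_eq_zero]
      exact (v.ring.valuation_lt_one_iff ⟨ι a, v.map_mem a⟩).2 ((hvf a).2 ha))
  let := h.toAlgebra
  have : Algebra.IsAlgebraic (Fq[X] ⧸ Ideal.span {f})
      (IsLocalRing.maximalIdeal v.ring).ResidueField := by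
    constructor
    intro y
    obtain ⟨x, rfl⟩ := Ideal.algebraMap_residueField_surjective _ y
    obtain ⟨p, hp, -, hpx⟩ := hι.exists_isPrimitive x.1
    refine ⟨p.map (Ideal.Quotient.mk _), ?_, ?_⟩
    · intro h0
      refine hf.not_isUnit (hp f ((C_dvd_iff_dvd_coeff f p).2 fun i => ?_))
      have := congrArg (fun r => coeff r i) h0
      simp only [Polynomial.coeff_map, coeff_zero] at this
      rwa [Ideal.Quotient.eq_zero_iff_mem, Ideal.mem_span_singleton] at this
    · have hgx : p.eval₂ g x = 0 := by
        apply Subtype.val_injective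
        have := hom_eval₂ p g v.ring.subtype x
        exact this.trans hpx
      have := congrArg (algebraMap v.ring (IsLocalRing.maximalIdeal v.ring).ResidueField) hgx
      rw [hom_eval₂, map_zero] at this
      rw [aeval_def, eval₂_map]
      exact this
  exact Algebra.IsAlgebraic.perfectField (K := Fq[X] ⧸ Ideal.span {f})

end FinitePlace

/-! ### Galois theory of $p$-extensions and pro-$p$ extensions. -/

section

variable {p : ℕ} {K Ω : Type*} [Field K] [Field Ω] [Algebra K Ω]

namespace IntermediateField

theorem apply_eq_of_adjoin {S : Set Ω} {σ : Ω ≃ₐ[K] Ω} (h : ∀ x ∈ S, σ x = x) {x : Ω}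
    (hx : x ∈ adjoin K S) : σ x = x := by
  have : σ ∈ (adjoin K S).fixingSubgroup := by
    have hle : adjoin K S ≤ fixedField (Subgroup.zpowers σ) := by
      rw [adjoin_le_iff]
      intro y hy
      rw [SetLike.mem_coe, mem_fixedField_iff]
      intro τ hτ
      have : Subgroup.zpowers σ ≤ MulAction.stabilizer (Ω ≃ₐ[K] Ω) y := by
        rw [Subgroup.zpowers_le]
        exact h y hy
      exact this hτ
    exact (le_iff_le _ _).1 hle (Subgroup.mem_zpowers σ)
  exact (mem_fixingSubgroup_iff _ _).1 this x hx

theorem pow_apply_eq_of_dvd {σ : Ω ≃ₐ[K] Ω} {m n : ℕ} (h : m ∣ n) {x : Ω}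
    (hx : (σ ^ m) x = x) : (σ ^ n) x = x := by
  obtain ⟨d, rfl⟩ := h
  have : σ ^ m ∈ MulAction.stabilizer (Ω ≃ₐ[K] Ω) x := hx
  rw [pow_mul]
  exact pow_mem this d

theorem exists_pow_apply_eq_of_finite {σ : Ω ≃ₐ[K] Ω} {S : Set Ω} (hS : S.Finite)
    (h : ∀ x ∈ S, ∃ k, (σ ^ p ^ k) x = x) : ∃ k, ∀ x ∈ S, (σ ^ p ^ k) x = x := by
  choose! k hk using h
  obtain ⟨N, hN⟩ := (hS.image k).bddAbove
  exact ⟨N, fun x hx => pow_apply_eq_of_dvd (pow_dvd_pow p (hN ⟨x, hx, rfl⟩)) (hk x hx)⟩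

/-- Both sides speak of the same maps on `Ω`, so a condition over `L` can be tested inside the
Galois group over `K`. -/
theorem forall_algEquiv_iff (L : IntermediateField K Ω) {P : (Ω → Ω) → Prop} {n : ℕ → ℕ} :
    (∀ σ : Ω ≃ₐ[L] Ω, ∃ k, P ⇑(σ ^ n k)) ↔ ∀ σ ∈ L.fixingSubgroup, ∃ k, P ⇑(σ ^ n k) := by
  constructor
  · intro h σ hσ
    obtain ⟨k, hk⟩ := h (fixingSubgroupEquiv L ⟨σ, hσ⟩)
    rw [← map_pow] at hk
    exact ⟨k, hk⟩
  · intro h σ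
    obtain ⟨⟨τ, hτ⟩, rfl⟩ := (fixingSubgroupEquiv L).surjective σ
    obtain ⟨k, hk⟩ := h τ hτ
    refine ⟨k, ?_⟩
    rw [← map_pow]
    exact hk

variable [IsGalois K Ω]

/-- An intermediate field of a Galois extension that is stable under the Galois group is Galois. -/
theorem isGalois_of_forall_mem {E : IntermediateField K Ω}
    (h : ∀ σ : Ω ≃ₐ[K] Ω, ∀ x ∈ E, σ x ∈ E) : IsGalois K E := by
  have : Normal K E := by
    rw [normal_iff_forall_map_le']
    rintro σ _ ⟨x, hx, rfl⟩
    exact h σ x hx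
  exact ⟨⟩

theorem apply_mem_of_normal (E : IntermediateField K Ω) [Normal K E] (σ : Ω ≃ₐ[K] Ω) {x : Ω}
    (hx : x ∈ E) : σ x ∈ E :=
  normal_iff_forall_map_le'.1 inferInstance σ ⟨x, hx, rfl⟩

theorem isGalois_extendScalars {L E : IntermediateField K Ω} (h : L ≤ E) [Normal K E] :
    IsGalois L (extendScalars h) :=
  isGalois_of_forall_mem fun σ _ hx => E.apply_mem_of_normal (σ.restrictScalars K) hx

theorem isGalois_adjoin_of_forall_mem {S : Set Ω} (h : ∀ σ : Ω ≃ₐ[K] Ω, ∀ x ∈ S, σ x ∈ S) :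
    IsGalois K (adjoin K S) := by
  refine isGalois_of_forall_mem fun σ x hx => ?_
  have hmap : (adjoin K S).map (σ : Ω →ₐ[K] Ω) ≤ adjoin K S := by
    rw [adjoin_map, adjoin_le_iff]
    rintro _ ⟨y, hy, rfl⟩
    exact subset_adjoin K S (h σ y hy)
  exact hmap ⟨x, hx, rfl⟩

/-- The subgroup fixing an intersection of normal subextensions, one of them finite. -/
theorem fixingSubgroup_inf (E₁ E₂ : IntermediateField K Ω) [FiniteDimensional K E₁] :
    (E₁ ⊓ E₂).fixingSubgroup = E₁.fixingSubgroup ⊔ E₂.fixingSubgroup := by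
  -- Finite degree makes the first group open, so the join is open, hence closed, and the infinite
  -- Galois correspondence applies to it.
  have hopen : IsOpen ((E₁.fixingSubgroup ⊔ E₂.fixingSubgroup : Subgroup (Ω ≃ₐ[K] Ω)) :
      Set (Ω ≃ₐ[K] Ω)) := Subgroup.isOpen_mono le_sup_left E₁.fixingSubgroup_isOpen
  have h1 := InfiniteGalois.fixingSubgroup_fixedField
    ⟨E₁.fixingSubgroup ⊔ E₂.fixingSubgroup, Subgroup.isClosed_of_isOpen _ hopen⟩
  have h2 : fixedField (E₁.fixingSubgroup ⊔ E₂.fixingSubgroup) = E₁ ⊓ E₂ := by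
    refine le_antisymm (le_inf ?_ ?_) ((le_iff_le _ _).2 (sup_le ?_ ?_))
    · conv_rhs => rw [← InfiniteGalois.fixedField_fixingSubgroup E₁]
      exact fixedField_antitone le_sup_left
    · conv_rhs => rw [← InfiniteGalois.fixedField_fixingSubgroup E₂]
      exact fixedField_antitone le_sup_right
    · exact fixingSubgroup_antitone inf_le_left
    · exact fixingSubgroup_antitone inf_le_right
  rw [← h2]
  exact h1

end IntermediateField

open IntermediateField

variable [IsGalois K Ω]

/-- The Galois group of a normal subextension is a `p`-group iff some `p`-power of each
automorphism is trivial on it. -/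
theorem isPGroup_iff_forall_exists (E : IntermediateField K Ω) [Normal K E] :
    IsPGroup p (E ≃ₐ[K] E) ↔ ∀ σ : Ω ≃ₐ[K] Ω, ∃ k, σ ^ p ^ k ∈ E.fixingSubgroup := by
  have key : ∀ (σ : Ω ≃ₐ[K] Ω) (k : ℕ),
      (AlgEquiv.restrictNormalHom E σ) ^ p ^ k = 1 ↔ σ ^ p ^ k ∈ E.fixingSubgroup := by
    intro σ k
    rw [← restrictNormalHom_ker, MonoidHom.mem_ker, map_pow]
  constructor
  · intro h σ
    obtain ⟨k, hk⟩ := h (AlgEquiv.restrictNormalHom E σ)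
    exact ⟨k, (key σ k).1 hk⟩
  · intro h τ
    obtain ⟨σ, rfl⟩ := AlgEquiv.restrictNormalHom_surjective (F := K) (K₁ := E) Ω τ
    obtain ⟨k, hk⟩ := h σ
    exact ⟨k, (key σ k).2 hk⟩

/-- An open subgroup contains all automorphisms fixing some finite subextension. That field has
finitely many generators, so a single $p$-power of a given automorphism fixes all of them. -/
theorem isProPExtension_of_forall_exists [Fact p.Prime] (M : IntermediateField K Ω) [Normal K M]
    (h : ∀ σ : Ω ≃ₐ[K] Ω, ∀ x ∈ M, ∃ k, (σ ^ p ^ k) x = x) : IsProPExtension p K M := by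
  have hgal : IsGalois K M := ⟨⟩
  refine ⟨hgal, fun U hU hopen => ?_⟩
  have hfin : Finite ((M ≃ₐ[K] M) ⧸ U) := Subgroup.quotient_finite_of_isOpen U hopen
  have hp : IsPGroup p ((M ≃ₐ[K] M) ⧸ U) := by
    intro t
    obtain ⟨τ, rfl⟩ := QuotientGroup.mk_surjective t
    obtain ⟨σ, rfl⟩ := AlgEquiv.restrictNormalHom_surjective (F := K) (K₁ := M) Ω τ
    obtain ⟨F, hF, hFU⟩ := (krullTopology_mem_nhds_one_iff K M _).1 (hopen.mem_nhds U.one_mem)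
    obtain ⟨S, hS⟩ := F.fg_of_fg_toSubalgebra
      (Subalgebra.fg_of_fg_toSubmodule (Module.Finite.iff_fg.1 (inferInstanceAs (Module.Finite K F))))
    obtain ⟨k, hk⟩ := exists_pow_apply_eq_of_finite (p := p) (σ := σ)
      (S := Subtype.val '' (S : Set M)) (S.finite_toSet.image _) (by
        rintro _ ⟨x, -, rfl⟩
        exact h σ x.1 x.2)
    refine ⟨k, ?_⟩
    rw [← QuotientGroup.mk_pow, QuotientGroup.eq_one_iff]
    refine hFU ((mem_fixingSubgroup_iff _ _).2 fun x hx => ?_)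
    rw [← hS] at hx
    refine apply_eq_of_adjoin (fun y hy => Subtype.ext ?_) hx
    rw [← map_pow, AlgEquiv.restrictNormalHom_apply]
    exact hk _ ⟨y, hy, rfl⟩
  exact IsPGroup.iff_card.1 hp

/-- The subgroup fixing a finite normal subextension is open and normal, so its index is a power of
$p$, and raising to the index lands in it. -/
theorem IsProPExtension.exists_pow_mem_fixingSubgroup {E M : IntermediateField K Ω} (hEM : E ≤ M)
    [Normal K M] [Normal K E] [FiniteDimensional K E] (h : IsProPExtension p K M)
    (σ : Ω ≃ₐ[K] Ω) : ∃ k, σ ^ p ^ k ∈ E.fixingSubgroup := by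
  have := h.1
  let F : IntermediateField K M := IntermediateField.restrict hEM
  have : FiniteDimensional K F :=
    LinearEquiv.finiteDimensional (IntermediateField.restrictAlgEquiv hEM).toLinearEquiv
  have : Normal K F := Normal.of_algEquiv (IntermediateField.restrictAlgEquiv hEM)
  have : IsGalois K F := ⟨⟩
  obtain ⟨k, hk⟩ := h.2 F.fixingSubgroup inferInstance F.fixingSubgroup_isOpen
  refine ⟨k, (mem_fixingSubgroup_iff _ _).2 fun x hx => ?_⟩
  have h1 := F.fixingSubgroup.pow_index_mem (AlgEquiv.restrictNormalHom M σ)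
  rw [hk] at h1
  have h2 := congrArg Subtype.val ((mem_fixingSubgroup_iff _ _).1 h1 ⟨x, hEM hx⟩
    ((IntermediateField.mem_restrict hEM _).2 hx))
  rw [← map_pow] at h2
  exact (AlgEquiv.restrictNormalHom_apply M (σ ^ p ^ k) ⟨x, hEM hx⟩).symm.trans h2

namespace IntermediateField

theorem isPExtension_extendScalars_iff {L E : IntermediateField K Ω} (h : L ≤ E) [Normal K E]
    [FiniteDimensional K E] : IsPExtension p L (extendScalars h) ↔
      ∀ σ ∈ L.fixingSubgroup, ∃ k, σ ^ p ^ k ∈ E.fixingSubgroup := by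
  have := isGalois_extendScalars h
  have hfin : FiniteDimensional L (extendScalars h) := by
    have : FiniteDimensional K (extendScalars h) := inferInstanceAs (FiniteDimensional K E)
    exact FiniteDimensional.right K L _
  have h1 := forall_algEquiv_iff L (P := fun f => ∀ x ∈ E, f x = x) (n := fun k => p ^ k)
  simp only [IsPExtension, hfin, this, true_and, isPGroup_iff_forall_exists]
  simp only [IntermediateField.mem_fixingSubgroup_iff] at h1 ⊢
  exact h1

end IntermediateField

end

/-! ### Representations over a finite field that are triangular with powers of a character. -/

namespace Representation

variable {p : ℕ} [Fact p.Prime] {k G V : Type*} [Field k] [Finite k] [CharP k p] [Group G]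
  [AddCommGroup V] [Module k V] [FiniteDimensional k V]

/-- A `p`-group of operators on a nonzero space over a finite field of characteristic `p` has a
nonzero fixed vector. -/
theorem exists_fixed_vector [Nontrivial V] (ρ : Representation k G V) (N : Subgroup G)
    (h : ∀ σ ∈ N, ∃ m, ρ σ ^ p ^ m = 1) : ∃ v ≠ 0, ∀ σ ∈ N, ρ σ v = v := by
  have : Finite V := Module.finite_of_finite k
  let P : Subgroup (Module.End k V)ˣ := N.map ρ.toHomUnits
  have hP : IsPGroup p P := by
    rintro ⟨_, σ, hσ, rfl⟩
    obtain ⟨m, hm⟩ := h σ hσ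
    exact ⟨m, Subtype.ext (Units.ext hm)⟩
  let : MulAction P V := MulAction.compHom V ((Units.coeHom (Module.End k V)).comp P.subtype)
  -- The number of fixed vectors is congruent modulo $p$ to the order of `V`, so it is divisible by
  -- $p$; zero is fixed, hence so is something else.
  have hcard := hP.card_modEq_card_fixedPoints V
  have hdvd : p ∣ Nat.card V := by
    have := Module.natCard_eq_pow_finrank (K := k) (V := V)
    rw [this]
    refine dvd_pow ?_ Module.finrank_pos.ne'
    let : Fintype k := Fintype.ofFinite k
    rw [Nat.card_eq_fintype_card]
    exact (CharP.cast_eq_zero_iff k p _).1 (Nat.cast_card_eq_zero k)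
  have hdvd' : p ∣ Nat.card (MulAction.fixedPoints P V) := (hcard.dvd_iff dvd_rfl).1 hdvd
  have h0 : (0 : V) ∈ MulAction.fixedPoints P V := fun g => map_zero (g.1 : Module.End k V)
  have hpos : 0 < Nat.card (MulAction.fixedPoints P V) :=
    Nat.card_pos_iff.2 ⟨⟨0, h0⟩, inferInstance⟩
  have hone := (Fact.out : p.Prime).one_lt.trans_le (Nat.le_of_dvd hpos hdvd')
  rw [Finite.one_lt_card_iff_nontrivial] at hone
  obtain ⟨v, hv⟩ := exists_ne (⟨0, h0⟩ : MulAction.fixedPoints P V)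
  refine ⟨v.1, fun h => hv (Subtype.ext h), fun σ hσ => ?_⟩
  exact v.2 ⟨_, σ, hσ, rfl⟩

/-- If the kernel of a character `χ` acts through a `p`-group, there is a line on which the group
acts by a power of `χ`. -/
theorem exists_eigenline [Nontrivial V] (ρ : Representation k G V) (χ : G →* kˣ)
    (h : ∀ σ, χ σ = 1 → ∃ m, ρ σ ^ p ^ m = 1) :
    ∃ v ≠ 0, ∃ i ≤ Nat.card k - 1, ∀ σ, ρ σ v = ((χ σ ^ i : kˣ) : k) • v := by
  -- The fixed space of the kernel is stable because the kernel is normal, and `G` acts on it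
  -- through the cyclic image of `χ`.
  let V₀ : Submodule k V := ⨅ σ ∈ χ.ker, LinearMap.eqLocus (ρ σ) LinearMap.id
  have hV₀ : ∀ v, v ∈ V₀ ↔ ∀ σ ∈ χ.ker, ρ σ v = v := by
    intro v
    simp [V₀, Submodule.mem_iInf]
  obtain ⟨v, hv0, hv⟩ := ρ.exists_fixed_vector χ.ker h
  have : Nontrivial V₀ := ⟨⟨v, (hV₀ v).2 hv⟩, 0, fun h => hv0 (congrArg Subtype.val h)⟩
  obtain ⟨⟨_, g, rfl⟩, hg⟩ := IsCyclic.exists_generator (α := χ.range)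
  set n := orderOf (χ g) with hn
  have hn0 : 0 < n := orderOf_pos _
  have : NeZero n := ⟨hn0.ne'⟩
  have hmaps : ∀ v ∈ V₀, ρ g v ∈ V₀ := by
    intro v hv
    rw [hV₀] at hv ⊢
    intro σ hσ
    have h1 := hv (g⁻¹ * σ * g) (by rw [MonoidHom.mem_ker] at hσ ⊢; simp [hσ])
    rw [map_mul, map_mul, Module.End.mul_apply, Module.End.mul_apply] at h1
    have h2 := congrArg (ρ g) h1
    rwa [← Module.End.mul_apply (ρ g), ← map_mul, mul_inv_cancel, map_one,
      Module.End.one_apply] at h2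
  let T : Module.End k V₀ := (ρ g).restrict hmaps
  have hTn : T ^ n = 1 := by
    ext w
    have h1 : ∀ m : ℕ, ((T ^ m) w : V) = (ρ (g ^ m)) w := by
      intro m
      induction m with
      | zero => simp
      | succ m ih =>
        rw [pow_succ', pow_succ', map_mul, Module.End.mul_apply, Module.End.mul_apply, ← ih]
        rfl
    rw [h1, (hV₀ w.1).1 w.2 (g ^ n) (by rw [MonoidHom.mem_ker, map_pow, pow_orderOf_eq_one])]
    rfl
  have hprim : IsPrimitiveRoot ((χ g : kˣ) : k) n :=
    IsPrimitiveRoot.coe_units_iff.2 (IsPrimitiveRoot.orderOf (χ g))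
  -- The field already contains a primitive `n`-th root of unity, namely `χ g`; hence $X^n-1$
  -- splits, and an eigenvalue exists and is a power of `χ g`.
  have hdvd : minpoly k T ∣ X ^ n - 1 := minpoly.dvd k T (by simp [hTn])
  have hsplit : (X ^ n - 1 : k[X]).Splits := by
    rw [X_pow_sub_one_eq_prod hn0 hprim]
    exact Splits.prod fun a _ => Splits.X_sub_C a
  have hX0 : (X ^ n - 1 : k[X]) ≠ 0 := (monic_X_pow_sub_C (1 : k) hn0.ne').ne_zero
  obtain ⟨a, ha⟩ := (hsplit.of_dvd hX0 hdvd).exists_eval_eq_zero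
    (minpoly.degree_pos (Algebra.IsIntegral.isIntegral T)).ne'
  have han : a ^ n = 1 := by
    have := eval_eq_zero_of_dvd_of_eval_eq_zero hdvd ha
    simpa [sub_eq_zero] using this
  obtain ⟨i, hi, hia⟩ := hprim.eq_pow_of_pow_eq_one han
  obtain ⟨w, hw⟩ := (Module.End.hasEigenvalue_of_isRoot ha).exists_hasEigenvector
  have hgw : ρ g w = a • (w : V) := congrArg Subtype.val hw.apply_eq_smul
  refine ⟨w, fun h0 => hw.2 (Subtype.ext h0), i, ?_, fun σ => ?_⟩
  · have h1 : n ≤ Nat.card kˣ := Nat.le_of_dvd Nat.card_pos (orderOf_dvd_natCard _)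
    rw [Nat.card_units] at h1
    omega
  · have h1 : ∀ m : ℕ, ρ (g ^ m) w = a ^ m • (w : V) := by
      intro m
      induction m with
      | zero => simp
      | succ m ih =>
        rw [pow_succ', map_mul, Module.End.mul_apply, ih, map_smul, hgw, smul_smul, pow_succ]
    obtain ⟨m, hm⟩ := (mem_powers_iff_mem_zpowers (x := (⟨χ g, g, rfl⟩ : χ.range))).2
      (hg ⟨χ σ, σ, rfl⟩)
    have hm : χ g ^ m = χ σ := congrArg Subtype.val hm
    -- An arbitrary `σ` differs from a power of `g` by an element of the kernel, which fixes `w`.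
    have h2 := (hV₀ w.1).1 w.2 ((g ^ m)⁻¹ * σ) (by
      rw [MonoidHom.mem_ker, map_mul, map_inv, map_pow, hm, inv_mul_cancel])
    have h3 := congrArg (ρ (g ^ m)) h2
    rw [← Module.End.mul_apply, ← map_mul, mul_inv_cancel_left] at h3
    rw [h3, h1, ← hm, ← hia]
    congr 1
    push_cast
    rw [← pow_mul, ← pow_mul, mul_comm]

/-- A flag on which the group acts through powers of a character. -/
theorem exists_flag (ρ : Representation k G V) (χ : G →* kˣ)
    (h : ∀ σ, χ σ = 1 → ∃ m, ρ σ ^ p ^ m = 1) (n : ℕ) (hn : n ≤ Module.finrank k V) :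
    ∃ (b : Fin n → V) (i : Fin n → ℕ), LinearIndependent k b ∧ (∀ j, i j ≤ Nat.card k - 1) ∧
      ∀ σ j, ρ σ (b j) - ((χ σ ^ i j : kˣ) : k) • b j ∈ Submodule.span k (b '' {l | l < j}) := by
  induction n with
  | zero => exact ⟨Fin.elim0, Fin.elim0, linearIndependent_empty_type, fun j => j.elim0,
      fun _ j => j.elim0⟩
  | succ n ih =>
    obtain ⟨b, i, hb, hi, hbi⟩ := ih (by omega)
    -- The next flag vector is a lift of an eigenvector in the quotient by the span of the vectors
    -- found so far.
    let N := Submodule.span k (Set.range b)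
    have hbN : ∀ j, b j ∈ N := fun j => Submodule.subset_span ⟨j, rfl⟩
    have hN : ∀ σ, N ≤ N.comap (ρ σ) := by
      intro σ
      rw [Submodule.span_le]
      rintro _ ⟨j, rfl⟩
      have h1 := Submodule.span_mono (Set.image_subset_range b _) (hbi σ j)
      have h2 := N.add_mem h1 (N.smul_mem ((χ σ ^ i j : kˣ) : k) (hbN j))
      rwa [sub_add_cancel] at h2
    let ρ' : Representation k G (V ⧸ N) :=
      { toFun := fun σ => N.mapQ N (ρ σ) (hN σ)
        map_one' := by
          apply Submodule.linearMap_qext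
          ext v
          simp
        map_mul' := fun σ τ => by
          apply Submodule.linearMap_qext
          ext v
          simp }
    have hρ' : ∀ σ v, ρ' σ (N.mkQ v) = N.mkQ (ρ σ v) := fun _ _ => rfl
    have hpow : ∀ σ m, ρ σ ^ m = 1 → ρ' σ ^ m = 1 := by
      intro σ m hm
      rw [← map_pow] at hm ⊢
      apply Submodule.linearMap_qext
      ext v
      rw [LinearMap.comp_apply, hρ', hm]
      rfl
    have hfin : Module.finrank k N = n := by
      rw [finrank_span_eq_card hb, Fintype.card_fin]
    have : Nontrivial (V ⧸ N) := by
      rw [Submodule.Quotient.nontrivial_iff]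
      intro htop
      rw [htop, finrank_top] at hfin
      omega
    obtain ⟨v, hv0, e, he, hv⟩ := ρ'.exists_eigenline χ fun σ hσ => by
      obtain ⟨m, hm⟩ := h σ hσ
      exact ⟨m, hpow _ _ hm⟩
    obtain ⟨v, rfl⟩ := N.mkQ_surjective v
    have hvN : v ∉ N := fun hvN => hv0 ((Submodule.Quotient.mk_eq_zero N).2 hvN)
    refine ⟨Fin.snoc b v, Fin.snoc i e, ?_, ?_, ?_⟩
    · exact linearIndependent_finSnoc.2 ⟨hb, hvN⟩
    · intro j
      refine Fin.lastCases ?_ (fun j => ?_) j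
      · rwa [Fin.snoc_last]
      · rw [Fin.snoc_castSucc]
        exact hi j
    · intro σ j
      refine Fin.lastCases ?_ (fun j => ?_) j
      · rw [Fin.snoc_last, Fin.snoc_last]
        have h1 := hv σ
        rw [hρ', ← map_smul, ← sub_eq_zero, ← map_sub, Submodule.mkQ_apply,
          Submodule.Quotient.mk_eq_zero] at h1
        refine Submodule.span_mono ?_ h1
        rintro _ ⟨l, rfl⟩
        exact ⟨l.castSucc, Fin.castSucc_lt_last l, by simp⟩
      · rw [Fin.snoc_castSucc, Fin.snoc_castSucc]
        refine Submodule.span_mono ?_ (hbi σ j)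
        rintro _ ⟨l, hl, rfl⟩
        exact ⟨l.castSucc, Fin.castSucc_lt_castSucc_iff.2 hl, by simp⟩

/-- The kernel of `χ` acts through a `p`-group iff the representation is triangular with powers
of `χ` on the diagonal. -/
theorem exists_triangular_basis_iff (ρ : Representation k G V) (χ : G →* kˣ) {r : ℕ} (hr : 0 < r)
    (hV : Module.finrank k V = r) :
    (∃ (b : Module.Basis (Fin r) k V) (i : Fin r → ℕ), (∀ j, i j ≤ Nat.card k - 1) ∧
      ∀ σ, (∀ j l, l < j → LinearMap.toMatrix b b (ρ σ) j l = 0) ∧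
        ∀ j, LinearMap.toMatrix b b (ρ σ) j j = ((χ σ ^ i j : kˣ) : k)) ↔
    ∀ σ, χ σ = 1 → ∃ m, ρ σ ^ p ^ m = 1 := by
  constructor
  · rintro ⟨b, i, -, hbi⟩ σ hσ
    obtain ⟨htri, hdiag⟩ := hbi σ
    -- On the kernel of `χ` all diagonal entries are one, so Cayley–Hamilton makes `ρ σ - 1`
    -- nilpotent; in characteristic $p$ a large $p$-power of `ρ σ` is then the identity.
    have hchar : (ρ σ).charpoly = (X - C 1) ^ r := by
      rw [← LinearMap.charpoly_toMatrix (ρ σ) b, Matrix.charpoly_of_isUpperTriangular _ fun j l h =>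
        htri j l h]
      simp [hdiag, hσ]
    have h0 := LinearMap.aeval_self_charpoly (ρ σ)
    rw [hchar, map_pow, map_sub, aeval_X, aeval_C, map_one] at h0
    refine ⟨r, ?_⟩
    have hle : r ≤ p ^ r := (Nat.lt_pow_self (Fact.out : p.Prime).one_lt).le
    have : Nontrivial V := Module.nontrivial_of_finrank_pos (R := k) (by omega)
    have : CharP (Module.End k V) p :=
      charP_of_injective_algebraMap (algebraMap k (Module.End k V)).injective p
    have h1 := sub_pow_char_pow_of_commute p r (Commute.one_right (ρ σ))
    rw [one_pow, pow_eq_zero_of_le hle h0] at h1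
    exact (sub_eq_zero.1 h1.symm)
  · intro h
    obtain ⟨b, i, hb, hi, hbi⟩ := ρ.exists_flag χ h r hV.ge
    have : Nonempty (Fin r) := ⟨⟨0, hr⟩⟩
    let B := basisOfLinearIndependentOfCardEqFinrank hb (by rw [Fintype.card_fin, hV])
    have hB : ∀ j, B j = b j := fun j => by simp [B]
    have hBb : ⇑B = b := funext hB
    have key : ∀ σ j l, l ≤ j → B.repr (ρ σ (B l) - ((χ σ ^ i l : kˣ) : k) • B l) j = 0 := by
      intro σ j l hlj
      have h1 := hbi σ l
      rw [← hBb, B.mem_span_image] at h1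
      by_contra hne
      exact (not_lt.2 hlj) (h1 (Finsupp.mem_support_iff.2 hne))
    refine ⟨B, i, hi, fun σ => ⟨fun j l hlj => ?_, fun j => ?_⟩⟩
    · have h1 := key σ j l hlj.le
      rw [map_sub, Finsupp.sub_apply, map_smul, Finsupp.smul_apply, B.repr_self,
        Finsupp.single_eq_of_ne hlj.ne', smul_zero, sub_zero] at h1
      rw [LinearMap.toMatrix_apply]
      exact h1
    · have h1 := key σ j j le_rfl
      rw [map_sub, Finsupp.sub_apply, map_smul, Finsupp.smul_apply, B.repr_self,
        Finsupp.single_eq_same, smul_eq_mul, mul_one, sub_eq_zero] at h1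
      rw [LinearMap.toMatrix_apply]
      exact h1

end Representation

/-! ### The Galois action on torsion and the $p$-extension conditions. -/

namespace DrinfeldModule

variable {Fq K : Type*} [Field Fq] [Finite Fq] [Field K] {ι : Fq[X] →+* K} {r : ℕ}

theorem apply_mem_torsionSet (φ : DrinfeldModule ι r) (a : Fq[X])
    (σ : SeparableClosure K ≃ₐ[K] SeparableClosure K) {x : SeparableClosure K}
    (hx : x ∈ φ.torsionSet a) : σ x ∈ φ.torsionSet a :=
  (φ.galTorsion a σ ⟨x, hx⟩).2

instance isGalois_torsionField (φ : DrinfeldModule ι r) (a : Fq[X]) :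
    IsGalois K (φ.torsionField a) :=
  IntermediateField.isGalois_adjoin_of_forall_mem fun σ _ hx => φ.apply_mem_torsionSet a σ hx

instance isGalois_powTorsionField (φ : DrinfeldModule ι r) (a : Fq[X]) :
    IsGalois K (φ.powTorsionField a) :=
  IntermediateField.isGalois_adjoin_of_forall_mem fun σ _ hx => by
    obtain ⟨n, hn, hx⟩ := Set.mem_iUnion₂.1 hx
    exact Set.mem_iUnion₂.2 ⟨n, hn, φ.apply_mem_torsionSet _ σ hx⟩

theorem finiteDimensional_torsionField (φ : DrinfeldModule ι r) (hr : 0 < r) {a : Fq[X]}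
    (ha : a ≠ 0) : FiniteDimensional K (φ.torsionField a) := by
  have : Finite (φ.torsionSet a) := φ.finite_torsionSet hr ha
  exact IntermediateField.finiteDimensional_adjoin fun x _ => Algebra.IsIntegral.isIntegral x

theorem mem_fixingSubgroup_torsionField_iff (φ : DrinfeldModule ι r) (a : Fq[X])
    (σ : SeparableClosure K ≃ₐ[K] SeparableClosure K) :
    σ ∈ (φ.torsionField a).fixingSubgroup ↔ φ.modRep a σ = 1 := by
  rw [IntermediateField.mem_fixingSubgroup_iff]
  constructor
  · intro h
    ext x
    exact h x.1 (IntermediateField.subset_adjoin K _ x.2)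
  · intro h x hx
    refine IntermediateField.apply_eq_of_adjoin (fun y hy => ?_) hx
    exact congrArg Subtype.val (LinearMap.congr_fun h (⟨y, hy⟩ : φ.torsion a))

/-- On a line every endomorphism is a scalar, which its determinant recovers; so the kernel of the
character is exactly the group fixing the field. -/
theorem mem_fixingSubgroup_carlitz_iff {π : Fq[X]} (hπ : Irreducible π) (hιπ : ι π ≠ 0)
    (σ : SeparableClosure K ≃ₐ[K] SeparableClosure K) :
    σ ∈ ((carlitz ι).torsionField π).fixingSubgroup ↔ carlitzCharacter ι π σ = 1 := by
  rw [mem_fixingSubgroup_torsionField_iff]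
  have := isMaximal_span hπ
  let : Field (Fq[X] ⧸ Ideal.span {π}) := Ideal.Quotient.field _
  have h1 := finrank_torsion (carlitz ι) one_pos hπ hιπ
  have h2 : ((carlitzCharacter ι π σ : (Fq[X] ⧸ Ideal.span {π})ˣ) : Fq[X] ⧸ Ideal.span {π}) =
      LinearMap.det ((carlitz ι).modRep π σ) := rfl
  rw [← Units.val_eq_one, h2]
  constructor
  · intro h
    rw [h, map_one]
  · intro h
    obtain ⟨c, hc, -⟩ := LinearMap.existsUnique_eq_smul_id_of_finrank_eq_one h1
      ((carlitz ι).modRep π σ)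
    rw [hc, LinearMap.det_smul, h1, pow_one, LinearMap.det_id, mul_one] at h
    rw [hc, h, one_smul]
    rfl

/-- The condition on `K(φ[π])/L` in terms of the mod `π` representation. -/
theorem isPExtension_torsionField_iff {p : ℕ} (φ : DrinfeldModule ι r) (hr : 0 < r) {π : Fq[X]}
    (hπ : Irreducible π) (hιπ : ι π ≠ 0) :
    IsPExtension p (φ.interField π)
      (IntermediateField.extendScalars (φ.interField_le_torsionField π)) ↔
    ∀ σ, carlitzCharacter ι π σ = 1 → ∃ k, φ.modRep π σ ^ p ^ k = 1 := by
  have := φ.finiteDimensional_torsionField hr hπ.ne_zero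
  rw [IntermediateField.isPExtension_extendScalars_iff, interField,
    IntermediateField.fixingSubgroup_inf]
  simp only [← mem_fixingSubgroup_carlitz_iff hπ hιπ, ← map_pow,
    ← mem_fixingSubgroup_torsionField_iff]
  constructor
  · exact fun h σ hσ => h σ (Subgroup.mem_sup_right hσ)
  · intro h σ hσ
    -- Modulo the normal subgroup acting trivially on the torsion only `σ₂` remains, and it lies in
    -- the kernel of the Carlitz character.
    obtain ⟨σ₁, h₁, σ₂, h₂, rfl⟩ := Subgroup.mem_sup_of_normal_left.1 hσ
    obtain ⟨k, hk⟩ := h σ₂ h₂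
    refine ⟨k, ?_⟩
    rw [← QuotientGroup.eq_one_iff] at hk h₁ ⊢
    rw [QuotientGroup.mk_pow] at hk ⊢
    rwa [QuotientGroup.mk_mul, h₁, one_mul]

theorem isCarlitzTriangular_iff {p : ℕ} [Fact p.Prime] [CharP Fq p] (φ : DrinfeldModule ι r)
    (hr : 0 < r) {π : Fq[X]} (hπ : Irreducible π) (hιπ : ι π ≠ 0) :
    φ.IsCarlitzTriangular π ↔
      ∀ σ, carlitzCharacter ι π σ = 1 → ∃ k, φ.modRep π σ ^ p ^ k = 1 := by
  have := isMaximal_span hπ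
  let : Field (Fq[X] ⧸ Ideal.span {π}) := Ideal.Quotient.field _
  have : Finite (Fq[X] ⧸ Ideal.span {π}) := finite_quotient_span hπ.ne_zero
  have : CharP (Fq[X] ⧸ Ideal.span {π}) p :=
    charP_of_injective_algebraMap (algebraMap Fq (Fq[X] ⧸ Ideal.span {π})).injective p
  have h1 := finrank_torsion φ hr hπ hιπ
  have : FiniteDimensional (Fq[X] ⧸ Ideal.span {π}) (φ.torsion π) :=
    Module.finite_of_finrank_pos (by rw [h1]; exact hr)
  rw [← (φ.modRep π).exists_triangular_basis_iff (carlitzCharacter ι π) hr h1]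
  simp only [IsCarlitzTriangular, Units.val_pow_eq_pow_val]

/-- An automorphism trivial on `φ[π]` acts on `φ[π ^ n]` with `p`-power order. -/
theorem exists_pow_apply_eq {p : ℕ} [Fact p.Prime] [CharP K p] (φ : DrinfeldModule ι r)
    {π : Fq[X]} {σ : SeparableClosure K ≃ₐ[K] SeparableClosure K}
    (h : ∀ x ∈ φ.torsionSet π, σ x = x) (n : ℕ) :
    ∃ k, ∀ x ∈ φ.torsionSet (π ^ n), (σ ^ p ^ k) x = x := by
  let T : Module.End K (SeparableClosure K) := σ.toLinearMap
  -- For `x` killed by $\phi_{\pi^{n+1}}$ the point $\phi_{\pi^n}(x)$ lies in $\phi[\pi]$, so it is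
  -- fixed and `σ x - x` is killed by $\phi_{\pi^n}$.
  have hnil : ∀ n, ∀ x ∈ φ.torsionSet (π ^ n), ((T - 1) ^ n) x = 0 := by
    intro n
    induction n with
    | zero =>
      intro x hx
      have : TwistedPoly.eval ι (SeparableClosure K) (φ.toRingHom (π ^ 0)) x = 0 := hx
      rw [pow_zero, map_one, map_one] at this
      exact this
    | succ n ih =>
      intro x hx
      rw [pow_succ, Module.End.mul_apply]
      refine ih _ ?_
      have hx' : TwistedPoly.eval ι (SeparableClosure K) (φ.toRingHom (π ^ (n + 1))) x = 0 := hx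
      rw [pow_succ', map_mul, map_mul] at hx'
      have h1 := h (TwistedPoly.eval ι (SeparableClosure K) (φ.toRingHom (π ^ n)) x) hx'
      rw [TwistedPoly.eval_algEquiv] at h1
      change TwistedPoly.eval ι (SeparableClosure K) (φ.toRingHom (π ^ n)) (σ x - x) = 0
      rw [map_sub, h1, sub_self]
  have : CharP (Module.End K (SeparableClosure K)) p :=
    charP_of_injective_algebraMap (algebraMap K (Module.End K (SeparableClosure K))).injective p
  have hpow : ∀ m : ℕ, ∀ x, (σ ^ m) x = (T ^ m) x := by
    intro m x
    induction m with
    | zero => rfl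
    | succ m ih => rw [pow_succ', pow_succ', AlgEquiv.mul_apply, Module.End.mul_apply, ih]; rfl
  refine ⟨n, fun x hx => ?_⟩
  have hle : n ≤ p ^ n := (Nat.lt_pow_self (Fact.out : p.Prime).one_lt).le
  have h1 := sub_pow_char_pow_of_commute p n (Commute.one_right T)
  have h2 : ((T - 1) ^ p ^ n) x = 0 := by
    rw [← Nat.sub_add_cancel hle, pow_add, Module.End.mul_apply, hnil n x hx, map_zero]
  rw [h1, one_pow, LinearMap.sub_apply, sub_eq_zero] at h2
  rw [hpow, h2]
  rfl

/-- Some $p$-power of an automorphism over $L$ fixes $\phi[\pi]$, and a further one fixes a given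
$\phi[\pi^n]$. Each element of the field involves only finitely many division points, so one
exponent suffices for it. -/
theorem isProPExtension_of_isPExtension {p : ℕ} [Fact p.Prime] [CharP K p]
    (φ : DrinfeldModule ι r) (hr : 0 < r) {π : Fq[X]} (hπ : π ≠ 0)
    (h : IsPExtension p (φ.interField π)
      (IntermediateField.extendScalars (φ.interField_le_torsionField π))) :
    IsProPExtension p (φ.interField π)
      (IntermediateField.extendScalars (φ.interField_le_powTorsionField π)) := by
  have := φ.finiteDimensional_torsionField hr hπ
  have hgal := IntermediateField.isGalois_extendScalars (φ.interField_le_powTorsionField π)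
  rw [IntermediateField.isPExtension_extendScalars_iff] at h
  refine isProPExtension_of_forall_exists _ fun σ x hx => ?_
  let σ' : SeparableClosure K ≃ₐ[K] SeparableClosure K := σ.restrictScalars K
  have hpow : ∀ m : ℕ, ⇑(σ ^ m) = ⇑(σ' ^ m) := by
    intro m
    induction m with
    | zero => rfl
    | succ m ih =>
      ext x
      rw [pow_succ', pow_succ', AlgEquiv.mul_apply, AlgEquiv.mul_apply, ih]
      rfl
  rw [show (∃ k, (σ ^ p ^ k) x = x) ↔ ∃ k, (σ' ^ p ^ k) x = x by simp only [hpow]]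
  obtain ⟨m, hm⟩ := h σ' ((IntermediateField.mem_fixingSubgroup_iff _ _).2 fun y hy =>
    σ.commutes ⟨y, hy⟩)
  have hm' : ∀ y ∈ φ.torsionSet π, (σ' ^ p ^ m) y = y := fun y hy =>
    (IntermediateField.mem_fixingSubgroup_iff _ _).1 hm y (IntermediateField.subset_adjoin K _ hy)
  have hgen : ∀ y ∈ ⋃ n ≥ 1, φ.torsionSet (π ^ n), ∃ k, (σ' ^ p ^ k) y = y := by
    intro y hy
    obtain ⟨n, -, hy⟩ := Set.mem_iUnion₂.1 hy
    obtain ⟨k, hk⟩ := φ.exists_pow_apply_eq (p := p) hm' n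
    refine ⟨m + k, ?_⟩
    rw [pow_add, pow_mul]
    exact hk y hy
  have hx : x ∈ IntermediateField.adjoin K (⋃ n ≥ 1, φ.torsionSet (π ^ n)) := hx
  obtain ⟨S, hS, hxS⟩ : ∃ S : Finset (SeparableClosure K), (S : Set (SeparableClosure K)) ⊆
      (⋃ n ≥ 1, φ.torsionSet (π ^ n)) ∧
      x ∈ IntermediateField.adjoin K (S : Set (SeparableClosure K)) :=
    IntermediateField.exists_finset_of_mem_adjoin hx
  obtain ⟨k, hk⟩ := IntermediateField.exists_pow_apply_eq_of_finite (p := p) (σ := σ')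
    S.finite_toSet fun y hy => hgen y (hS hy)
  exact ⟨k, IntermediateField.apply_eq_of_adjoin hk hxS⟩

theorem isPExtension_of_isProPExtension {p : ℕ} [Fact p.Prime]
    (φ : DrinfeldModule ι r) (hr : 0 < r) {π : Fq[X]} (hπ : π ≠ 0)
    (h : IsProPExtension p (φ.interField π)
      (IntermediateField.extendScalars (φ.interField_le_powTorsionField π))) :
    IsPExtension p (φ.interField π)
      (IntermediateField.extendScalars (φ.interField_le_torsionField π)) := by
  have := φ.finiteDimensional_torsionField hr hπ
  have h1 := IntermediateField.isGalois_extendScalars (φ.interField_le_powTorsionField π)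
  have h2 := IntermediateField.isGalois_extendScalars (φ.interField_le_torsionField π)
  have h3 : FiniteDimensional (φ.interField π)
      (IntermediateField.extendScalars (φ.interField_le_torsionField π)) := by
    have : FiniteDimensional K
        (IntermediateField.extendScalars (φ.interField_le_torsionField π)) :=
      inferInstanceAs (FiniteDimensional K (φ.torsionField π))
    exact FiniteDimensional.right K (φ.interField π) _
  refine ⟨h3, h2, (isPGroup_iff_forall_exists _).2 fun σ => ?_⟩
  have h4 : IntermediateField.extendScalars (φ.interField_le_torsionField π) ≤
      IntermediateField.extendScalars (φ.interField_le_powTorsionField π) :=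
    φ.torsionField_le_powTorsionField π
  exact h.exists_pow_mem_fixingSubgroup h4 σ

end DrinfeldModule

/-! ### Extending places, and good reduction implies unramified. -/

namespace ValuationSubring

variable {K L : Type*} [Field K] [Field L]

/-- Every valuation ring extends to an extension field. -/
theorem exists_comap_eq (v : ValuationSubring K) (f : K →+* L) :
    ∃ V : ValuationSubring L, V.comap f = v := by
  obtain ⟨V, hV, hloc⟩ := IsLocalRing.exists_factor_valuationRing (f.comp v.subtype)
  refine ⟨V, ?_⟩
  ext x
  rw [mem_comap]
  refine ⟨fun hx => ?_, fun hx => hV ⟨x, hx⟩⟩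
  rcases v.mem_or_inv_mem x with h | h
  · exact h
  rcases eq_or_ne x 0 with rfl | hx0
  · exact v.zero_mem
  have hunit : IsUnit ((f.comp v.subtype).codRestrict V.toSubring hV ⟨x⁻¹, h⟩) := by
    refine IsUnit.of_mul_eq_one (⟨f x, hx⟩ : V) (Subtype.ext ?_)
    change f x⁻¹ * f x = 1
    rw [← map_mul, inv_mul_cancel₀ hx0, map_one]
  obtain ⟨y, hy⟩ := (hloc.map_nonunit _ hunit).exists_right_inv
  have hy' : x⁻¹ * y.1 = 1 := congrArg Subtype.val hy
  have hxy : x = y.1 := by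
    rw [← mul_one x, ← hy', mul_inv_cancel_left₀ hx0]
  rw [hxy]
  exact y.2

/-- Algebraic elements are integral over a valuation ring containing the base field, and such a ring
is integrally closed. Hence restricting a finite place to a subfield leaves it nontrivial. -/
theorem eq_top_of_comap_eq_top [Algebra K L] [Algebra.IsAlgebraic K L] {W : ValuationSubring L}
    (h : W.comap (algebraMap K L) = ⊤) : W = ⊤ := by
  refine _root_.eq_top_iff.2 fun x _ => ?_
  let f : K →+* W := (algebraMap K L).codRestrict W.toSubring fun y => by
    have : y ∈ W.comap (algebraMap K L) := h ▸ mem_top y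
    exact this
  obtain ⟨q, hq, hqx⟩ := Algebra.IsIntegral.isIntegral (R := K) x
  have hint : IsIntegral W x := ⟨q.map f, hq.map f, by rw [eval₂_map]; exact hqx⟩
  obtain ⟨y, hy⟩ := IsIntegrallyClosed.isIntegral_iff.1 hint
  rw [← hy]
  exact y.2

end ValuationSubring

/-- An automorphism of a field generated by a set is determined by its action on the set. -/
theorem IntermediateField.algEquiv_eq_one {K L Ω : Type*} [Field K] [Field L] [Field Ω]
    [Algebra K L] [Algebra L Ω] [Algebra K Ω] [IsScalarTower K L Ω] [IsGalois L Ω]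
    {M : IntermediateField L Ω} [Normal L M] {S : Set Ω}
    (hSM : S ⊆ M) (hMS : ∀ x ∈ M, x ∈ IntermediateField.adjoin K S) {σ : M ≃ₐ[L] M}
    (h : ∀ x (hx : x ∈ S), σ ⟨x, hSM hx⟩ = ⟨x, hSM hx⟩) : σ = 1 := by
  obtain ⟨τ, rfl⟩ := AlgEquiv.restrictNormalHom_surjective (F := L) (K₁ := M) Ω σ
  ext x
  rw [AlgEquiv.restrictNormalHom_apply]
  refine IntermediateField.apply_eq_of_adjoin (σ := τ.restrictScalars K) (fun y hy => ?_)
    (hMS x.1 x.2)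
  have := congrArg Subtype.val (h y hy)
  rwa [AlgEquiv.restrictNormalHom_apply] at this

namespace DrinfeldModule

variable {Fq K : Type*} [Field Fq] [Finite Fq] [Field K] {ι : Fq[X] →+* K} {r : ℕ}

/-- A field generated by `π`-power division points of a Drinfeld module with a good model has
trivial inertia. -/
theorem IsGoodModel.inertiaSubgroup_eq_bot {L Ω : Type*} [Field L] [Field Ω] [Algebra K L]
    [Algebra L Ω] [Algebra K Ω] [IsScalarTower K L Ω] [IsGalois L Ω] {M : IntermediateField L Ω}
    [Normal L M] {S : Set Ω} (hSM : S ⊆ M) (hMS : ∀ x ∈ M, x ∈ IntermediateField.adjoin K S)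
    {φ : DrinfeldModule ι r} (hr : 0 < r) {π : Fq[X]}
    (hS : ∀ x ∈ S, ∃ n, TwistedPoly.eval ι Ω (φ.toRingHom (π ^ n)) x = 0)
    {W : ValuationSubring M} {u : K} {hu : u ≠ 0}
    (h : (φ.conj u hu).IsGoodModel (W.valuation.comap (algebraMap K M)))
    (hι : ∀ a, W.valuation (algebraMap K M (ι a)) ≤ 1) (hmon : π.Monic)
    (hπ : W.valuation (algebraMap K M (ι π)) = 1) : W.inertiaSubgroup L = ⊥ := by
  rw [eq_bot_iff]
  intro σ hσ
  rw [Subgroup.mem_bot]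
  refine Subtype.ext ?_
  refine IntermediateField.algEquiv_eq_one (K := K) hSM hMS fun x hx => ?_
  obtain ⟨n, hn⟩ := hS x hx
  refine h.inertia_apply_eq hr hι (hmon.pow n) (by rw [map_pow, map_pow, map_pow, hπ, one_pow])
    hσ (?_ : TwistedPoly.eval ι M (φ.toRingHom (π ^ n)) ⟨x, hSM hx⟩ = 0)
  have h1 := TwistedPoly.eval_algHom (M.val.restrictScalars K) (φ.toRingHom (π ^ n)) ⟨x, hSM hx⟩
  refine Subtype.ext (h1.trans hn)

/-- The coefficients are `ι X` and the unit one at every place. Conjugation by `1` only matches the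
form required by `IsGoodModel.inertiaSubgroup_eq_bot`. -/
theorem isGoodModel_carlitz {Γ₀ : Type*} [LinearOrderedCommGroupWithZero Γ₀] {v : Valuation K Γ₀}
    (hι : ∀ a, v (ι a) ≤ 1) : ((carlitz ι).conj 1 one_ne_zero).IsGoodModel v := by
  have h0 : (carlitz ι).coeff 0 = ι X := (carlitz ι).coeff_zero
  have h1 : (carlitz ι).coeff 1 = 1 := by
    simp [coeff, carlitz, TwistedPoly.coeff_add, TwistedPoly.coeff_const, TwistedPoly.coeff_tau]
  have h2 : ∀ i, ((carlitz ι).conj 1 one_ne_zero).coeff i = (carlitz ι).coeff i := by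
    intro i
    rw [coeff_conj, one_mul, inv_one, one_pow, mul_one]
  refine ⟨fun i => ?_, by rw [h2, h1, map_one]⟩
  rw [h2]
  rcases lt_trichotomy i 1 with h | rfl | h
  · obtain rfl : i = 0 := by omega
    rw [h0]
    exact hι X
  · rw [h1, map_one]
  · have : (carlitz ι).coeff i = 0 := (carlitz ι).coeff_eq_zero i h
    rw [this, map_zero]
    exact zero_le

theorem isGoodModel_iff_of_comap_eq {L : Type*} [Field L] [Algebra K L] {φ : DrinfeldModule ι r}
    {v : ValuationSubring K} {W : ValuationSubring L} (h : W.comap (algebraMap K L) = v) :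
    φ.IsGoodModel (W.valuation.comap (algebraMap K L)) ↔ φ.IsGoodModel v.valuation := by
  subst h
  simp only [IsGoodModel, ValuationSubring.comap_valuation_le_one_iff,
    ValuationSubring.comap_valuation_eq_one_iff, Valuation.comap_apply]

end DrinfeldModule

namespace DrinfeldModule

variable {Fq K : Type*} [Field Fq] [Finite Fq] [Field K] {ι : Fq[X] →+* K} {r : ℕ}

/-- Good reduction outside `π` implies that the extension generated by `π`-power division points
is unramified outside `π`. -/
theorem HasGoodReductionOutside.isUnramifiedAtPlace {φ : DrinfeldModule ι r} (hr : 0 < r)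
    {π : Fq[X]} (hmon : π.Monic) (h : φ.HasGoodReductionOutside π)
    (w : FinitePlace ((algebraMap K (φ.interField π)).comp ι)) (hw : ¬ w.LiesAbove π) :
    IsUnramifiedAtPlace (φ.interField π)
      (IntermediateField.extendScalars (φ.interField_le_powTorsionField π)) w.ring := by
  have hgal := IntermediateField.isGalois_extendScalars (φ.interField_le_powTorsionField π)
  intro W hW
  let v : FinitePlace ι :=
    { ring := w.ring.comap (algebraMap K (φ.interField π))
      ne_top := fun h => w.ne_top (ValuationSubring.eq_top_of_comap_eq_top h)
      map_mem := w.map_mem }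
  have hv : ∀ a, v.ring.valuation (ι a) < 1 ↔
      w.ring.valuation (algebraMap K (φ.interField π) (ι a)) < 1 := by
    intro a
    have := ValuationSubring.comap_valuation_lt_iff w.ring (algebraMap K (φ.interField π)) (ι a) 1
    rwa [map_one, map_one, map_one] at this
  have hvπ : ¬ v.LiesAbove π := fun hlt => hw ((hv π).1 hlt)
  obtain ⟨u, hu, hgood⟩ := (hasGoodReduction_iff φ hr v).1 (h v hvπ)
  have hWv : W.comap (algebraMap K
      (IntermediateField.extendScalars (φ.interField_le_powTorsionField π))) = v.ring := by
    rw [IsScalarTower.algebraMap_eq K (φ.interField π), ← ValuationSubring.comap_comap, hW]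
  refine IsGoodModel.inertiaSubgroup_eq_bot (K := K) (S := ⋃ n ≥ 1, φ.torsionSet (π ^ n))
    (M := IntermediateField.extendScalars (φ.interField_le_powTorsionField π))
    (IntermediateField.subset_adjoin K (⋃ n ≥ 1, φ.torsionSet (π ^ n))) (fun x hx => hx) hr (φ := φ) (π := π) (fun x hx => ?_)
    ((isGoodModel_iff_of_comap_eq hWv).2 hgood) (fun a => ?_) hmon ?_
  · obtain ⟨n, -, hx⟩ := Set.mem_iUnion₂.1 hx
    exact ⟨n, hx⟩
  · rw [← ValuationSubring.comap_valuation_le_one_iff, hWv]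
    exact v.valuation_map_le_one a
  · rw [← ValuationSubring.comap_valuation_eq_one_iff, hWv]
    exact v.valuation_map_eq_one hvπ

end DrinfeldModule

/-! ### Unramified implies good reduction. -/

theorem exists_isFunctionField_comp (Fq K L : Type*) [Field Fq] [Field K] [Field L]
    [Algebra (RatFunc Fq) K] [FiniteDimensional (RatFunc Fq) K] [Algebra K L]
    [FiniteDimensional K L] :
    ∃ n, IsFunctionField ((algebraMap K L).comp (structureMap Fq K)) n := by
  let : Algebra (RatFunc Fq) L := ((algebraMap K L).comp (algebraMap (RatFunc Fq) K)).toAlgebra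
  have : IsScalarTower (RatFunc Fq) K L := IsScalarTower.of_algebraMap_eq fun _ => rfl
  have : FiniteDimensional (RatFunc Fq) L := FiniteDimensional.trans (RatFunc Fq) K L
  exact ⟨_, isFunctionField_structureMap Fq L⟩

namespace DrinfeldModule

variable {Fq K : Type*} [Field Fq] [Finite Fq] [Field K] [Algebra (RatFunc Fq) K]
  [FiniteDimensional (RatFunc Fq) K] {r : ℕ}

/-- The Carlitz module generates an extension that is unramified outside `π`, so that it does not
enlarge the value group. -/
theorem exists_valuation_eq_of_mem_carlitz {π : Fq[X]} (hmon : π.Monic)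
    (v : FinitePlace (structureMap Fq K)) (hv : ¬ v.LiesAbove π)
    {V : ValuationSubring (SeparableClosure K)}
    (hV : V.comap (algebraMap K (SeparableClosure K)) = v.ring) {x : SeparableClosure K}
    (hx : x ∈ (carlitz (structureMap Fq K)).torsionField π) (hx0 : x ≠ 0) :
    ∃ y : K, V.valuation (algebraMap K (SeparableClosure K) y) = V.valuation x := by
  have hK := isFunctionField_structureMap Fq K
  have := v.isDiscreteValuationRing hK
  have := v.perfectField hK
  set C := (carlitz (structureMap Fq K)).torsionField π with hC
  let W : ValuationSubring C := V.comap (algebraMap C (SeparableClosure K))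
  have hW : W.comap (algebraMap K C) = v.ring := by
    rw [ValuationSubring.comap_comap, ← IsScalarTower.algebraMap_eq, hV]
  have hι : ∀ a, W.valuation (algebraMap K C (structureMap Fq K a)) ≤ 1 := by
    intro a
    rw [← ValuationSubring.comap_valuation_le_one_iff, hW]
    exact v.valuation_map_le_one a
  have hI : W.inertiaSubgroup K = ⊥ :=
    IsGoodModel.inertiaSubgroup_eq_bot (K := K) (M := C)
      (S := (carlitz (structureMap Fq K)).torsionSet π)
      (IntermediateField.subset_adjoin K ((carlitz (structureMap Fq K)).torsionSet π))
      (fun x hx => hx) one_pos (φ := carlitz (structureMap Fq K)) (π := π)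
      (fun x hx => ⟨1, by rw [pow_one]; exact hx⟩) (isGoodModel_carlitz hι) hι hmon
      (by
        rw [← ValuationSubring.comap_valuation_eq_one_iff, hW]
        exact v.valuation_map_eq_one hv)
  obtain ⟨y, hy⟩ := ValuationSubring.exists_valuation_eq_of_inertiaSubgroup_eq_bot hW hI
    (x := (⟨x, hx⟩ : C)) (fun h => hx0 (congrArg Subtype.val h))
  exact ⟨y, (ValuationSubring.comap_valuation_eq_iff V _ _ _).1 hy⟩

/-- If the extension generated by `π`-power division points is unramified outside `π`, then
`φ` has good reduction outside `π`. -/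
theorem hasGoodReductionOutside_of_isUnramifiedAtPlace (φ : DrinfeldModule (structureMap Fq K) r)
    (hr : 0 < r) {π : Fq[X]} (hmon : π.Monic) (hπ : Irreducible π)
    (h : ∀ w : FinitePlace ((algebraMap K (φ.interField π)).comp (structureMap Fq K)),
      ¬ w.LiesAbove π → IsUnramifiedAtPlace (φ.interField π)
        (IntermediateField.extendScalars (φ.interField_le_powTorsionField π)) w.ring) :
    φ.HasGoodReductionOutside π := by
  intro v hv
  rw [hasGoodReduction_iff φ hr]
  -- One extension of the place to the separable closure induces compatible places on all the fields
  -- involved.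
  obtain ⟨V, hV⟩ := v.ring.exists_comap_eq (algebraMap K (SeparableClosure K))
  have hK := isFunctionField_structureMap Fq K
  set L := φ.interField π with hL
  set M := IntermediateField.extendScalars (φ.interField_le_powTorsionField π) with hM
  have hgal : IsGalois L M :=
    IntermediateField.isGalois_extendScalars (φ.interField_le_powTorsionField π)
  have hwv : (V.comap (algebraMap L (SeparableClosure K))).comap (algebraMap K L) = v.ring := by
    rw [ValuationSubring.comap_comap, ← IsScalarTower.algebraMap_eq, hV]
  let w : FinitePlace ((algebraMap K L).comp (structureMap Fq K)) :=
    { ring := V.comap (algebraMap L (SeparableClosure K))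
      ne_top := by
        intro htop
        rw [htop] at hwv
        exact v.ne_top (hwv.symm.trans (eq_top_iff.2 fun x _ => ValuationSubring.mem_top _))
      map_mem := fun a => by
        have : structureMap Fq K a ∈ (V.comap (algebraMap L (SeparableClosure K))).comap
          (algebraMap K L) := hwv ▸ v.map_mem a
        exact this }
  have hw : ¬ w.LiesAbove π := by
    intro hlt
    have h1 : w.ring.valuation (algebraMap K L (structureMap Fq K π)) = 1 := by
      rw [← ValuationSubring.comap_valuation_eq_one_iff, hwv]
      exact v.valuation_map_eq_one hv
    exact hlt.ne h1
  have hI := h w hw (V.comap (algebraMap M (SeparableClosure K))) (by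
    rw [ValuationSubring.comap_comap, ← IsScalarTower.algebraMap_eq])
  have : FiniteDimensional K (φ.torsionField π) :=
    φ.finiteDimensional_torsionField hr hπ.ne_zero
  have : FiniteDimensional K L :=
    FiniteDimensional.of_injective
      (IntermediateField.inclusion (φ.interField_le_torsionField π)).toLinearMap
      (IntermediateField.inclusion (φ.interField_le_torsionField π)).injective
  obtain ⟨n, hLf⟩ := exists_isFunctionField_comp Fq K L
  have := w.isDiscreteValuationRing hLf
  have := w.perfectField hLf
  have hval : ∀ x ∈ φ.powTorsionField π, x ≠ 0 →
      ∃ y : K, V.valuation (algebraMap K (SeparableClosure K) y) = V.valuation x := by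
    intro x hx hx0
    obtain ⟨y, hy⟩ := ValuationSubring.exists_valuation_eq_of_inertiaSubgroup_eq_bot
      (w := w.ring) (W := V.comap (algebraMap M (SeparableClosure K)))
      (by rw [ValuationSubring.comap_comap, ← IsScalarTower.algebraMap_eq]) hI
      (x := (⟨x, hx⟩ : M)) (fun h => hx0 (congrArg Subtype.val h))
    have hy' : V.valuation (y : SeparableClosure K) = V.valuation x :=
      (ValuationSubring.comap_valuation_eq_iff V _ _ _).1 hy
    have hy0 : (y : SeparableClosure K) ≠ 0 := by
      intro h0
      rw [h0, map_zero, eq_comm, Valuation.zero_iff] at hy'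
      exact hx0 hy'
    -- The element `y` lies in $L$, hence in $K(\mathcal C[\pi])$, so its value is already taken on
    -- $K$.
    obtain ⟨z, hz⟩ := exists_valuation_eq_of_mem_carlitz hmon v hv hV y.2.2 hy0
    exact ⟨z, hz.trans hy'⟩
  obtain ⟨μ, hμ⟩ := v.exists_nat_order hK
  have hlt : ∀ x y : K, v.ring.valuation x < v.ring.valuation y ↔
      V.valuation (algebraMap K (SeparableClosure K) x) <
        V.valuation (algebraMap K (SeparableClosure K) y) :=
    hV ▸ fun x y => ValuationSubring.comap_valuation_lt_iff V _ x y
  obtain ⟨u, hu, hgood⟩ := exists_good_model V.valuation φ hr hmon hπ.natDegree_pos.ne'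
    (by
      rw [← ValuationSubring.comap_valuation_eq_one_iff, hV]
      exact v.valuation_map_eq_one hv)
    (fun x hx hx0 => by
      refine hval x ?_ hx0
      obtain ⟨n, hn⟩ := hx
      -- The exponent zero is allowed in `powTorsionPoints` but not in the union generating the
      -- field; raising it by one is harmless.
      refine IntermediateField.subset_adjoin K _ (Set.mem_iUnion₂.2 ⟨n + 1, by omega, ?_⟩)
      change TwistedPoly.eval _ _ (φ.toRingHom (π ^ (n + 1))) x = 0
      rw [pow_succ', map_mul, map_mul]
      change TwistedPoly.eval _ _ _ (TwistedPoly.eval _ _ _ x) = 0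
      rw [hn, map_zero])
    μ (fun x y hx hxy => by
      refine hμ x y ?_ ((hlt x y).2 hxy)
      have := (hlt 1 x).2
      rw [map_one, map_one, map_one] at this
      exact this hx)
  exact ⟨u, hu, (isGoodModel_iff_of_comap_eq hV).1 hgood⟩

end DrinfeldModule

/-! ### The equivalence. -/

theorem mainTheorem4 {Fq : Type*} [Field Fq] [Finite Fq] (p : ℕ) [Fact p.Prime] [CharP Fq p]
    {K : Type*} [Field K] [Algebra (RatFunc Fq) K] [FiniteDimensional (RatFunc Fq) K]
    (r : ℕ) (hr : 0 < r) (φ : DrinfeldModule (structureMap Fq K) r)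
    (π : Fq[X]) (hπ_monic : π.Monic) (hπ : Irreducible π) :
    [φ.ConditionDR1 p π, φ.ConditionDR2 p π, φ.ConditionDR3 π].TFAE := by
  have hιπ : structureMap Fq K π ≠ 0 :=
    (map_ne_zero_iff _ (isFunctionField_structureMap Fq K).injective).2 hπ.ne_zero
  have : CharP K p :=
    charP_of_injective_ringHom ((structureMap Fq K).comp C).injective p
  tfae_have 1 → 2 := fun h =>
    ⟨φ.hasGoodReductionOutside_of_isUnramifiedAtPlace hr hπ_monic hπ h.2,
      φ.isPExtension_of_isProPExtension hr hπ.ne_zero h.1⟩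
  tfae_have 2 → 1 := fun h =>
    ⟨φ.isProPExtension_of_isPExtension hr hπ.ne_zero h.2,
      fun w hw => h.1.isUnramifiedAtPlace hr hπ_monic w hw⟩
  tfae_have 2 ↔ 3 := and_congr Iff.rfl
    ((φ.isPExtension_torsionField_iff hr hπ hιπ).trans
      (φ.isCarlitzTriangular_iff (p := p) hr hπ hιπ).symm)
  tfae_finish
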